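/- All graphs are finite and simple. For a graph $G$ on $n$ vertices let $L(G)=D(G)-A(G)$ be its Laplacian matrix, and for an interval $I$ let $m_G I$ denote the number of eigenvalues of $L(G)$, counted with multiplicity, that lie in $I$. The girth of a graph is the length of a shortest cycle. Let $K_{p,q}$ be the complete bipartite graph with parts of sizes $p$ and $q$, and $C_m$ the cycle on $m$ vertices. For $n\ge 5$ let $U_n$ be the graph obtained from $C_{n-1}$ by joining one new vertex to one vertex of the cycle. For $n\ge 6$, writing $C_{n-2}=u_1u_2\dots u_{n-2}u_1$, let $Y_{n,i}$ $(1\le i\le\lceil\frac{n-1}{2}\rceil)$ be the graph obtained from $C_{n-2}$ by adding two new vertices $w,z$ and the edges $u_1w$ and $u_iz$. Let $v$ be one of the two vertices of degree $3$ of $K_{2,3}$, and let $K_{2,3}^{*}$, $K_{2,3}^{**}$, $K_{2,3}^{***}$ be the graphs obtained from $K_{2,3}$ by subdividing once each of, respectively, one, two, or all three of the edges incident with $v$ (they have $6,7,8$ vertices). **Theorem.** Let $G$ be a connected graph of order $n$ with girth $g\ge 4$, and let $k$ be an integer with $1\le k\le\min\{g-1,n-g\}$. Then \[ m_G[n-g-k+4,\,n]\le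 n-g . \] If $k=1$, equality holds if and only if $g=n-1$; moreover, $g=n-1$ if and only if $G\cong K_{2,3}$ or $G\cong U_n$. If $k=2$, equality holds if and only if one of the following holds: - $n=6$ and $G\cong K_{2,4}$ or $G\cong K_{2,3}^{*}$; - $n=7$ and $G\cong K_{2,3}^{**}$ or $G\cong Y_{7,3}$; - $n=8$ and $G\cong K_{2,3}^{***}$ or $G\cong Y_{8,4}$; - $n\ge 9$ and $G\cong Y_{n,i}$ for some integer $i$ with $3\le i\le\lceil\frac{n-1}{2}\rceil$. -/

import Mathlib

namespace GirthLap

/-- The number of Laplacian eigenvalues of `G`, counted with multiplicity, that lie in `I`. -/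
noncomputable def lapCount {V : Type*} [Fintype V] [DecidableEq V] (G : SimpleGraph V)
    [DecidableRel G.Adj] (I : Set ℝ) : ℕ :=
  Set.ncard {v : V | (G.isHermitian_lapMatrix ℝ).eigenvalues v ∈ I}

/-- The cycle `u_1 u_2 … u_m u_1` (the vertex `u_i` is `Sum.inl a` with `a + 1 = i`) together with
`r` further vertices, the `j`-th of which is joined to `u_{p j}` and to nothing else. -/
def pendantCycle (m : ℕ) {r : ℕ} (p : Fin r → ℕ) : SimpleGraph (Fin m ⊕ Fin r) where
  Adj
    | Sum.inl a, Sum.inl b => (SimpleGraph.cycleGraph m).Adj a b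
    | Sum.inl a, Sum.inr j => (a : ℕ) + 1 = p j
    | Sum.inr j, Sum.inl a => (a : ℕ) + 1 = p j
    | Sum.inr _, Sum.inr _ => False
  symm := ⟨by
    rintro (a | i) (b | j) h
    · exact SimpleGraph.Adj.symm h
    · exact h
    · exact h
    · exact h⟩
  loopless := ⟨by
    rintro (a | i) h
    · exact SimpleGraph.irrefl _ h
    · exact h⟩

/-- `U_n`: the cycle `C_{n-1}` with one pendant vertex. -/
def U (n : ℕ) : SimpleGraph (Fin (n - 1) ⊕ Fin 1) := pendantCycle (n - 1) ![1]

/-- `Y_{n,i}`: the cycle `C_{n-2}` with pendant vertices attached at `u_1` and at `u_i`. -/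
def Y (n i : ℕ) : SimpleGraph (Fin (n - 2) ⊕ Fin 2) := pendantCycle (n - 2) ![1, i]

/-- `K_{2,3}` with parts `{0, 1}` and `{2, 3, 4}`, with the edge `14` subdivided by `5`. -/
def K23s : SimpleGraph (Fin 6) :=
  SimpleGraph.fromEdgeSet {s(0, 2), s(0, 3), s(0, 4), s(1, 2), s(1, 3), s(4, 5), s(5, 1)}

/-- `K_{2,3}` with parts `{0, 1}` and `{2, 3, 4}`, with the edge `14` subdivided by `5` and the
edge `13` subdivided by `6`. -/
def K23ss : SimpleGraph (Fin 7) :=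
  SimpleGraph.fromEdgeSet
    {s(0, 2), s(0, 3), s(0, 4), s(1, 2), s(4, 5), s(5, 1), s(3, 6), s(6, 1)}

/-- `K_{2,3}` with parts `{0, 1}` and `{2, 3, 4}`, with the edge `14` subdivided by `5`, the
edge `13` subdivided by `6` and the edge `12` subdivided by `7`. -/
def K23sss : SimpleGraph (Fin 8) :=
  SimpleGraph.fromEdgeSet
    {s(0, 2), s(0, 3), s(0, 4), s(4, 5), s(5, 1), s(3, 6), s(6, 1), s(2, 7), s(7, 1)}

/-- `G`, of order `n`, is one of the listed graphs on `n` vertices. -/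
def InList {V : Type*} (G : SimpleGraph V) (n : ℕ) : Prop :=
  (n = 6 ∧ (Nonempty (G ≃g completeBipartiteGraph (Fin 2) (Fin 4)) ∨ Nonempty (G ≃g K23s))) ∨
  (n = 7 ∧ (Nonempty (G ≃g K23ss) ∨ Nonempty (G ≃g Y 7 3))) ∨
  (n = 8 ∧ (Nonempty (G ≃g K23sss) ∨ Nonempty (G ≃g Y 8 4))) ∨
  (9 ≤ n ∧ ∃ i : ℕ, 3 ≤ i ∧ i ≤ ⌈((n : ℝ) - 1) / 2⌉₊ ∧ Nonempty (G ≃g Y n i))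

end GirthLap

/-! By the Courant–Fischer principle, at most `c` eigenvalues are `≥ T` once `c` linear conditions
on `f` force the Laplacian form below `T * ‖f‖ ^ 2` (`Below`, `lapCount_le_of_below`). At least `c`
eigenvalues lie in `[T, n]` once some `c`-dimensional test space has form at least `T * ‖f‖ ^ 2`
(`Above`, `le_lapCount_of_above`), since no eigenvalue exceeds `n`.

Passing to an induced subgraph costs, for each vertex dropped, one condition (`f v = 0`) and one
unit of the threshold (`Below.of_induce`). A connected graph shrinks to a connected induced subgraph
on `g + m` vertices containing a shortest cycle (`below_of_forall_card`), so only graphs slightly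
larger than their girth matter. The inequality needs `k` conditions for threshold 4 on `g + k`
vertices (`below_four`). Equality fails for `n > g + k` because on `g + 2`, respectively `g + 3`,
vertices one, respectively two, conditions suffice for threshold 5 (`below_one_five`,
`below_two_five`). For `k = 2` and `n = g + 2`, one condition suffices for threshold 4 unless the
graph is listed (`below_four_or_inList`).

For `g ≥ 5` the conditions kill vertices or contract edges until the degrees are at most two. The
Laplacian and the signless Laplacian add up to `2D`, so the form is then at most `4 * ‖f‖ ^ 2`,
strictly unless some component avoids both the zeros and the vertices of degree below two
(`qf_lt_four`); a single vertex of degree three keeps it below 5 (`qf_lt_five`). The geometric input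
is that two paths with the same ends and total length below `g` coincide (`NoShortCycle.path_eq`): a
shortest cycle has no chord, an outside vertex has at most one neighbour on it, and branches leaving
it must be long. For `g = 4` there are at most seven vertices and no triangle, and a finite list of
shapes is settled by sum-of-squares certificates.

In the other direction, the vector `(3, -1, -1, -1)` on a star `K_{1,3}` has Rayleigh quotient 4.
One star gives equality for `k = 1`; for `k = 2` two disjoint stars, or explicit pairs of vectors,
do so (`above_two_of_inList`). -/

namespace GirthLap

open Finset

/-! ### Counting eigenvalues by linear conditions and by test spaces. -/

section Spectral

variable {V : Type*} [Fintype V]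

open Classical in
/-- The Laplacian quadratic form: the sum of `(f u - f v) ^ 2` over the edges `uv`. -/
noncomputable def qf (G : SimpleGraph V) (f : V → ℝ) : ℝ :=
  (∑ i, ∑ j, if G.Adj i j then (f i - f j) ^ 2 else 0) / 2

/-- At most `c` linear conditions force the Laplacian quadratic form strictly below
`T * ‖f‖ ^ 2`. -/
def Below (G : SimpleGraph V) (c : ℕ) (T : ℝ) : Prop :=
  ∃ L : Finset (Module.Dual ℝ (V → ℝ)), L.card ≤ c ∧
    ∀ f : V → ℝ, f ≠ 0 → (∀ l ∈ L, l f = 0) → qf G f < T * ∑ v, f v ^ 2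

/-- There is a `c`-dimensional space on which the Laplacian quadratic form is at least
`T * ‖f‖ ^ 2`. -/
def Above (G : SimpleGraph V) (c : ℕ) (T : ℝ) : Prop :=
  ∃ ψ : (Fin c → ℝ) →ₗ[ℝ] (V → ℝ), Function.Injective ψ ∧
    ∀ s, T * ∑ v, ψ s v ^ 2 ≤ qf G (ψ s)

/-- Rank–nullity for `e ↦ (l (φ e))`, a map into a space of dimension `L.card`. Injectivity of `φ`
is left to the applications. -/
theorem exists_ne_zero_of_card_lt {E F : Type*} [AddCommGroup E] [Module ℝ E]
    [FiniteDimensional ℝ E] [AddCommGroup F] [Module ℝ F] (φ : E →ₗ[ℝ] F)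
    (L : Finset (Module.Dual ℝ F)) (h : L.card < Module.finrank ℝ E) :
    ∃ e : E, e ≠ 0 ∧ ∀ l ∈ L, l (φ e) = 0 := by
  let Φ : E →ₗ[ℝ] (L → ℝ) := LinearMap.pi fun l => (l : Module.Dual ℝ F).comp φ
  have hk : LinearMap.ker Φ ≠ ⊥ := by
    apply LinearMap.ker_ne_bot_of_finrank_lt
    simpa using h
  obtain ⟨e, he, he0⟩ := Submodule.exists_mem_ne_zero_of_ne_bot hk
  refine ⟨e, he0, fun l hl => ?_⟩
  have := congrFun (LinearMap.mem_ker.1 he) ⟨l, hl⟩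
  simpa [Φ] using this

theorem sum_sq_pos {f : V → ℝ} (hf : f ≠ 0) : 0 < ∑ v, f v ^ 2 := by
  obtain ⟨v, hv⟩ := Function.ne_iff.1 hf
  exact Finset.sum_pos' (fun _ _ => sq_nonneg _) ⟨v, mem_univ _, by
    have : f v ≠ 0 := hv
    positivity⟩

theorem qf_eq_dotProduct [DecidableEq V] (G : SimpleGraph V) [DecidableRel G.Adj] (f : V → ℝ) :
    qf G f = f ⬝ᵥ (G.lapMatrix ℝ).mulVec f := by
  rw [← Matrix.toLinearMap₂'_apply', G.lapMatrix_toLinearMap₂' ℝ, qf]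
  congr!

/-- `φ` takes coordinates in an orthonormal eigenbasis: Parseval gives the norm, and symmetry of the
Laplacian lets it act on the eigenvectors. -/
theorem exists_diagonalization [DecidableEq V] (G : SimpleGraph V) [DecidableRel G.Adj] :
    ∃ φ : (V → ℝ) ≃ₗ[ℝ] (V → ℝ), ∀ f, ∑ v, f v ^ 2 = ∑ v, φ f v ^ 2 ∧
      qf G f = ∑ v, (G.isHermitian_lapMatrix ℝ).eigenvalues v * φ f v ^ 2 := by
  set hA := G.isHermitian_lapMatrix ℝ
  let b := hA.eigenvectorBasis
  let φ : (V → ℝ) ≃ₗ[ℝ] (V → ℝ) :=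
    ((WithLp.linearEquiv 2 ℝ (V → ℝ)).symm.trans b.repr.toLinearEquiv).trans
      (WithLp.linearEquiv 2 ℝ (V → ℝ))
  have hφ : ∀ f v, φ f v = ⇑(b v) ⬝ᵥ f := by
    intro f v
    have : φ f v = b.repr (WithLp.toLp 2 f) v := rfl
    rw [this, b.repr_apply_apply, EuclideanSpace.inner_eq_star_dotProduct]
    simp [dotProduct_comm]
  have hpars : ∀ f h : V → ℝ, f ⬝ᵥ h = ∑ v, φ f v * φ h v := by
    intro f h
    have := b.sum_inner_mul_inner (WithLp.toLp 2 f) (WithLp.toLp 2 h)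
    rw [EuclideanSpace.inner_eq_star_dotProduct] at this
    simp only [star_trivial] at this
    rw [dotProduct_comm, ← this]
    refine sum_congr rfl fun v _ => ?_
    rw [hφ, hφ, EuclideanSpace.inner_eq_star_dotProduct, EuclideanSpace.inner_eq_star_dotProduct]
    simp [dotProduct_comm]
  refine ⟨φ, fun f => ⟨?_, ?_⟩⟩
  · have := hpars f f
    simp only [dotProduct, ← sq] at this
    exact this
  · rw [qf_eq_dotProduct, hpars]
    refine sum_congr rfl fun v _ => ?_
    have : φ ((G.lapMatrix ℝ).mulVec f) v = hA.eigenvalues v * φ f v := by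
      rw [hφ, hφ, Matrix.dotProduct_mulVec, ← Matrix.mulVec_transpose,
        (G.isSymm_lapMatrix (R := ℝ)).eq, hA.mulVec_eigenvectorBasis, smul_dotProduct, smul_eq_mul]
    rw [this]; ring

/-- Comparison with the complete graph, whose form is `n * ‖f‖ ^ 2 - (∑ f) ^ 2`. -/
theorem qf_le_card_mul (G : SimpleGraph V) (f : V → ℝ) :
    qf G f ≤ Fintype.card V * ∑ v, f v ^ 2 := by
  classical
  have h1 : ∑ i, ∑ j, (if G.Adj i j then (f i - f j) ^ 2 else 0) ≤ ∑ i, ∑ j, (f i - f j) ^ 2 := by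
    refine sum_le_sum fun i _ => sum_le_sum fun j _ => ?_
    split_ifs
    · exact le_rfl
    · positivity
  have h2 : ∑ i, ∑ j, (f i - f j) ^ 2 = 2 * (Fintype.card V * ∑ v, f v ^ 2) - 2 * (∑ v, f v) ^ 2 :=
    by
    have : ∀ i j, (f i - f j) ^ 2 = f i ^ 2 + f j ^ 2 - 2 * (f i * f j) := by intros; ring
    simp_rw [this, sum_sub_distrib, sum_add_distrib, ← mul_sum, ← sum_mul]
    simp [← mul_sum]
    ring
  have h3 := sq_nonneg (∑ v, f v)
  unfold qf
  linarith

/-- The eigenvectors with eigenvalue in the interval span a space on which the form is at least `T *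
‖f‖ ^ 2`. If its dimension exceeded `c`, the `c` conditions would have a nonzero solution in it. -/
theorem lapCount_le_of_below [DecidableEq V] (G : SimpleGraph V) [DecidableRel G.Adj]
    {c : ℕ} {T : ℝ} (h : Below G c T) (b : ℝ) : lapCount G (Set.Icc T b) ≤ c := by
  classical
  obtain ⟨L, hL, hQ⟩ := h
  obtain ⟨φ, hφ⟩ := exists_diagonalization G
  by_contra! hc
  set A : Set V := {v | (G.isHermitian_lapMatrix ℝ).eigenvalues v ∈ Set.Icc T b} with hA
  have hcard : lapCount G (Set.Icc T b) = Fintype.card A := by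
    rw [lapCount, Set.ncard_eq_toFinset_card', Set.toFinset_card]
  let ext : (A → ℝ) →ₗ[ℝ] (V → ℝ) := Function.ExtendByZero.linearMap ℝ (Subtype.val : A → V)
  obtain ⟨e, he0, he⟩ := exists_ne_zero_of_card_lt (φ.symm.toLinearMap.comp ext) L (by
    rw [Module.finrank_fintype_fun_eq_card]; omega)
  have hin : ∀ v : A, ext e v = e v := fun v => Subtype.val_injective.extend_apply _ _ _
  have hout : ∀ v, v ∉ A → ext e v = 0 := fun v hv => by
    have : ¬∃ a : A, (a : V) = v := fun ⟨a, ha⟩ => hv (ha ▸ a.2)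
    exact Function.extend_apply' e (0 : V → ℝ) v this
  have hext : ext e ≠ 0 := by
    obtain ⟨v, hv⟩ := Function.ne_iff.1 he0
    exact Function.ne_iff.2 ⟨v, by rw [hin]; exact hv⟩
  have hf : φ.symm (ext e) ≠ 0 := by simpa using hext
  have := hQ _ hf he
  rw [(hφ _).1, (hφ _).2, mul_sum] at this
  simp only [LinearEquiv.apply_symm_apply] at this
  refine absurd this (not_lt.2 (sum_le_sum fun v _ => ?_))
  by_cases hv : v ∈ A
  · exact mul_le_mul_of_nonneg_right hv.1 (sq_nonneg _)
  · simp [hout v hv]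

theorem eigenvalues_le_card [DecidableEq V] (G : SimpleGraph V) [DecidableRel G.Adj] (v : V) :
    (G.isHermitian_lapMatrix ℝ).eigenvalues v ≤ Fintype.card V := by
  obtain ⟨φ, hφ⟩ := exists_diagonalization G
  have h := qf_le_card_mul G (φ.symm (Pi.single v 1))
  rw [(hφ _).1, (hφ _).2] at h
  simpa [Pi.single_apply] using h

/-- A test space of dimension larger than the count contains a nonzero vector orthogonal to all
eigenvectors with eigenvalue in the interval. Every other eigenvalue is below `T`, because none
exceeds `n`. -/
theorem le_lapCount_of_above [DecidableEq V] (G : SimpleGraph V) [DecidableRel G.Adj]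
    {c : ℕ} {T : ℝ} (h : Above G c T) {n : ℕ} (hn : Fintype.card V = n) :
    c ≤ lapCount G (Set.Icc T n) := by
  classical
  obtain ⟨ψ, hinj, hψ⟩ := h
  obtain ⟨φ, hφ⟩ := exists_diagonalization G
  by_contra! hc
  set A : Set V := {v | (G.isHermitian_lapMatrix ℝ).eigenvalues v ∈ Set.Icc T (n : ℝ)} with hA
  have hcard : lapCount G (Set.Icc T n) = A.toFinset.card := by
    rw [lapCount, Set.ncard_eq_toFinset_card']
  let L : Finset (Module.Dual ℝ (V → ℝ)) :=
    A.toFinset.image fun v => (LinearMap.proj v).comp φ.toLinearMap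
  obtain ⟨s, hs0, hs⟩ := exists_ne_zero_of_card_lt ψ L (by
    rw [Module.finrank_fintype_fun_eq_card, Fintype.card_fin]
    exact lt_of_le_of_lt card_image_le (by omega))
  have hzero : ∀ v ∈ A, φ (ψ s) v = 0 := fun v hv =>
    hs _ (mem_image.2 ⟨v, by simpa using hv, rfl⟩)
  have hne : φ (ψ s) ≠ 0 := by
    simpa using (map_ne_zero_iff ψ hinj).2 hs0
  have := hψ s
  rw [(hφ _).1, (hφ _).2, mul_sum] at this
  refine absurd this (not_le.2 ?_)
  obtain ⟨v, hv⟩ := Function.ne_iff.1 hne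
  have hlt : ∀ u, u ∉ A → (G.isHermitian_lapMatrix ℝ).eigenvalues u < T := by
    intro u hu
    by_contra! hT
    exact hu ⟨hT, hn ▸ eigenvalues_le_card G u⟩
  refine sum_lt_sum (fun u _ => ?_) ⟨v, mem_univ _, ?_⟩
  · by_cases hu : u ∈ A
    · simp [hzero u hu]
    · exact mul_le_mul_of_nonneg_right (hlt u hu).le (sq_nonneg _)
  · have hvA : v ∉ A := fun h => hv (hzero v h)
    have hv' : φ (ψ s) v ≠ 0 := hv
    have : 0 < φ (ψ s) v ^ 2 := by positivity
    exact mul_lt_mul_of_pos_right (hlt v hvA) this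

end Spectral

end GirthLap

namespace GirthLap

open Finset

/-! ### Comparison of Laplacian forms and degree bounds. -/

section Forms

variable {V : Type*} [Fintype V]

/-- The evaluation functional at `v`. -/
abbrev coord {α : Type*} (v : α) : Module.Dual ℝ (α → ℝ) := LinearMap.proj v

/-- Edges of `G` go to distinct edges of `H`, and the remaining edges of `H` contribute squares. -/
theorem qf_le_of_injective {W : Type*} [Fintype W] {G : SimpleGraph V} {H : SimpleGraph W}
    (e : V ↪ W) (h : ∀ u v, G.Adj u v → H.Adj (e u) (e v)) (f : W → ℝ) :
    qf G (f ∘ e) ≤ qf H f := by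
  classical
  unfold qf
  refine div_le_div_of_nonneg_right ?_ (by norm_num)
  calc ∑ i, ∑ j, (if G.Adj i j then ((f ∘ e) i - (f ∘ e) j) ^ 2 else 0)
      ≤ ∑ i, ∑ j, (if H.Adj (e i) (e j) then (f (e i) - f (e j)) ^ 2 else 0) := by
        refine sum_le_sum fun i _ => sum_le_sum fun j _ => ?_
        by_cases hij : G.Adj i j
        · simp [hij, h i j hij]
        · rw [if_neg hij]; split_ifs <;> positivity
    _ = ∑ a ∈ univ.map e, ∑ b ∈ univ.map e, (if H.Adj a b then (f a - f b) ^ 2 else 0) := by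
        simp
    _ ≤ ∑ a, ∑ b ∈ univ.map e, (if H.Adj a b then (f a - f b) ^ 2 else 0) :=
        sum_le_sum_of_subset_of_nonneg (subset_univ _) fun _ _ _ =>
          sum_nonneg fun _ _ => by split_ifs <;> positivity
    _ ≤ _ := sum_le_sum fun _ _ => sum_le_sum_of_subset_of_nonneg (subset_univ _)
          fun _ _ _ => by split_ifs <;> positivity

theorem Below.of_equiv {W : Type*} [Fintype W] {G : SimpleGraph V} {H : SimpleGraph W}
    {c : ℕ} {T : ℝ} (hH : Below H c T) (e : V ≃ W) (h : ∀ u v, G.Adj u v → H.Adj (e u) (e v)) :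
    Below G c T := by
  classical
  obtain ⟨L, hL, hQ⟩ := hH
  let φ : (V → ℝ) →ₗ[ℝ] (W → ℝ) := LinearMap.funLeft ℝ ℝ e.symm
  refine ⟨L.image fun l => l.comp φ, card_image_le.trans hL, fun f hf hl => ?_⟩
  have h1 : f = (φ f) ∘ e := by ext v; simp [φ, LinearMap.funLeft_apply]
  have h2 : φ f ≠ 0 := by
    intro h0
    apply hf
    rw [h1, h0]; rfl
  have h3 := hQ (φ f) h2 fun l hl' => hl _ (mem_image_of_mem _ hl')
  have h4 : ∑ v, f v ^ 2 = ∑ w, φ f w ^ 2 := by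
    rw [← e.sum_comp]
    exact sum_congr rfl fun v _ => by simp [φ, LinearMap.funLeft_apply]
  rw [h4]
  refine lt_of_le_of_lt ?_ h3
  conv_lhs => rw [h1]
  exact qf_le_of_injective e.toEmbedding h (φ f)

theorem Below.mono {G : SimpleGraph V} {c c' : ℕ} {T T' : ℝ} (h : Below G c T) (hc : c ≤ c')
    (hT : T ≤ T') : Below G c' T' := by
  obtain ⟨L, hL, hQ⟩ := h
  exact ⟨L, hL.trans hc, fun f hf hl => (hQ f hf hl).trans_le
    (mul_le_mul_of_nonneg_right hT (sum_nonneg fun _ _ => sq_nonneg _))⟩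

/-- Each edge of `G` missing from `H` is paid for by a pair of `D`, in whichever orientation it is
listed. -/
theorem qf_le_add_pairs {G H : SimpleGraph V} (D : Finset (V × V))
    (hD : ∀ u v, G.Adj u v → ¬H.Adj u v → (u, v) ∈ D ∨ (v, u) ∈ D) (f : V → ℝ) :
    qf G f ≤ qf H f + ∑ p ∈ D, (f p.1 - f p.2) ^ 2 := by
  classical
  have h1 : ∑ p ∈ D, (f p.1 - f p.2) ^ 2
      = ∑ i, ∑ j, if (i, j) ∈ D then (f i - f j) ^ 2 else 0 := by
    rw [← sum_product', univ_product_univ, ← sum_filter]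
    simp
  have h2 : ∑ p ∈ D, (f p.1 - f p.2) ^ 2
      = ∑ i, ∑ j, if (j, i) ∈ D then (f i - f j) ^ 2 else 0 := by
    rw [h1, sum_comm]
    refine sum_congr rfl fun i _ => sum_congr rfl fun j _ => ?_
    split_ifs
    · ring
    · rfl
  have h3 : ∑ i, ∑ j, (if G.Adj i j then (f i - f j) ^ 2 else 0) ≤
      (∑ i, ∑ j, if H.Adj i j then (f i - f j) ^ 2 else 0) +
      ((∑ i, ∑ j, if (i, j) ∈ D then (f i - f j) ^ 2 else 0) +
      ∑ i, ∑ j, if (j, i) ∈ D then (f i - f j) ^ 2 else 0) := by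
    simp_rw [← sum_add_distrib]
    refine sum_le_sum fun i _ => sum_le_sum fun j _ => ?_
    have := sq_nonneg (f i - f j)
    by_cases hG : G.Adj i j
    · by_cases hH : H.Adj i j
      · split_ifs <;> linarith
      · rcases hD i j hG hH with h | h <;> simp only [hG, hH, h, if_true, if_false] <;>
          split_ifs <;> linarith
    · split_ifs <;> linarith
  unfold qf
  rw [← h1, ← h2] at h3
  linarith

/-- Excluding reversed pairs from `D` ensures that no edge is counted twice. -/
theorem pairs_le_qf {G : SimpleGraph V} (D : Finset (V × V))
    (hD : ∀ p ∈ D, G.Adj p.1 p.2 ∧ (p.2, p.1) ∉ D) (f : V → ℝ) :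
    ∑ p ∈ D, (f p.1 - f p.2) ^ 2 ≤ qf G f := by
  classical
  have h1 : ∑ p ∈ D, (f p.1 - f p.2) ^ 2
      = ∑ i, ∑ j, if (i, j) ∈ D then (f i - f j) ^ 2 else 0 := by
    rw [← sum_product', univ_product_univ, ← sum_filter]
    simp
  have h2 : ∑ p ∈ D, (f p.1 - f p.2) ^ 2
      = ∑ i, ∑ j, if (j, i) ∈ D then (f i - f j) ^ 2 else 0 := by
    rw [h1, sum_comm]
    refine sum_congr rfl fun i _ => sum_congr rfl fun j _ => ?_
    split_ifs
    · ring
    · rfl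
  have h3 : (∑ i, ∑ j, if (i, j) ∈ D then (f i - f j) ^ 2 else 0) +
      (∑ i, ∑ j, if (j, i) ∈ D then (f i - f j) ^ 2 else 0) ≤
      ∑ i, ∑ j, (if G.Adj i j then (f i - f j) ^ 2 else 0) := by
    simp_rw [← sum_add_distrib]
    refine sum_le_sum fun i _ => sum_le_sum fun j _ => ?_
    have := sq_nonneg (f i - f j)
    by_cases h : (i, j) ∈ D
    · simp [h, (hD _ h).1, (hD _ h).2]
    · by_cases h' : (j, i) ∈ D
      · simp [h, h', (hD _ h').1.symm]
      · simp only [h, h', if_false]; split_ifs <;> linarith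
  unfold qf
  rw [← h1, ← h2] at h3
  linarith

@[simp] theorem qf_bot (f : V → ℝ) : qf (⊥ : SimpleGraph V) f = 0 := by simp [qf]

/-- Killing the values on `S` and the differences along the deleted pairs `D`. -/
theorem below_of_delete {G H : SimpleGraph V} (S : Finset V) (D : Finset (V × V)) {c : ℕ} {T : ℝ}
    (hc : S.card + D.card ≤ c)
    (hD : ∀ u v, G.Adj u v → ¬H.Adj u v → (u, v) ∈ D ∨ (v, u) ∈ D)
    (hQ : ∀ f : V → ℝ, f ≠ 0 → (∀ v ∈ S, f v = 0) → qf H f < T * ∑ v, f v ^ 2) :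
    Below G c T := by
  classical
  refine ⟨S.image (fun v => coord v) ∪
    D.image (fun p => coord p.1 - coord p.2), ?_, fun f hf hl => ?_⟩
  · exact (card_union_le _ _).trans ((add_le_add card_image_le card_image_le).trans hc)
  · have hS : ∀ v ∈ S, f v = 0 := fun v hv =>
      hl (coord v) (mem_union_left _ (mem_image_of_mem _ hv))
    have hDz : ∑ p ∈ D, (f p.1 - f p.2) ^ 2 = 0 := by
      refine sum_eq_zero fun p hp => ?_
      have : f p.1 - f p.2 = 0 := hl (coord p.1 - coord p.2)
        (mem_union_right _ (mem_image_of_mem _ hp))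
      rw [this]; norm_num
    have := qf_le_add_pairs D hD f
    have := hQ f hf hS
    linarith

theorem two_mul_qf_eq_split (G : SimpleGraph V) (W : Set V) [DecidablePred (· ∈ W)] [Fintype W]
    [DecidableRel G.Adj] (f : V → ℝ) :
    2 * qf G f = 2 * qf (G.induce W) (fun w => f w) +
      (∑ i : W, ∑ j : {v // v ∉ W}, (if G.Adj i j then (f i - f j) ^ 2 else 0)) +
      (∑ i : {v // v ∉ W}, ∑ j : W, (if G.Adj i j then (f i - f j) ^ 2 else 0)) +
      ∑ i : {v // v ∉ W}, ∑ j : {v // v ∉ W}, (if G.Adj i j then (f i - f j) ^ 2 else 0) := by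
  classical
  have key : ∀ F : V → ℝ, ∑ i, F i = (∑ i : W, F i) + ∑ i : {v // v ∉ W}, F i := by
    intro F
    rw [← Fintype.sum_subtype_add_sum_subtype (· ∈ W) F]
    congr!
  have h0 : 2 * qf G f = ∑ i, ∑ j, if G.Adj i j then (f i - f j) ^ 2 else 0 := by
    unfold qf
    rw [mul_div_cancel₀ _ (by norm_num)]
    congr!
  have h1 : 2 * qf (G.induce W) (fun w => f w) =
      ∑ i : W, ∑ j : W, if G.Adj i j then (f i - f j) ^ 2 else 0 := by
    unfold qf
    rw [mul_div_cancel₀ _ (by norm_num)]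
    congr!
  rw [h0, h1, key]
  simp_rw [fun i => key fun j => if G.Adj i j then (f i - f j) ^ 2 else 0]
  rw [sum_add_distrib, sum_add_distrib]
  ring

theorem sum_sq_eq_split (W : Set V) [DecidablePred (· ∈ W)] [Fintype W] (f : V → ℝ) :
    ∑ v, f v ^ 2 = (∑ i : W, f i ^ 2) + ∑ i : {v // v ∉ W}, f i ^ 2 := by
  rw [← Fintype.sum_subtype_add_sum_subtype (· ∈ W) (fun v => f v ^ 2)]
  congr!

/-- Passing from an induced subgraph to the whole graph costs one linear condition and one unit of
the threshold for each further vertex. -/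
theorem Below.of_induce {G : SimpleGraph V} (W : Set V) [Fintype W] {c m : ℕ} {T : ℝ}
    (hm : Fintype.card W + m = Fintype.card V) (h : Below (G.induce W) c T) :
    Below G (c + m) (T + m) := by
  classical
  obtain ⟨L, hL, hQ⟩ := h
  let φ : (V → ℝ) →ₗ[ℝ] (W → ℝ) := LinearMap.funLeft ℝ ℝ Subtype.val
  have hcard : Fintype.card {v // v ∉ W} = m := by
    have := Fintype.card_subtype_compl (· ∈ W)
    have h2 : Fintype.card {v // v ∈ W} = Fintype.card W := by congr!
    omega
  refine ⟨L.image (fun l => l.comp φ) ∪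
    (univ : Finset {v // v ∉ W}).image (fun v => coord v.1), ?_, fun f hf hl => ?_⟩
  · refine (card_union_le _ _).trans (add_le_add (card_image_le.trans hL) ?_)
    refine card_image_le.trans ?_
    rw [card_univ, hcard]
  · have hout : ∀ v : {v // v ∉ W}, f v = 0 := fun v =>
      hl (coord v.1) (mem_union_right _ (mem_image_of_mem _ (mem_univ v)))
    have hne : φ f ≠ 0 := by
      intro h0
      apply hf
      ext v
      by_cases hv : v ∈ W
      · exact congrFun h0 ⟨v, hv⟩
      · exact hout ⟨v, hv⟩
    have h1 := hQ (φ f) hne fun l hl' => hl (l.comp φ) (mem_union_left _ (mem_image_of_mem _ hl'))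
    have h2 := two_mul_qf_eq_split G W f
    have h3 := sum_sq_eq_split W f
    have h4 : ∑ i : {v // v ∉ W}, f i ^ 2 = 0 := sum_eq_zero fun v _ => by simp [hout v]
    have h5 : ∑ i : {v // v ∉ W}, ∑ j : {v // v ∉ W},
        (if G.Adj i j then (f i - f j) ^ 2 else 0) = 0 :=
      sum_eq_zero fun i _ => sum_eq_zero fun j _ => by simp [hout]
    -- A vertex of `W` has at most `m` edges leaving `W`, and each contributes `f i ^ 2` because `f`
    -- vanishes outside.
    have h6 : (∑ i : W, ∑ j : {v // v ∉ W}, (if G.Adj i j then (f i - f j) ^ 2 else 0)) ≤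
        m * ∑ i : W, f i ^ 2 := by
      rw [mul_sum]
      refine sum_le_sum fun i _ => ?_
      rw [← hcard, ← nsmul_eq_mul, ← card_univ, ← sum_const]
      refine sum_le_sum fun j _ => ?_
      rw [hout j]
      split_ifs
      · simp
      · positivity
    have h7 : (∑ i : {v // v ∉ W}, ∑ j : W, (if G.Adj i j then (f i - f j) ^ 2 else 0)) ≤
        m * ∑ i : W, f i ^ 2 := by
      refine le_of_eq_of_le ?_ h6
      rw [sum_comm]
      refine sum_congr rfl fun i _ => sum_congr rfl fun j _ => ?_
      simp only [G.adj_comm j.1 i.1]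
      split_ifs
      · ring
      · rfl
    have h8 : ∑ v, φ f v ^ 2 = ∑ i : W, f i ^ 2 := rfl
    have h9 : qf (G.induce W) (φ f) = qf (G.induce W) (fun w => f w) := rfl
    rw [h8, h9] at h1
    rw [h3, h4, add_zero, add_mul]
    linarith

/-- Removing a vertex with exactly one neighbour costs one linear condition. -/
theorem Below.of_leaf {G : SimpleGraph V} {x y : V} (hxy : ∀ v, G.Adj x v ↔ v = y)
    {W : Set V} [Fintype W] (hW : W = {x}ᶜ) {c : ℕ} {T : ℝ} (hT : 0 < T)
    (h : Below (G.induce W) c T) :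
    Below G (c + 1) T := by
  classical
  obtain ⟨L, hL, hQ⟩ := h
  let φ : (V → ℝ) →ₗ[ℝ] (W → ℝ) := LinearMap.funLeft ℝ ℝ Subtype.val
  refine ⟨insert (coord x - coord y) (L.image (fun l => l.comp φ)), ?_,
    fun f hf hl => ?_⟩
  · exact (card_insert_le _ _).trans (by gcongr; exact card_image_le.trans hL)
  · have hfxy : f x = f y := by
      have := hl (coord x - coord y) (mem_insert_self _ _)
      exact sub_eq_zero.1 this
    have hyx : y ≠ x := fun h => G.irrefl ((hxy x).2 h.symm)
    have hne : φ f ≠ 0 := by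
      intro h0
      apply hf
      ext v
      by_cases hv : v ∈ W
      · exact congrFun h0 ⟨v, hv⟩
      · have : v = x := by simpa [hW] using hv
        rw [this, hfxy]
        exact congrFun h0 ⟨y, by simpa [hW] using hyx⟩
    have h1 := hQ (φ f) hne fun l hl' => hl (l.comp φ) (mem_insert_of_mem (mem_image_of_mem _ hl'))
    have h2 := two_mul_qf_eq_split G W f
    have h3 := sum_sq_eq_split W f
    have h4 : 0 ≤ ∑ i : {v // v ∉ W}, f i ^ 2 := sum_nonneg fun v _ => sq_nonneg _
    have hout : ∀ v : {v // v ∉ W}, v.1 = x := fun v => by simpa [hW] using v.2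
    have h5 : ∑ i : {v // v ∉ W}, ∑ j : {v // v ∉ W},
        (if G.Adj i j then (f i - f j) ^ 2 else 0) = 0 :=
      sum_eq_zero fun i _ => sum_eq_zero fun j _ => by simp [hout]
    have h6 : (∑ i : W, ∑ j : {v // v ∉ W}, (if G.Adj i j then (f i - f j) ^ 2 else 0)) = 0 := by
      refine sum_eq_zero fun i _ => sum_eq_zero fun j _ => ?_
      rw [hout j]
      split_ifs with h
      · rw [(hxy _).1 h.symm, hfxy]; ring
      · rfl
    have h7 : (∑ i : {v // v ∉ W}, ∑ j : W, (if G.Adj i j then (f i - f j) ^ 2 else 0)) = 0 := by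
      refine sum_eq_zero fun i _ => sum_eq_zero fun j _ => ?_
      rw [hout i]
      split_ifs with h
      · rw [(hxy _).1 h, hfxy]; ring
      · rfl
    have h8 : ∑ v, φ f v ^ 2 = ∑ i : W, f i ^ 2 := rfl
    have h9 : qf (G.induce W) (φ f) = qf (G.induce W) (fun w => f w) := rfl
    rw [h8, h9] at h1
    -- The edge `xy` contributes nothing as `f x = f y`, and `T * f x ^ 2 ≥ 0` only enlarges the
    -- right side.
    rw [h3, mul_add]
    have := mul_nonneg hT.le h4
    linarith

theorem sum_ite_adj_eq_ncard (H : SimpleGraph V)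
    [DecidableRel H.Adj] (v : V) (a : ℝ) :
    (∑ j, if H.Adj v j then a else 0) = (H.neighborSet v).ncard * a := by
  classical
  rw [← sum_filter, sum_const, nsmul_eq_mul]
  congr 2
  rw [Set.ncard_eq_toFinset_card']
  congr 1
  ext; simp

/-- `(a - b) ^ 2 + (a + b) ^ 2 = 2 * a ^ 2 + 2 * b ^ 2` summed over the edges: Laplacian plus
signless Laplacian equals `2D`. -/
theorem qf_add_qf_plus (H : SimpleGraph V) [DecidableRel H.Adj] (f : V → ℝ) :
    qf H f + (∑ i, ∑ j, if H.Adj i j then (f i + f j) ^ 2 else 0) / 2 =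
      ∑ v, 2 * (H.neighborSet v).ncard * f v ^ 2 := by
  classical
  have h0 : qf H f = (∑ i, ∑ j, if H.Adj i j then (f i - f j) ^ 2 else 0) / 2 := by
    unfold qf; congr!
  have h1 : ∑ i, ∑ j, (if H.Adj i j then f i ^ 2 else 0) =
      ∑ v, (H.neighborSet v).ncard * f v ^ 2 :=
    sum_congr rfl fun v _ => sum_ite_adj_eq_ncard H v (f v ^ 2)
  have h2 : ∑ i, ∑ j, (if H.Adj i j then f j ^ 2 else 0) =
      ∑ v, (H.neighborSet v).ncard * f v ^ 2 := by
    rw [← h1, sum_comm]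
    simp_rw [H.adj_comm]
  rw [h0, ← add_div, ← sum_add_distrib]
  have h3 : ∀ i, (∑ j, if H.Adj i j then (f i - f j) ^ 2 else 0) +
      (∑ j, if H.Adj i j then (f i + f j) ^ 2 else 0) =
      2 * (∑ j, if H.Adj i j then f i ^ 2 else 0) + 2 * ∑ j, if H.Adj i j then f j ^ 2 else 0 := by
    intro i
    rw [← sum_add_distrib, mul_sum, mul_sum, ← sum_add_distrib]
    refine sum_congr rfl fun j _ => ?_
    split_ifs
    · ring
    · ring
  simp_rw [h3, sum_add_distrib, ← mul_sum, h1, h2]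
  rw [mul_sum]
  simp_rw [mul_assoc, ← mul_sum]
  ring

/-- If outside the zero set `S` all degrees are at most two and every vertex is connected to `S` or
to a vertex of degree at most one, then the quadratic form is below `4 * ‖f‖ ^ 2`. -/
theorem qf_lt_four {H : SimpleGraph V} {S : Set V} (hdeg : ∀ v ∉ S, (H.neighborSet v).ncard ≤ 2)
    (hreach : ∀ v, ∃ w, H.Reachable v w ∧ (w ∈ S ∨ (H.neighborSet w).ncard < 2))
    {f : V → ℝ} (hf : f ≠ 0) (hS : ∀ v ∈ S, f v = 0) : qf H f < 4 * ∑ v, f v ^ 2 := by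
  classical
  have h1 := qf_add_qf_plus H f
  have h2 : ∀ v ∈ univ, 2 * ((H.neighborSet v).ncard : ℝ) * f v ^ 2 ≤ 4 * f v ^ 2 := by
    intro v _
    by_cases hv : v ∈ S
    · simp [hS v hv]
    · have : ((H.neighborSet v).ncard : ℝ) ≤ 2 := by exact_mod_cast hdeg v hv
      nlinarith [sq_nonneg (f v)]
  have h4 : ∀ i j, 0 ≤ (if H.Adj i j then (f i + f j) ^ 2 else 0) := by
    intro i j; split_ifs <;> positivity
  have h3 : 0 ≤ ∑ i, ∑ j, (if H.Adj i j then (f i + f j) ^ 2 else 0) :=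
    sum_nonneg fun i _ => sum_nonneg fun j _ => h4 i j
  have h5 := sum_le_sum h2
  rw [← mul_sum] at h5
  -- Equality would force `f i = -f j` along every edge and `f = 0` at each vertex of degree below
  -- two. The zero at `w` then spreads along the walk to `v`.
  by_contra! hcon
  have h6 : ∑ i, ∑ j, (if H.Adj i j then (f i + f j) ^ 2 else 0) = 0 := by linarith
  have h7 : ∑ v, 2 * ((H.neighborSet v).ncard : ℝ) * f v ^ 2 = ∑ v, 4 * f v ^ 2 := by
    rw [← mul_sum]; linarith
  have h8 : ∀ i j, H.Adj i j → f i = - f j := by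
    intro i j hij
    have := (sum_eq_zero_iff_of_nonneg fun i _ => sum_nonneg fun j _ => h4 i j).1 h6 i (mem_univ _)
    have := (sum_eq_zero_iff_of_nonneg fun j _ => h4 i j).1 this j (mem_univ _)
    rw [if_pos hij] at this
    have := pow_eq_zero_iff (two_ne_zero) |>.1 this
    linarith
  have h9 := (sum_eq_sum_iff_of_le h2).1 h7
  apply hf
  ext v
  obtain ⟨w, ⟨p⟩, hw⟩ := hreach v
  have hw0 : f w = 0 := by
    rcases hw with hw | hw
    · exact hS w hw
    · have := h9 w (mem_univ _)
      have h' : ((H.neighborSet w).ncard : ℝ) ≤ 1 := by exact_mod_cast Nat.lt_succ_iff.1 hw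
      have : f w ^ 2 ≤ 0 := by nlinarith [sq_nonneg (f w)]
      exact pow_eq_zero_iff (two_ne_zero) |>.1 (le_antisymm this (sq_nonneg _))
  clear hw
  induction p with
  | nil => exact hw0
  | cons h p ih => rw [h8 _ _ h, ih hw0]; simp

/-- If outside the zero set `S` all degrees are at most two, except for one vertex of degree at
most three, then the quadratic form is below `5 * ‖f‖ ^ 2`. -/
theorem qf_lt_five {H : SimpleGraph V} {S : Set V} {u : V}
    (hdeg : ∀ v ∉ S, v ≠ u → (H.neighborSet v).ncard ≤ 2) (hu : (H.neighborSet u).ncard ≤ 3)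
    {f : V → ℝ} (hf : f ≠ 0) (hS : ∀ v ∈ S, f v = 0) : qf H f < 5 * ∑ v, f v ^ 2 := by
  classical
  -- The inequality `(a - b) ^ 2 ≤ 8/5 * a ^ 2 + 8/3 * b ^ 2` amounts to `(3 * a + 5 * b) ^ 2 ≥ 0`.
  -- The end at `u` gets `8/5`, so three edges give `24/5`; any other vertex has at most one edge to
  -- `u` and gets at most `2 + 8/3 = 14/3`.
  let w : V → V → ℝ := fun i j => if i = u then 8 / 5 else if j = u then 8 / 3 else 2
  have hw : ∀ i j, i ≠ j → (f i - f j) ^ 2 ≤ w i j * f i ^ 2 + w j i * f j ^ 2 := by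
    intro i j hij
    simp only [w]
    by_cases hi : i = u
    · have hj : j ≠ u := fun h => hij (hi.trans h.symm)
      simp only [hi, hj, if_true, if_false]
      nlinarith [sq_nonneg (3 * f u + 5 * f j)]
    · by_cases hj : j = u
      · simp only [hi, hj, if_true, if_false]
        nlinarith [sq_nonneg (3 * f u + 5 * f i)]
      · simp only [hi, hj, if_false]
        nlinarith [sq_nonneg (f i + f j)]
  have h1 : ∑ i, ∑ j, (if H.Adj i j then (f i - f j) ^ 2 else 0) ≤
      (∑ i, ∑ j, if H.Adj i j then w i j * f i ^ 2 else 0) +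
      ∑ i, ∑ j, if H.Adj i j then w j i * f j ^ 2 else 0 := by
    simp_rw [← sum_add_distrib]
    refine sum_le_sum fun i _ => sum_le_sum fun j _ => ?_
    by_cases h : H.Adj i j
    · simpa [h] using hw i j h.ne
    · simp [h]
  have h2 : ∑ i, ∑ j, (if H.Adj i j then w j i * f j ^ 2 else 0) =
      ∑ i, ∑ j, if H.Adj i j then w i j * f i ^ 2 else 0 := by
    rw [sum_comm]
    simp_rw [H.adj_comm]
  have h3 : ∀ i, ∑ j, (if H.Adj i j then w i j * f i ^ 2 else 0) ≤ 24 / 5 * f i ^ 2 := by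
    intro i
    have hsq := sq_nonneg (f i)
    by_cases hi : i = u
    · have : ∀ j, (if H.Adj i j then w i j * f i ^ 2 else 0) =
        if H.Adj i j then 8 / 5 * f i ^ 2 else 0 := by intro j; simp [w, hi]
      simp_rw [this]
      rw [sum_ite_adj_eq_ncard]
      have : ((H.neighborSet i).ncard : ℝ) ≤ 3 := by rw [hi]; exact_mod_cast hu
      nlinarith
    · by_cases hiS : i ∈ S
      · simp [hS i hiS]
      · have : ∀ j, (if H.Adj i j then w i j * f i ^ 2 else 0) ≤
          (if H.Adj i j then 2 * f i ^ 2 else 0) + if j = u then 2 / 3 * f i ^ 2 else 0 := by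
          intro j
          simp only [w, hi, if_false]
          split_ifs <;> nlinarith
        refine (sum_le_sum fun j _ => this j).trans ?_
        rw [sum_add_distrib, sum_ite_adj_eq_ncard]
        have : ((H.neighborSet i).ncard : ℝ) ≤ 2 := by exact_mod_cast hdeg i hiS hi
        simp only [sum_ite_eq', mem_univ, if_true]
        nlinarith
  have h4 := sum_le_sum fun i (_ : i ∈ univ) => h3 i
  rw [← mul_sum] at h4
  have h5 := sum_sq_pos hf
  have h6 : qf H f = (∑ i, ∑ j, if H.Adj i j then (f i - f j) ^ 2 else 0) / 2 := rfl
  rw [h2] at h1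
  linarith

/-- The graph whose edges are the listed pairs. -/
def ofPairs {α : Type*} (D : Finset (α × α)) : SimpleGraph α :=
  SimpleGraph.fromRel fun a b => (a, b) ∈ D

/-- The slack `ε` makes the inequality strict for `f ≠ 0`, so that a non-strict polynomial
inequality is enough. -/
theorem below_ofPairs (D : Finset (V × V)) (L : Finset (Module.Dual ℝ (V → ℝ))) {c : ℕ}
    (hL : L.card ≤ c) {T ε : ℝ} (hε : 0 < ε)
    (h : ∀ f : V → ℝ, (∀ l ∈ L, l f = 0) →
      ∑ p ∈ D, (f p.1 - f p.2) ^ 2 + ε * ∑ v, f v ^ 2 ≤ T * ∑ v, f v ^ 2) :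
    Below (ofPairs D) c T := by
  refine ⟨L, hL, fun f hf hl => ?_⟩
  have h1 := qf_le_add_pairs (G := ofPairs D) (H := ⊥) D (fun u v huv _ => by
    simpa [ofPairs] using huv.2) f
  have h2 := h f hl
  have h3 := mul_pos hε (sum_sq_pos hf)
  rw [qf_bot] at h1
  linarith

/-- A copy of an edge list inside `G` carrying a large quadratic form. -/
theorem above_of_pairs {G : SimpleGraph V} {m c : ℕ} {T : ℝ} (p : Fin m → V)
    (hp : Function.Injective p) (D : Finset (Fin m × Fin m))
    (hD : ∀ q ∈ D, G.Adj (p q.1) (p q.2) ∧ (q.2, q.1) ∉ D)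
    (ψ : (Fin c → ℝ) →ₗ[ℝ] (Fin m → ℝ)) (hψ : Function.Injective ψ)
    (h : ∀ s, T * ∑ i, ψ s i ^ 2 ≤ ∑ q ∈ D, (ψ s q.1 - ψ s q.2) ^ 2) : Above G c T := by
  classical
  let ext : (Fin m → ℝ) →ₗ[ℝ] (V → ℝ) := Function.ExtendByZero.linearMap ℝ p
  have hext : ∀ x i, ext x (p i) = x i := fun x i => hp.extend_apply _ _ _
  have hout : ∀ x v, (v ∉ Set.range p) → ext x v = 0 := fun x v hv =>
    Function.extend_apply' x (0 : V → ℝ) v hv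
  refine ⟨ext.comp ψ, ?_, fun s => ?_⟩
  · intro s t hst
    apply hψ
    ext i
    rw [← hext (ψ s), ← hext (ψ t)]
    exact congrFun hst _
  · have h1 : ∑ v, (ext.comp ψ) s v ^ 2 = ∑ i, ψ s i ^ 2 := by
      have := Finset.sum_map univ ⟨p, hp⟩ fun v => ext (ψ s) v ^ 2
      simp only [Function.Embedding.coeFn_mk, hext] at this
      rw [← this]
      symm
      refine sum_subset (subset_univ _) fun v _ hv => ?_
      rw [hout]
      · norm_num
      · simpa using hv
    rw [h1]
    refine (h s).trans ?_
    have h2 := pairs_le_qf (G := ofPairs D) D (fun q hq => ⟨by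
      refine ⟨fun h => ?_, Or.inl hq⟩
      exact (hD q hq).1.ne (by rw [h]), (hD q hq).2⟩) (ψ s)
    have h3 := qf_le_of_injective (G := ofPairs D) (H := G) ⟨p, hp⟩ (fun u v huv => by
      rcases huv.2 with h | h
      · exact (hD _ h).1
      · exact (hD _ h).1.symm) (ext (ψ s))
    have h4 : (ext (ψ s)) ∘ p = ψ s := by ext i; exact hext _ _
    simp only [Function.Embedding.coeFn_mk, h4] at h3
    exact h2.trans h3

end Forms

end GirthLap

namespace GirthLap

open Finset SimpleGraph

/-! ### Short paths and shortest cycles. -/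

section Paths

variable {V : Type*} {G : SimpleGraph V}

/-- All cycles of `G` have length at least `g`. -/
def NoShortCycle (G : SimpleGraph V) (g : ℕ) : Prop :=
  ∀ (a : V) (w : G.Walk a a), w.IsCycle → g ≤ w.length

theorem NoShortCycle.comap {W : Type*} {H : SimpleGraph W} {g : ℕ} (h : NoShortCycle G g)
    (φ : H →g G) (hφ : Function.Injective φ) : NoShortCycle H g := by
  intro a w hw
  have := h _ (w.map φ) (hw.map hφ)
  simpa using this

/-- The edges of `p` and `q` span a subgraph with fewer than `g` edges. It is therefore a forest,
and paths in a forest are unique. -/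
theorem NoShortCycle.path_eq {g : ℕ} (h : NoShortCycle G g) {u v : V} {p q : G.Walk u v}
    (hp : p.IsPath) (hq : q.IsPath) (hlt : p.length + q.length < g) : p = q := by
  classical
  let H : SimpleGraph V := SimpleGraph.fromEdgeSet {e | e ∈ p.edges ∨ e ∈ q.edges}
  have hHG : H ≤ G := by
    intro a b hab
    rw [SimpleGraph.fromEdgeSet_adj] at hab
    rcases hab.1 with h | h
    · exact p.adj_of_mem_edges h
    · exact q.adj_of_mem_edges h
  have hmem : ∀ e, (e ∈ p.edges ∨ e ∈ q.edges) → e ∈ H.edgeSet := by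
    intro e he
    rw [SimpleGraph.edgeSet_fromEdgeSet]
    refine ⟨he, ?_⟩
    have heG : e ∈ G.edgeSet := by
      rcases he with h | h
      · exact p.edges_subset_edgeSet h
      · exact q.edges_subset_edgeSet h
    exact G.not_isDiag_of_mem_edgeSet heG
  have hac : H.IsAcyclic := by
    intro a w hw
    have h1 := h a (w.mapLe hHG) (hw.mapLe hHG)
    have h2 : w.edges ⊆ p.edges ++ q.edges := by
      intro e he
      have := w.edges_subset_edgeSet he
      rw [SimpleGraph.edgeSet_fromEdgeSet] at this
      simpa using this.1
    have h3 := (hw.edges_nodup.subperm h2).length_le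
    simp at h1 h3
    omega
  have hp' := hp.transfer (H := H) (fun e he => hmem e (Or.inl he))
  have hq' := hq.transfer (H := H) (fun e he => hmem e (Or.inr he))
  have := (hac.subsingleton_path u v).elim ⟨_, hp'⟩ ⟨_, hq'⟩
  have h4 : p.transfer H (fun e he => hmem e (Or.inl he)) =
      q.transfer H (fun e he => hmem e (Or.inr he)) := congrArg Subtype.val this
  apply SimpleGraph.Walk.ext_support
  have h5 := congrArg Walk.support h4
  simpa using h5

/-- Paths of prescribed length inside a set in which every vertex has two neighbours. -/
theorem NoShortCycle.exists_path {g : ℕ} (h : NoShortCycle G g) {A : Set V}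
    (hA : ∀ a ∈ A, ∀ b, ∃ b' ∈ A, b' ≠ b ∧ G.Adj a b') {v x : V} (hv : v ∈ A) (hx : x ∈ A)
    (hvx : G.Adj v x) (j : ℕ) (hj : j + 2 ≤ g) :
    ∃ (y : V) (p : G.Walk v y), p.IsPath ∧ p.length = j + 1 ∧ p.getVert 1 = x ∧
      ∀ u ∈ p.support, u ∈ A := by
  classical
  induction j with
  | zero =>
    refine ⟨x, Walk.cons hvx Walk.nil, ?_, rfl, rfl, ?_⟩
    · simp [hvx.ne]
    · simp [hv, hx]
  | succ j ih =>
    obtain ⟨y, p, hp, hlen, h1, hpA⟩ := ih (by omega)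
    obtain ⟨b, hbA, hb, hyb⟩ := hA y (hpA y p.end_mem_support) p.penultimate
    -- If `b` lay on `p`, the part of `p` from `b` to `y` and the edge `by` would be two short paths
    -- with the same ends. They would coincide, making `b` the penultimate vertex.
    have hbs : b ∉ p.support := by
      intro hbs
      have hq := hp.dropUntil hbs
      have hqe := h.path_eq hq (q := Walk.cons hyb.symm Walk.nil) (by simp [hyb.ne.symm]) (by
        have := p.length_dropUntil_le_length hbs
        simp only [Walk.length_cons, Walk.length_nil]
        omega)
      have hs := p.take_spec hbs
      rw [hqe] at hs
      apply hb
      conv_rhs => rw [← hs]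
      rw [← Walk.concat_eq_append, Walk.penultimate_concat]
    refine ⟨b, p.concat hyb, hp.concat hbs hyb, by simp [hlen], ?_, ?_⟩
    · rw [Walk.concat_eq_append, Walk.getVert_append]
      split_ifs with hlt
      · exact h1
      · rw [show 1 - p.length = 0 by omega, Walk.getVert_zero, ← h1, show 1 = p.length by omega,
          p.getVert_length]
    · intro u hu
      rw [Walk.support_concat] at hu
      simp at hu
      rcases hu with hu | rfl
      · exact hpA u hu
      · exact hbA

/-- `c` runs periodically around a cycle of length `g`, and no cycle is shorter. -/
structure ShortestCycle (G : SimpleGraph V) (g : ℕ) (c : ℕ → V) : Prop where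
  adj : ∀ i, G.Adj (c i) (c (i + 1))
  eq_iff : ∀ i j, c i = c j ↔ i % g = j % g
  four_le : 4 ≤ g
  min : NoShortCycle G g

theorem exists_shortestCycle {g : ℕ} (hg : G.girth = g) (hg4 : 4 ≤ g) :
    ∃ c, ShortestCycle G g c := by
  have hac : ¬G.IsAcyclic := by
    rw [← SimpleGraph.girth_eq_zero]; omega
  obtain ⟨a, w, hw, hwl⟩ := SimpleGraph.exists_girth_eq_length.2 hac
  obtain ⟨φ⟩ := (SimpleGraph.cycleGraph_isContained_iff (G := G) (n := g) (by omega)).2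
    ⟨a, w, hw, by omega⟩
  have : NeZero g := ⟨by omega⟩
  refine ⟨fun i => φ.toHom (Fin.ofNat g i), fun i => ?_, fun i j => ?_, hg4, fun a w hw => ?_⟩
  · apply φ.toHom.map_rel
    rw [SimpleGraph.cycleGraph_adj']
    right
    have : (Fin.ofNat g (i + 1) - Fin.ofNat g i : Fin g) = Fin.ofNat g 1 := by
      have h1 : (Fin.ofNat g (i + 1) : Fin g) = Fin.ofNat g i + Fin.ofNat g 1 := by
        apply Fin.ext
        simp [Fin.ofNat, Fin.val_add]
      rw [h1]
      exact add_sub_cancel_left _ _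
    rw [this]
    exact Nat.mod_eq_of_lt (by omega)
  · constructor
    · intro h
      have := φ.injective h
      exact congrArg Fin.val this
    · intro h
      have : Fin.ofNat g i = Fin.ofNat g j := Fin.ext h
      simp only [this]
  · rw [← hg]; exact SimpleGraph.girth_le_length hw

namespace ShortestCycle

variable {g : ℕ} {c : ℕ → V}

theorem shift (h : ShortestCycle G g c) (a : ℕ) : ShortestCycle G g (fun i => c (i + a)) where
  adj i := by
    have := h.adj (i + a)
    rwa [add_right_comm] at this
  eq_iff i j := by
    rw [h.eq_iff]
    constructor
    · intro hij
      exact Nat.ModEq.add_right_cancel' a hij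
    · intro hij
      exact Nat.ModEq.add_right a hij
  four_le := h.four_le
  min := h.min

theorem period (h : ShortestCycle G g c) (i : ℕ) : c (i + g) = c i := (h.eq_iff _ _).2 (by simp)

theorem mod (h : ShortestCycle G g c) (i : ℕ) : c (i % g) = c i := (h.eq_iff _ _).2 (by simp)

/-- Multiplication by `g - 1` is negation modulo `g`, so no subtraction of indices is needed. -/
theorem reverse (h : ShortestCycle G g c) : ShortestCycle G g (fun i => c (i * (g - 1))) where
  adj i := by
    have h4 := h.four_le
    have h1 := h.adj ((i + 1) * (g - 1))
    have h2 : (i + 1) * (g - 1) + 1 = i * (g - 1) + g := by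
      obtain ⟨k, rfl⟩ : ∃ k, g = k + 1 := ⟨g - 1, by omega⟩
      simp; ring
    rw [h2, h.period] at h1
    exact h1.symm
  eq_iff i j := by
    have h4 := h.four_le
    rw [h.eq_iff]
    constructor
    · intro hij
      refine Nat.ModEq.cancel_right_of_coprime (c := g - 1) ?_ hij
      have : Nat.Coprime g (g - 1) := by
        obtain ⟨k, rfl⟩ : ∃ k, g = k + 1 := ⟨g - 1, by omega⟩
        simp
      exact this
    · intro hij
      exact Nat.ModEq.mul_right _ hij
  four_le := h.four_le
  min := h.min

theorem exists_lt (h : ShortestCycle G g c) {v : V} (hv : v ∈ Set.range c) :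
    ∃ i < g, c i = v := by
  obtain ⟨i, rfl⟩ := hv
  exact ⟨i % g, Nat.mod_lt _ (by have := h.four_le; omega), h.mod i⟩

theorem inj_lt (h : ShortestCycle G g c) {i j : ℕ} (hi : i < g) (hj : j < g) (hij : c i = c j) :
    i = j := by
  have := (h.eq_iff i j).1 hij
  rwa [Nat.mod_eq_of_lt hi, Nat.mod_eq_of_lt hj] at this

theorem ncard_range (h : ShortestCycle G g c) : (Set.range c).ncard = g := by
  have : Set.range c = c '' (Finset.range g : Set ℕ) := by
    ext v
    constructor
    · intro hv
      obtain ⟨i, hi, rfl⟩ := h.exists_lt hv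
      exact ⟨i, by simpa using hi, rfl⟩
    · rintro ⟨i, _, rfl⟩
      exact ⟨i, rfl⟩
  rw [this, Set.InjOn.ncard_image, Set.ncard_coe_finset, Finset.card_range]
  intro i hi j hj hij
  exact h.inj_lt (by simpa using hi) (by simpa using hj) hij

theorem reverse_apply (h : ShortestCycle G g c) {e : ℕ} (he : e ≤ g) :
    c ((g - e) * (g - 1)) = c e := by
  have h4 := h.four_le
  refine (h.eq_iff ((g - e) * (g - 1)) e).2 ?_
  obtain ⟨k, rfl⟩ : ∃ k, g = k + e := ⟨g - e, by omega⟩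
  have : (k + e - e) * (k + e - 1) + k = k * (k + e) := by
    obtain ⟨l, hl⟩ : ∃ l, k + e = l + 1 := ⟨k + e - 1, by omega⟩
    rw [hl]
    simp
    rw [show l + 1 - e = k by omega]
    ring
  have h3 : ((k + e - e) * (k + e - 1) + k) % (k + e) = (e + k) % (k + e) := by
    rw [this]; simp [add_comm e k]
  exact Nat.ModEq.add_right_cancel' k h3

/-- Two vertices of the cycle can be written as `c 0` and `c d` with `2 * d ≤ g` after
reparametrization. -/
theorem exists_reparam (h : ShortestCycle G g c) {u v : V} (hu : u ∈ Set.range c)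
    (hv : v ∈ Set.range c) : ∃ c', ShortestCycle G g c' ∧ Set.range c' = Set.range c ∧ c' 0 = u ∧
      ∃ d, 2 * d ≤ g ∧ c' d = v := by
  have h4 := h.four_le
  have key : ∀ c' : ℕ → V, ShortestCycle G g c' → (∀ i, c' i ∈ Set.range c) →
      Set.range c' = Set.range c := by
    intro c' hc' hsub
    have hfin : (Set.range c).Finite := by
      refine ((Set.finite_lt_nat g).image c).subset ?_
      intro v hv
      obtain ⟨i, hi, rfl⟩ := h.exists_lt hv
      exact ⟨i, hi, rfl⟩
    exact Set.eq_of_subset_of_ncard_le (by rintro _ ⟨i, rfl⟩; exact hsub i)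
      (by rw [h.ncard_range, hc'.ncard_range]) hfin
  obtain ⟨a, -, rfl⟩ := h.exists_lt hu
  have hs := h.shift a
  have hv' : v ∈ Set.range fun i => c (i + a) := by
    rw [key _ hs fun i => ⟨_, rfl⟩]; exact hv
  obtain ⟨d, hd, rfl⟩ := hs.exists_lt hv'
  by_cases h2 : 2 * d ≤ g
  · exact ⟨_, hs, key _ hs fun i => ⟨_, rfl⟩, by simp, d, h2, rfl⟩
  · refine ⟨_, hs.reverse, key _ hs.reverse fun i => ⟨_, rfl⟩, by simp, g - d, by omega, ?_⟩
    exact hs.reverse_apply hd.le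

theorem exists_arc (h : ShortestCycle G g c) (d : ℕ) (hd : d < g) :
    ∃ p : G.Walk (c 0) (c d), p.IsPath ∧ p.length = d ∧ ∀ x ∈ p.support, x ∈ Set.range c := by
  have : ∃ p : G.Walk (c 0) (c d), p.IsPath ∧ p.length = d ∧
      ∀ x ∈ p.support, ∃ i ≤ d, x = c i := by
    induction d with
    | zero => exact ⟨Walk.nil, by simp, rfl, by simp⟩
    | succ d ih =>
      obtain ⟨p, hp, hl, hs⟩ := ih (by omega)
      refine ⟨p.concat (h.adj d), hp.concat ?_ _, by simp [hl], ?_⟩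
      · intro hmem
        obtain ⟨i, hi, hci⟩ := hs _ hmem
        have := h.inj_lt hd (by omega) hci
        omega
      · intro x hx
        rw [Walk.support_concat] at hx
        simp at hx
        rcases hx with hx | rfl
        · obtain ⟨i, hi, rfl⟩ := hs x hx
          exact ⟨i, by omega, rfl⟩
        · exact ⟨d + 1, le_rfl, rfl⟩
  obtain ⟨p, hp, hl, hs⟩ := this
  exact ⟨p, hp, hl, fun x hx => by obtain ⟨i, -, rfl⟩ := hs x hx; exact ⟨i, rfl⟩⟩

/-- A path from `c 0` to `c d` leaving the cycle has length at least `g - d`. -/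
theorem le_length_add (h : ShortestCycle G g c) {d : ℕ} (hd : d < g) {p : G.Walk (c 0) (c d)}
    (hp : p.IsPath) {x : V} (hx : x ∈ p.support) (hxc : x ∉ Set.range c) : g ≤ p.length + d := by
  by_contra! hlt
  obtain ⟨q, hq, hql, hqs⟩ := h.exists_arc d hd
  have := h.min.path_eq hp hq (by omega)
  exact hxc (hqs x (this ▸ hx))

/-- There are no chords: an edge and an arc of length `d ≤ g / 2` have total length below `g`, so
they coincide. -/
theorem adj_zero (h : ShortestCycle G g c) {d : ℕ} (hd : 2 * d ≤ g) (hadj : G.Adj (c 0) (c d)) :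
    d = 1 := by
  have h4 := h.four_le
  obtain ⟨q, hq, hql, hqs⟩ := h.exists_arc d (by omega)
  have := h.min.path_eq (p := Walk.cons hadj Walk.nil) (by simp [hadj.ne]) hq (by simp; omega)
  rw [← hql, ← this]; rfl

theorem adj_iff (h : ShortestCycle G g c) (i j : ℕ) :
    G.Adj (c i) (c j) ↔ j % g = (i + 1) % g ∨ i % g = (j + 1) % g := by
  have h4 := h.four_le
  constructor
  · intro hadj
    -- One of the differences `j - i` and `i - j` modulo `g` is at most `g / 2`.
    wlog hij : ∃ d, 2 * d ≤ g ∧ j % g = (i + d) % g generalizing i j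
    · refine (this j i hadj.symm ?_).symm
      have h1 := Nat.mod_lt i (show 0 < g by omega)
      have h2 := Nat.mod_lt j (show 0 < g by omega)
      refine ⟨(i % g + g - j % g) % g, ?_, ?_⟩
      · by_contra! hc
        apply hij
        refine ⟨(j % g + g - i % g) % g, ?_, ?_⟩
        · rcases lt_trichotomy (i % g) (j % g) with hlt | heq | hgt
          · have e1 : (i % g + g - j % g) % g = i % g + g - j % g := Nat.mod_eq_of_lt (by omega)
            have e2 : (j % g + g - i % g) % g = j % g - i % g := by
              rw [show j % g + g - i % g = (j % g - i % g) + g by omega, Nat.add_mod_right]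
              exact Nat.mod_eq_of_lt (by omega)
            omega
          · rw [heq] at hc
            simp at hc
          · have e1 : (j % g + g - i % g) % g = j % g + g - i % g := Nat.mod_eq_of_lt (by omega)
            have e2 : (i % g + g - j % g) % g = i % g - j % g := by
              rw [show i % g + g - j % g = (i % g - j % g) + g by omega, Nat.add_mod_right]
              exact Nat.mod_eq_of_lt (by omega)
            omega
        · rw [Nat.add_mod, Nat.mod_mod, ← Nat.add_mod, Nat.add_mod i, ]
          rw [← Nat.add_mod, ← Nat.mod_add_mod, show i % g + (j % g + g - i % g) = j % g + g by
            omega]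
          simp
      · rw [Nat.add_mod, Nat.mod_mod, ← Nat.add_mod, ← Nat.mod_add_mod,
          show j % g + (i % g + g - j % g) = i % g + g by omega]
        simp
    obtain ⟨d, hd, hjd⟩ := hij
    have hs := h.shift i
    have hcj : c j = c (d + i) := (h.eq_iff _ _).2 (by rw [hjd, add_comm])
    have : d = 1 := hs.adj_zero hd (by simpa [← hcj] using hadj)
    left; rw [hjd, this]
  · rintro (hij | hij)
    · rw [(h.eq_iff j (i + 1)).2 hij]; exact h.adj i
    · rw [(h.eq_iff i (j + 1)).2 hij]; exact (h.adj j).symm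

/-- Two neighbours at cycle distance `d ≤ g / 2` would be joined by a path of length two leaving the
cycle, whence `g ≤ 2 + d`. This is impossible for `g ≥ 5`, while `g = 4`, `d = 2` does occur. -/
theorem attach_unique (h : ShortestCycle G g c) (hg : 5 ≤ g) {x u v : V} (hx : x ∉ Set.range c)
    (hu : u ∈ Set.range c) (hv : v ∈ Set.range c) (hxu : G.Adj x u) (hxv : G.Adj x v) : u = v := by
  by_contra hne
  obtain ⟨c', hc', hr, rfl, d, hd, rfl⟩ := h.exists_reparam hu hv
  have := hc'.le_length_add (d := d) (by omega) (p := Walk.cons hxu.symm (Walk.cons hxv Walk.nil))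
    (by simp [hxu.ne.symm, hxv.ne, hne]) (x := x) (by simp) (by rwa [hr])
  simp at this
  omega

end ShortestCycle

end Paths

end GirthLap

namespace GirthLap

open Finset SimpleGraph

/-! ### Connected subgraphs around a shortest cycle. -/

section Growing

variable {V : Type*} {G : SimpleGraph V} {g : ℕ} {c : ℕ → V}

theorem ShortestCycle.induce (h : ShortestCycle G g c) {W : Set V} (hW : ∀ i, c i ∈ W) :
    ShortestCycle (G.induce W) g (fun i => ⟨c i, hW i⟩) where
  adj i := h.adj i
  eq_iff i j := by rw [← h.eq_iff]; simp
  four_le := h.four_le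
  min := h.min.comap (SimpleGraph.Embedding.induce W).toHom Subtype.val_injective

theorem ShortestCycle.connected_range (h : ShortestCycle G g c) :
    (G.induce (Set.range c)).Connected := by
  have hr := h.induce (W := Set.range c) fun i => ⟨i, rfl⟩
  have key : ∀ i, (G.induce (Set.range c)).Reachable ⟨c 0, 0, rfl⟩ ⟨c i, i, rfl⟩ := by
    intro i
    induction i with
    | zero => exact Reachable.refl _
    | succ i ih => exact ih.trans (hr.adj i).reachable
  refine (SimpleGraph.connected_iff_exists_forall_reachable _).2 ⟨⟨c 0, 0, rfl⟩, ?_⟩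
  rintro ⟨_, i, rfl⟩
  exact key i

/-- Vertices are added one at a time: a walk from `W` to a missing vertex has an edge leaving `W`,
and its far end is adjoined. -/
theorem exists_connected_superset [Finite V] (hG : G.Connected) {W₀ : Set V}
    (h₀ : (G.induce W₀).Connected) {s : ℕ} (hs : W₀.ncard ≤ s) (hsV : s ≤ Nat.card V) :
    ∃ W, W₀ ⊆ W ∧ W.ncard = s ∧ (G.induce W).Connected := by
  induction s, hs using Nat.le_induction with
  | base => exact ⟨W₀, subset_rfl, rfl, h₀⟩
  | succ s hs ih =>
    obtain ⟨W, hWs, hWc, hW⟩ := ih (by omega)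
    have hne : ∃ y, y ∉ W := by
      by_contra! hall
      have : W = Set.univ := Set.eq_univ_of_forall hall
      rw [this, Set.ncard_univ] at hWc
      omega
    obtain ⟨y, hy⟩ := hne
    obtain ⟨⟨w, hw⟩⟩ := hW.nonempty
    obtain ⟨p⟩ := hG.preconnected w y
    obtain ⟨d, -, hd1, hd2⟩ := p.exists_boundary_dart W hw hy
    refine ⟨W ∪ {d.fst, d.snd}, hWs.trans Set.subset_union_left, ?_, ?_⟩
    · have : W ∪ {d.fst, d.snd} = insert d.snd W := by
        ext x
        simp only [Set.mem_union, Set.mem_insert_iff, Set.mem_singleton_iff]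
        constructor
        · rintro (h | rfl | rfl)
          · exact Or.inr h
          · exact Or.inr hd1
          · exact Or.inl rfl
        · rintro (rfl | h)
          · exact Or.inr (Or.inr rfl)
          · exact Or.inl h
      rw [this, Set.ncard_insert_of_notMem hd2, hWc]
    · exact induce_union_connected hW.preconnected
        (induce_pair_connected_of_adj d.adj).preconnected ⟨d.fst, hd1, by simp⟩

/-- Reduction to a connected induced subgraph with `g + m` vertices that contains a shortest
cycle. -/
theorem below_of_forall_card {V : Type*} [Fintype V] {G : SimpleGraph V} {g m b : ℕ} {c : ℕ → V}
    {T : ℝ} (hG : G.Connected) (h : ShortestCycle G g c)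
    (hm : g + m ≤ Fintype.card V)
    (base : ∀ (W : Set V) [Fintype W] (c' : ℕ → W), (G.induce W).Connected →
      ShortestCycle (G.induce W) g c' → Fintype.card W = g + m → Below (G.induce W) b T) :
    Below G (b + (Fintype.card V - (g + m))) (T + (Fintype.card V - (g + m) : ℕ)) := by
  classical
  obtain ⟨W, hWs, hWc, hW⟩ := exists_connected_superset hG h.connected_range (s := g + m)
    (by rw [h.ncard_range]; omega) (by rw [Nat.card_eq_fintype_card]; exact hm)
  have hcard : Fintype.card W = g + m := by
    rw [← hWc, ← Nat.card_coe_set_eq, Nat.card_eq_fintype_card]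
  refine Below.of_induce W (by omega) (base W _ hW (h.induce fun i => hWs ⟨i, rfl⟩) hcard)

/-- The predecessor and the successor on the cycle are distinct. Hence no vertex of the cycle is a
leaf, and leaves can be removed without harming it. -/
theorem neighbor_of_mem_cycle (h : ShortestCycle G g c) (i : ℕ) (b : V) :
    ∃ b', b' ≠ b ∧ G.Adj (c i) b' := by
  have h4 := h.four_le
  by_cases hb : b = c (i + 1)
  · refine ⟨c (i + (g - 1)), ?_, ?_⟩
    · rw [hb]
      intro hc
      have := (h.eq_iff _ _).1 hc
      have := Nat.ModEq.add_left_cancel' i this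
      rw [Nat.ModEq, Nat.mod_eq_of_lt (by omega), Nat.mod_eq_of_lt (by omega)] at this
      omega
    · have := h.adj (i + (g - 1))
      rw [show i + (g - 1) + 1 = i + g by omega, h.period] at this
      exact this.symm
  · exact ⟨c (i + 1), fun hc => hb hc.symm, h.adj i⟩

/-- Removing a leaf. -/
theorem below_of_leaf_of_forall {V : Type*} [Fintype V] {G : SimpleGraph V} {g m b : ℕ}
    {c : ℕ → V} {T : ℝ} (hT : 0 < T) (hG : G.Connected) (h : ShortestCycle G g c)
    (hcard : Fintype.card V = g + (m + 1)) {x y : V} (hxy : ∀ v, G.Adj x v ↔ v = y)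
    (base : ∀ (W : Set V) [Fintype W] (c' : ℕ → W), (G.induce W).Connected →
      ShortestCycle (G.induce W) g c' → Fintype.card W = g + m → Below (G.induce W) b T) :
    Below G (b + 1) T := by
  classical
  have hxc : ∀ i, c i ∈ ({x}ᶜ : Set V) := by
    intro i hi
    have hi' : c i = x := by simpa using hi
    obtain ⟨b', hb', hadj⟩ := neighbor_of_mem_cycle h i y
    rw [hi'] at hadj
    exact hb' ((hxy b').1 hadj)
  have hdeg : G.degree x = 1 := by
    rw [← card_neighborFinset_eq_degree, Finset.card_eq_one]
    refine ⟨y, ?_⟩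
    ext v; simp [hxy]
  have hconn := hG.induce_compl_singleton_of_degree_eq_one hdeg
  refine Below.of_leaf hxy rfl hT (base _ _ hconn (h.induce hxc) ?_)
  rw [Fintype.card_compl_set, hcard]
  simp

end Growing

end GirthLap

namespace GirthLap

open Finset SimpleGraph

/-! ### Threshold 4 for girth at least five. -/

section Structure

variable {V : Type*} {G : SimpleGraph V} {g : ℕ} {c : ℕ → V}

theorem ShortestCycle.eq_of_adj (h : ShortestCycle G g c) {i : ℕ} {b : V} (hb : b ∈ Set.range c)
    (hadj : G.Adj (c i) b) : b = c (i + 1) ∨ b = c (i + (g - 1)) := by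
  have h4 := h.four_le
  obtain ⟨j, rfl⟩ := hb
  rcases (h.adj_iff i j).1 hadj with hj | hj
  · exact Or.inl ((h.eq_iff _ _).2 hj)
  · right
    rw [h.eq_iff]
    have h1 : (i + (g - 1)) % g = ((j + 1) + (g - 1)) % g := Nat.ModEq.add_right _ hj
    rw [h1, show j + 1 + (g - 1) = j + g by omega, Nat.add_mod_right]

theorem ncard_le_two_of_subset {s : Set V} {a b : V} (h : s ⊆ {a, b}) : s.ncard ≤ 2 := by
  refine (Set.ncard_le_ncard h (Set.toFinite _)).trans ?_
  exact (Set.ncard_insert_le _ _).trans (by simp)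

theorem ncard_le_three_of_subset {s : Set V} {a b c : V} (h : s ⊆ {a, b, c}) : s.ncard ≤ 3 := by
  refine (Set.ncard_le_ncard h (Set.toFinite _)).trans ?_
  exact (Set.ncard_insert_le _ _).trans (Nat.succ_le_succ (ncard_le_two_of_subset subset_rfl))

/-- The edge from `v` to `c 0` followed by the arc to `c e` is a second path from `v` to `c e`. It
differs from the initial segment of `p`, whose first step stays off the cycle, so `t + (1 + e) ≥ g`.
The reversed cycle replaces `e` by `g - e` and gives the other bound. -/
theorem path_index_bounds (h : ShortestCycle G g c) {v y : V} (hv : v ∉ Set.range c)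
    (hv0 : G.Adj v (c 0)) {p : G.Walk v y} (hp : p.IsPath) (h1 : p.getVert 1 ∉ Set.range c)
    {t e : ℕ} (ht : t ≤ p.length) (he : e < g) (hte : p.getVert t = c e) :
    g ≤ t + 1 + e ∧ e ≤ t + 1 := by
  have key : ∀ c' : ℕ → V, ShortestCycle G g c' → (∀ i, c' i ∈ Set.range c) → G.Adj v (c' 0) →
      ∀ d < g, p.getVert t = c' d → g ≤ t + 1 + d := by
    intro c' hc' hsub hadj d hd hcd
    by_contra! hlt
    obtain ⟨q, hq, hql, hqs⟩ := hc'.exists_arc d hd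
    have hvq : v ∉ q.support := fun hm => by
      obtain ⟨i, rfl⟩ := hqs v hm
      exact hv (hsub i)
    have heq := h.min.path_eq (p := (p.take t).copy rfl hcd) (q := Walk.cons hadj q)
      (by simpa using hp.take t) (hq.cons hvq) (by simp [hql]; omega)
    have := congrArg (fun w => Walk.getVert w 1) heq
    simp only [Walk.getVert_copy, Walk.getVert_cons_succ, Walk.getVert_zero] at this
    rw [Walk.take_getVert] at this
    rcases Nat.eq_zero_or_pos t with rfl | hpos
    · simp at this
      exact hv (this ▸ hsub 0)
    · rw [min_eq_right hpos] at this
      exact h1 (this ▸ hsub 0)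
  refine ⟨key c h (fun i => ⟨i, rfl⟩) hv0 e he hte, ?_⟩
  rcases Nat.eq_zero_or_pos e with rfl | hpos
  · omega
  · have := key _ h.reverse (fun i => ⟨_, rfl⟩) (by simpa using hv0) (g - e) (by omega)
      (by rw [h.reverse_apply he.le]; exact hte)
    omega

/-- In a graph without leaves on fewer than `2 * g` vertices, a vertex outside the shortest cycle
with a neighbour on it has at most two neighbours outside. -/
theorem no_three_branches [Fintype V] (h : ShortestCycle G g c) (hg : 5 ≤ g)
    (hcard : Fintype.card V < 2 * g) (hleaf : ∀ a b, ∃ b', b' ≠ b ∧ G.Adj a b') {v u : V}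
    (hv : v ∉ Set.range c) (hu : u ∈ Set.range c) (hvu : G.Adj v u) (x : Fin 3 → V)
    (hx : Function.Injective x) (hxc : ∀ i, x i ∉ Set.range c) (hvx : ∀ i, G.Adj v (x i)) :
    False := by
  classical
  wlog hu0 : u = c 0 generalizing c
  · obtain ⟨c', hc', hr, h0, -⟩ := h.exists_reparam hu hu
    exact this hc' (by rwa [hr]) (by rwa [hr]) (by rwa [hr]) h0.symm
  subst hu0
  have hpath := fun i => h.min.exists_path (A := Set.univ)
    (fun a _ b => by simpa using hleaf a b) (Set.mem_univ v) (Set.mem_univ (x i)) (hvx i)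
    ((g - 1) / 2 - 1) (by omega)
  choose y p hp hlen h1 _ using hpath
  -- With this length, two of the three paths together are shorter than `g`, so they meet only in
  -- `v`.
  set k := (g - 1) / 2 with hk
  have hlen' : ∀ i, (p i).length = k := fun i => by rw [hlen]; omega
  have hdisj : ∀ i j s t, s ≤ k → t ≤ k → 1 ≤ s → 1 ≤ t →
      (p i).getVert s = (p j).getVert t → i = j := by
    intro i j s t hs ht hs1 ht1 hst
    have heq := h.min.path_eq (p := ((p i).take s).copy rfl hst) (q := (p j).take t)
      (by simpa using (hp i).take s) ((hp j).take t) (by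
        simp [hlen']; omega)
    have := congrArg (fun w => Walk.getVert w 1) heq
    simp only [Walk.getVert_copy, Walk.take_getVert] at this
    rw [min_eq_right hs1, min_eq_right ht1, h1, h1] at this
    exact hx this
  let F : Fin 3 × Fin k → V := fun q => (p q.1).getVert (q.2 + 1)
  have hF : Function.Injective F := by
    rintro ⟨i, s⟩ ⟨j, t⟩ hst
    have hij : i = j := hdisj i j (s + 1) (t + 1) (by omega) (by omega) (by omega) (by omega) hst
    subst hij
    have := (hp i).getVert_injOn (x₁ := s.1 + 1) (x₂ := t.1 + 1)
      (by simp [hlen']) (by simp [hlen']) hst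
    have : s = t := by ext; omega
    rw [this]
  have hvF : ∀ q, F q ≠ v := by
    rintro ⟨i, s⟩ hq
    have := (hp i).getVert_injOn (x₁ := s.1 + 1) (x₂ := 0) (by simp [hlen']) (by simp)
      (by simpa [F] using hq)
    omega
  let I : Finset V := univ.image F
  have hI : I.card = 3 * k := by
    rw [card_image_of_injective _ hF]; simp
  -- By `path_index_bounds` with `t ≤ k`, the three paths can meet the cycle only at indices in this
  -- window.
  let Cw : Finset V := (Icc (g - 1 - k) (k + 1)).image c
  have hCw : Cw.card ≤ 2 * k + 3 - g := card_image_le.trans (by simp; omega)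
  let C : Finset V := (range g).image c
  have hC : C.card = g := by
    rw [card_image_of_injOn]
    · simp
    · intro i hi j hj hij
      exact h.inj_lt (by simpa using hi) (by simpa using hj) hij
  have hmemC : ∀ w, w ∈ C → w ∈ Set.range c := by
    intro w hw
    obtain ⟨i, -, rfl⟩ := mem_image.1 hw
    exact ⟨i, rfl⟩
  have hsub : ∀ w ∈ I, w ∈ C → w ∈ Cw := by
    intro w hw hwC
    obtain ⟨⟨i, s⟩, -, rfl⟩ := mem_image.1 hw
    obtain ⟨e, he, hce⟩ := mem_image.1 hwC
    have := path_index_bounds h hv hvu (hp i) (by rw [h1]; exact hxc i) (t := s + 1) (e := e)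
      (by rw [hlen']; omega) (by simpa using he) hce.symm
    refine mem_image.2 ⟨e, ?_, hce⟩
    rw [mem_Icc]
    omega
  have hd1 : Disjoint (I \ Cw) C := by
    rw [Finset.disjoint_left]
    intro w hw hwC
    rw [mem_sdiff] at hw
    exact hw.2 (hsub w hw.1 hwC)
  have hv1 : v ∉ (I \ Cw) ∪ C := by
    rw [mem_union, mem_sdiff]
    rintro (⟨hm, -⟩ | hm)
    · obtain ⟨q, -, hq⟩ := mem_image.1 hm
      exact hvF q hq
    · exact hv (hmemC v hm)
  -- The vertex `v`, the cycle and the three paths off the window give at least `1 + g + 3k - (2k +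
  -- 3 - g) = 2g + k - 2` vertices, which is at least `2g` as `k ≥ 2`.
  have hcount : (insert v ((I \ Cw) ∪ C)).card ≤ Fintype.card V := card_le_univ _
  rw [card_insert_of_notMem hv1, card_union_of_disjoint hd1, hC] at hcount
  have := le_card_sdiff Cw I
  omega

/-- A family of deletions showing the bound `4`, provided that the vertices attached to the cycle
have few neighbours outside of it. -/
theorem below_four_of_attach [Fintype V] (h : ShortestCycle G g c) (hg : 5 ≤ g) {r : ℕ}
    (hcard : Fintype.card V = g + r) (hr : r < g)
    (hbr : ∀ v ∉ Set.range c, (∃ u ∈ Set.range c, G.Adj v u) →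
      (G.neighborSet v \ Set.range c).ncard ≤ 2)
    {v₀ u₀ b₀ : V} (hv₀ : v₀ ∉ Set.range c) (hu₀ : u₀ ∈ Set.range c) (hvu₀ : G.Adj v₀ u₀)
    (hn₀ : ∀ b, G.Adj v₀ b → b = b₀ ∨ b = u₀) : Below G r 4 := by
  classical
  have h4 := h.four_le
  let R : Finset V := univ.filter (· ∉ Set.range c)
  have hR : R.card = r := by
    have h1 : R = univ \ (Set.range c).toFinset := by
      ext w; simp [R]
    rw [h1, card_univ_sdiff, hcard, ← Set.ncard_eq_toFinset_card', h.ncard_range]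
    omega
  let att : V → Prop := fun w => ∃ u ∈ Set.range c, G.Adj w u
  have hex : ∀ w, ∃ u, att w → u ∈ Set.range c ∧ G.Adj w u := by
    intro w
    by_cases hw : att w
    · obtain ⟨u, hu⟩ := hw
      exact ⟨u, fun _ => hu⟩
    · exact ⟨w, fun h => absurd h hw⟩
  choose nb hnb using hex
  -- The budget: each outside vertex not attached to the cycle is killed, and each attached one
  -- except `v₀` loses its edge to the cycle. Sparing `v₀` pays for the zero at `u₀`, so the total
  -- is `r`.
  let A : Finset V := (R.filter att).erase v₀
  let S : Finset V := insert u₀ (R.filter fun w => ¬att w)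
  let D : Finset (V × V) := A.image fun w => (w, nb w)
  have hv₀R : v₀ ∈ R.filter att := by
    simp only [R, mem_filter, mem_univ, true_and]
    exact ⟨hv₀, u₀, hu₀, hvu₀⟩
  have hcount : S.card + D.card ≤ r := by
    have h1 : S.card ≤ (R.filter fun w => ¬att w).card + 1 := card_insert_le _ _
    have h2 : D.card ≤ A.card := card_image_le
    have h3 : A.card = (R.filter att).card - 1 := card_erase_of_mem hv₀R
    have h4 := card_filter_add_card_filter_not (s := R) att
    have h5 : 0 < (R.filter att).card := card_pos.2 ⟨v₀, hv₀R⟩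
    omega
  have hDmem : ∀ a b, (a, b) ∈ D ↔ a ∉ Set.range c ∧ a ≠ v₀ ∧ att a ∧ b = nb a := by
    intro a b
    simp only [D, A, R, mem_image, mem_erase, mem_filter, mem_univ, true_and, Prod.mk.injEq]
    constructor
    · rintro ⟨w, ⟨h1, h2, h3⟩, rfl, rfl⟩
      exact ⟨h2, h1, h3, rfl⟩
    · rintro ⟨h1, h2, h3, h4⟩
      exact ⟨a, ⟨h2, h1, h3⟩, rfl, h4.symm⟩
  have hSmem : ∀ w, w ∈ S ↔ w = u₀ ∨ (w ∉ Set.range c ∧ ¬att w) := by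
    intro w
    simp [S, R]
  set H : SimpleGraph V := G \ ofPairs D with hH
  have hHadj : ∀ a b, H.Adj a b ↔ G.Adj a b ∧ (a, b) ∉ D ∧ (b, a) ∉ D := by
    intro a b
    rw [hH, SimpleGraph.sdiff_adj]
    simp only [ofPairs, SimpleGraph.fromRel_adj]
    constructor
    · rintro ⟨h1, h2⟩
      have := h1.ne
      tauto
    · rintro ⟨h1, h2, h3⟩
      tauto
  have hnbu : ∀ w ∉ Set.range c, ∀ u ∈ Set.range c, G.Adj w u → nb w = u := fun w hw u hu hwu =>
    h.attach_unique hg hw (hnb w ⟨u, hu, hwu⟩).1 hu (hnb w ⟨u, hu, hwu⟩).2 hwu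
  have hcyc : ∀ i, H.Adj (c i) (c (i + 1)) := by
    intro i
    rw [hHadj]
    refine ⟨h.adj i, fun hd => ?_, fun hd => ?_⟩
    · exact ((hDmem _ _).1 hd).1 ⟨_, rfl⟩
    · exact ((hDmem _ _).1 hd).1 ⟨_, rfl⟩
  have hRR : ∀ a b, a ∉ Set.range c → b ∉ Set.range c → G.Adj a b → H.Adj a b := by
    intro a b ha hb hab
    rw [hHadj]
    refine ⟨hab, fun hd => ?_, fun hd => ?_⟩
    · have := (hDmem _ _).1 hd
      exact hb (this.2.2.2 ▸ (hnb a this.2.2.1).1)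
    · have := (hDmem _ _).1 hd
      exact ha (this.2.2.2 ▸ (hnb b this.2.2.1).1)
  have hattached : ∀ w, w ∉ Set.range c → att w → w ≠ v₀ →
      H.neighborSet w = G.neighborSet w \ Set.range c := by
    intro w hw hatt hwv
    ext b
    simp only [SimpleGraph.mem_neighborSet, Set.mem_sdiff]
    constructor
    · intro hb
      rw [hHadj] at hb
      refine ⟨hb.1, fun hbc => hb.2.1 ?_⟩
      exact (hDmem _ _).2 ⟨hw, hwv, hatt, (hnbu w hw b hbc hb.1).symm⟩
    · rintro ⟨hb, hbc⟩
      exact hRR w b hw hbc hb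
  have hv₀u₀ : H.Adj v₀ u₀ := by
    rw [hHadj]
    refine ⟨hvu₀, fun hd => ?_, fun hd => ?_⟩
    · exact ((hDmem _ _).1 hd).2.1 rfl
    · exact ((hDmem _ _).1 hd).1 hu₀
  have hdeg : ∀ v ∉ (S : Set V), (H.neighborSet v).ncard ≤ 2 := by
    intro v hv
    have hv' : ¬(v = u₀ ∨ (v ∉ Set.range c ∧ ¬att v)) := by
      rw [← hSmem]; simpa using hv
    push Not at hv'
    by_cases hvc : v ∈ Set.range c
    · obtain ⟨i, rfl⟩ := hvc
      have : H.neighborSet (c i) ⊆ {c (i + 1), c (i + (g - 1))} := by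
        intro b hb
        rw [SimpleGraph.mem_neighborSet, hHadj] at hb
        by_cases hbc : b ∈ Set.range c
        · simpa using h.eq_of_adj hbc hb.1
        · exfalso
          have hatt : att b := ⟨c i, ⟨i, rfl⟩, hb.1.symm⟩
          have hnbb := hnbu b hbc (c i) ⟨i, rfl⟩ hb.1.symm
          refine hb.2.2 ((hDmem _ _).2 ⟨hbc, ?_, hatt, hnbb.symm⟩)
          rintro rfl
          exact hv'.1 (h.attach_unique hg hbc ⟨i, rfl⟩ hu₀ hb.1.symm hvu₀)
      exact ncard_le_two_of_subset this
    · by_cases hvv : v = v₀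
      · subst hvv
        have : H.neighborSet v ⊆ {b₀, u₀} := by
          intro b hb
          rw [SimpleGraph.mem_neighborSet, hHadj] at hb
          simpa using hn₀ b hb.1
        exact ncard_le_two_of_subset this
      · rw [hattached v hvc (hv'.2 hvc) hvv]
        exact hbr v hvc (hv'.2 hvc)
  have hreach : ∀ v, ∃ w, H.Reachable v w ∧ (w ∈ (S : Set V) ∨ (H.neighborSet w).ncard < 2) := by
    intro v
    have hu₀S : u₀ ∈ (S : Set V) := by simp [S]
    by_cases hvc : v ∈ Set.range c
    · have hall : ∀ i, H.Reachable (c 0) (c i) := by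
        intro i
        induction i with
        | zero => exact Reachable.refl _
        | succ i ih => exact ih.trans (hcyc i).reachable
      obtain ⟨i, rfl⟩ := hvc
      obtain ⟨j, hj⟩ := hu₀
      exact ⟨u₀, hj ▸ (hall i).symm.trans (hall j), Or.inl hu₀S⟩
    -- Otherwise, in the part of the component of `v` outside the cycle, every vertex has two
    -- neighbours in that part. It would then contain a path on `g` vertices, but only `r < g`
    -- vertices lie outside.
    · by_contra! hcon
      let B : Set V := {w | w ∉ Set.range c ∧ H.Reachable v w}
      have hB : ∀ a ∈ B, ∀ b, ∃ b' ∈ B, b' ≠ b ∧ G.Adj a b' := by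
        rintro a ⟨hac, hva⟩ b
        have hcona := hcon a hva
        have hav : a ≠ v₀ := by
          rintro rfl
          exact (hcon u₀ (hva.trans hv₀u₀.reachable)).1 hu₀S
        have hatt : att a := by
          by_contra hna
          exact hcona.1 (by simpa using (hSmem a).2 (Or.inr ⟨hac, hna⟩))
        have hdega := hcona.2
        obtain ⟨b', hb', hne⟩ := Set.exists_ne_of_one_lt_ncard (Nat.lt_of_succ_le hdega) b
        have hb'' := hb'
        rw [hattached a hac hatt hav] at hb''
        exact ⟨b', ⟨hb''.2, hva.trans (Adj.reachable hb')⟩, hne, hb''.1⟩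
      have hvB : v ∈ B := ⟨hvc, Reachable.refl _⟩
      obtain ⟨x, hxB, -, hvx⟩ := hB v hvB v
      obtain ⟨y, p, hp, hlen, -, hpB⟩ := h.min.exists_path hB hvB hxB hvx (g - 2) (by omega)
      have hsub : p.support.toFinset ⊆ R := by
        intro w hw
        simpa [R] using (hpB w (by simpa using hw)).1
      have := card_le_card hsub
      rw [List.toFinset_card_of_nodup hp.support_nodup, Walk.length_support, hlen, hR] at this
      omega
  refine below_of_delete (H := H) S D hcount (fun u v huv hn => ?_) fun f hf hS => ?_
  · by_contra! hcon
    exact hn ((hHadj u v).2 ⟨huv, hcon.1, hcon.2⟩)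
  · exact qf_lt_four (S := (S : Set V)) hdeg hreach hf (by simpa using hS)

theorem exists_neighbor_ne_of_no_leaf [Nontrivial V] (hG : G.Connected)
    (hleaf : ¬∃ x y, ∀ v, G.Adj x v ↔ v = y) (a b : V) : ∃ b', b' ≠ b ∧ G.Adj a b' := by
  by_contra! hcon
  refine hleaf ⟨a, b, fun v => ⟨fun hv => ?_, ?_⟩⟩
  · by_contra hne
    exact hcon v hne hv
  · rintro rfl
    obtain ⟨w, hw⟩ := hG.preconnected.exists_adj_of_nontrivial a
    by_cases hwv : w = v
    · rwa [hwv] at hw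
    · exact absurd hw (hcon w hwv)

theorem exists_not_mem_range [Fintype V] (h : ShortestCycle G g c) (hcard : g < Fintype.card V) :
    ∃ v, v ∉ Set.range c := by
  by_contra! hall
  have h1 : Set.range c = Set.univ := Set.eq_univ_of_forall hall
  have h2 := h.ncard_range
  rw [h1, Set.ncard_univ, Nat.card_eq_fintype_card] at h2
  omega

end Structure

universe u

/-- Induction on `r`: a leaf can be removed for one condition. Without leaves, `no_three_branches`
supplies the degree bound of `below_four_of_attach`. A vertex `v₀` with at most one outside
neighbour exists, since otherwise the outside would contain a path on `g` vertices; having no leaf,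
`v₀` must be attached to the cycle. -/
theorem below_four_of_five_le {g : ℕ} (hg : 5 ≤ g) (r : ℕ) (hr1 : 1 ≤ r) (hr : r < g) :
    ∀ {V : Type u} [Fintype V] {G : SimpleGraph V} {c : ℕ → V}, G.Connected →
      ShortestCycle G g c → Fintype.card V = g + r → Below G r 4 := by
  classical
  induction r, hr1 using Nat.le_induction with
  | base =>
    intro V _ G c hG h hcard
    obtain ⟨v, hv⟩ := exists_not_mem_range h (by omega)
    have huniq : ∀ w ∉ Set.range c, w = v := by
      intro w hw
      by_contra hne
      have h1 : Set.range c ∪ {v, w} ⊆ Set.univ := Set.subset_univ _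
      have h2 := Set.ncard_le_ncard h1 (Set.toFinite _)
      rw [Set.ncard_union_eq (by
        rw [Set.disjoint_right]
        rintro x (rfl | rfl)
        · exact hv
        · exact hw) (Set.toFinite _) (Set.toFinite _), Set.ncard_pair (Ne.symm hne), h.ncard_range,
        Set.ncard_univ, Nat.card_eq_fintype_card] at h2
      omega
    have : Nontrivial V := Fintype.one_lt_card_iff_nontrivial.1 (by omega)
    have hvn : ∀ b, G.Adj v b → b ∈ Set.range c := by
      intro b hb
      by_contra hbc
      exact hb.ne (huniq b hbc).symm
    obtain ⟨u, hu⟩ := hG.preconnected.exists_adj_of_nontrivial v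
    refine below_four_of_attach h hg hcard hr (fun w hw _ => ?_) hv (hvn u hu) hu (b₀ := u)
      fun b hb => ?_
    · rw [huniq w hw]
      have : G.neighborSet v \ Set.range c = ∅ := by
        ext b
        simp only [Set.mem_sdiff, SimpleGraph.mem_neighborSet, Set.mem_empty_iff_false, iff_false]
        rintro ⟨h1, h2⟩
        exact h2 (hvn b h1)
      simp [this]
    · exact Or.inl (h.attach_unique hg hv (hvn b hb) (hvn u hu) hb hu)
  | succ r hr1 ih =>
    intro V _ G c hG h hcard
    by_cases hleaf : ∃ x y, ∀ v, G.Adj x v ↔ v = y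
    · obtain ⟨x, y, hxy⟩ := hleaf
      exact below_of_leaf_of_forall (by norm_num) hG h hcard hxy fun W _ c' hW hc' hWc =>
        ih (by omega) hW hc' hWc
    · have : Nontrivial V := Fintype.one_lt_card_iff_nontrivial.1 (by omega)
      have hnl := exists_neighbor_ne_of_no_leaf hG hleaf
      have hbr : ∀ v ∉ Set.range c, (∃ u ∈ Set.range c, G.Adj v u) →
          (G.neighborSet v \ Set.range c).ncard ≤ 2 := by
        rintro v hv ⟨u, hu, hvu⟩
        by_contra! hlt
        obtain ⟨x, y, z, hx, hy, hz, hxy, hxz, hyz⟩ := (Set.two_lt_ncard_iff (Set.toFinite _)).1 hlt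
        refine no_three_branches h hg (by omega) hnl hv hu hvu ![x, y, z] ?_ ?_ ?_
        · intro i j hij
          fin_cases i <;> fin_cases j <;> simp_all
        · intro i
          fin_cases i
          · exact hx.2
          · exact hy.2
          · exact hz.2
        · intro i
          fin_cases i
          · exact hx.1
          · exact hy.1
          · exact hz.1
      have hex : ∃ v₀ ∉ Set.range c, ∃ b₀, ∀ b' ∉ Set.range c, G.Adj v₀ b' → b' = b₀ := by
        by_contra! hcon
        have hA : ∀ a ∈ (Set.range c)ᶜ, ∀ b, ∃ b' ∈ (Set.range c)ᶜ, b' ≠ b ∧ G.Adj a b' := by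
          intro a ha b
          obtain ⟨b', h1, h2, h3⟩ := hcon a ha b
          exact ⟨b', h1, h3, h2⟩
        obtain ⟨v, hv⟩ := exists_not_mem_range h (by omega)
        obtain ⟨x, hx, -, hvx⟩ := hA v hv v
        obtain ⟨y, p, hp, hlen, -, hpB⟩ := h.min.exists_path hA hv hx hvx (g - 2) (by omega)
        have hsub : (p.support.toFinset : Set V) ⊆ (Set.range c)ᶜ := by
          intro w hw
          exact hpB w (by simpa using hw)
        have h1 := Set.ncard_le_ncard hsub (Set.toFinite _)
        have h2 := Set.ncard_add_ncard_compl (Set.range c)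
        rw [h.ncard_range, Nat.card_eq_fintype_card] at h2
        rw [Set.ncard_coe_finset, List.toFinset_card_of_nodup hp.support_nodup,
          Walk.length_support, hlen] at h1
        omega
      obtain ⟨v₀, hv₀, b₀, hb₀⟩ := hex
      obtain ⟨u₀, hu₀, hvu₀⟩ := hnl v₀ b₀
      have hu₀c : u₀ ∈ Set.range c := by
        by_contra hn
        exact hu₀ (hb₀ u₀ hn hvu₀)
      refine below_four_of_attach h hg hcard hr hbr hv₀ hu₀c hvu₀ (b₀ := b₀) fun b hb => ?_
      by_cases hbc : b ∈ Set.range c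
      · exact Or.inr (h.attach_unique hg hv₀ hbc hu₀c hb hvu₀)
      · exact Or.inl (hb₀ b hbc hb)

end GirthLap

namespace GirthLap

open Finset SimpleGraph

/-! ### Sum-of-squares certificates for small graphs. -/

section Explicit

/-- `N` lists pairs known to be non-adjacent; all other pairs may be edges, since extra edges only
increase the form. One certificate thus covers every subgraph of a shape. -/
theorem below_of_list {V : Type*} [Fintype V] {m : ℕ} {G : SimpleGraph V} (p : Fin m → V)
    (hp : Function.Bijective p) {N : List (Fin m × Fin m)}
    (hN : ∀ q ∈ N, ¬G.Adj (p q.1) (p q.2)) (D : Finset (Fin m × Fin m))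
    (hD : ∀ i j, i < j → (i, j) ∈ N ∨ (i, j) ∈ D)
    (L : List (Module.Dual ℝ (Fin m → ℝ))) {c : ℕ} (hL : L.length ≤ c) {T ε : ℝ} (hε : 0 < ε)
    (h : ∀ f : Fin m → ℝ, (∀ l ∈ L, l f = 0) →
      ∑ p ∈ D, (f p.1 - f p.2) ^ 2 + ε * ∑ v, f v ^ 2 ≤ T * ∑ v, f v ^ 2) :
    Below G c T := by
  classical
  have h1 := below_ofPairs D L.toFinset ((List.toFinset_card_le L).trans hL) hε
    (fun f hf => h f (by simpa using hf))
  refine h1.of_equiv (Equiv.ofBijective p hp).symm fun u v huv => ?_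
  obtain ⟨i, rfl⟩ := hp.2 u
  obtain ⟨j, rfl⟩ := hp.2 v
  have hi : (Equiv.ofBijective p hp).symm (p i) = i := (Equiv.ofBijective p hp).symm_apply_apply i
  have hj : (Equiv.ofBijective p hp).symm (p j) = j := (Equiv.ofBijective p hp).symm_apply_apply j
  rw [hi, hj]
  have hij : i ≠ j := fun h => huv.ne (by rw [h])
  refine ⟨hij, ?_⟩
  rcases lt_or_gt_of_ne hij with hlt | hgt
  · exact Or.inl ((hD i j hlt).resolve_left fun hn => hN _ hn huv)
  · exact Or.inr ((hD j i hgt).resolve_left fun hn => hN _ hn huv.symm)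

/-- The permitted edges form `K_{3,4}` with parts `{0, 2, 6}` and `{1, 3, 4, 5}`. Zeros on the
smaller part leave the form `3 * ‖f‖ ^ 2`. -/
theorem below_K34_four {V : Type*} [Fintype V] {G : SimpleGraph V} (p : Fin 7 → V)
    (hp : Function.Bijective p)
    (hN : ∀ q ∈ ([(0, 2), (0, 6), (1, 3), (1, 4), (1, 5), (2, 6), (3, 4), (3, 5), (4, 5)] :
      List (Fin 7 × Fin 7)), ¬G.Adj (p q.1) (p q.2)) :
    Below G 3 4 := by
  refine below_of_list p hp hN
    {(0, 1), (0, 3), (0, 4), (0, 5), (1, 2), (1, 6), (2, 3), (2, 4), (2, 5), (3, 6), (4, 6),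
      (5, 6)} (by decide)
    [coord 0, coord 2, coord 6] (by simp) (ε := 1/5) (by norm_num) fun f hf => ?_
  simp at hf
  obtain ⟨h0, h1, h2⟩ := hf
  simp only [Fin.sum_univ_succ, Fin.sum_univ_zero]
  simp [h0, h1, h2]
  linarith [sq_nonneg (f 1),
    sq_nonneg (f 3),
    sq_nonneg (f 4),
    sq_nonneg (f 5)]

/-- A vanishing sum over one part kills the mixed term of a complete bipartite form, which then has
coefficients 4 and 3 on the two parts. The same condition serves for `K_{2,3}`, `K_{3,3}` and, with
threshold 5, `K_{2,4}`. -/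
theorem below_K34_five {V : Type*} [Fintype V] {G : SimpleGraph V} (p : Fin 7 → V)
    (hp : Function.Bijective p)
    (hN : ∀ q ∈ ([(0, 2), (0, 6), (1, 3), (1, 4), (1, 5), (2, 6), (3, 4), (3, 5), (4, 5)] :
      List (Fin 7 × Fin 7)), ¬G.Adj (p q.1) (p q.2)) :
    Below G 1 5 := by
  refine below_of_list p hp hN
    {(0, 1), (0, 3), (0, 4), (0, 5), (1, 2), (1, 6), (2, 3), (2, 4), (2, 5), (3, 6), (4, 6),
      (5, 6)} (by decide)
    [coord 6 + coord 0 + coord 2] (by simp) (ε := 1/5) (by norm_num) fun f hf => ?_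
  simp at hf
  have h0 := hf
  replace h0 : f 6 = -f 0 + -f 2 := by linarith
  simp only [Fin.sum_univ_succ, Fin.sum_univ_zero]
  simp [h0]
  linarith [sq_nonneg (f 1),
    sq_nonneg (f 3),
    sq_nonneg (f 4),
    sq_nonneg (f 5),
    sq_nonneg (f 0 + (1/2) * f 2),
    sq_nonneg (f 2)]

theorem below_K25_four {V : Type*} [Fintype V] {G : SimpleGraph V} (p : Fin 7 → V)
    (hp : Function.Bijective p)
    (hN : ∀ q ∈ ([(0, 2), (1, 3), (1, 4), (1, 5), (1, 6), (3, 4), (3, 5), (3, 6), (4, 5), (4, 6),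
      (5, 6)] :
      List (Fin 7 × Fin 7)), ¬G.Adj (p q.1) (p q.2)) :
    Below G 2 4 := by
  refine below_of_list p hp hN
    {(0, 1), (0, 3), (0, 4), (0, 5), (0, 6), (1, 2), (2, 3), (2, 4), (2, 5), (2, 6)} (by decide)
    [coord 0, coord 2] (by simp) (ε := 1/5) (by norm_num) fun f hf => ?_
  simp at hf
  obtain ⟨h0, h1⟩ := hf
  simp only [Fin.sum_univ_succ, Fin.sum_univ_zero]
  simp [h0, h1]
  linarith [sq_nonneg (f 1),
    sq_nonneg (f 3),
    sq_nonneg (f 4),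
    sq_nonneg (f 5),
    sq_nonneg (f 6)]

theorem below_K25_five {V : Type*} [Fintype V] {G : SimpleGraph V} (p : Fin 7 → V)
    (hp : Function.Bijective p)
    (hN : ∀ q ∈ ([(0, 2), (1, 3), (1, 4), (1, 5), (1, 6), (3, 4), (3, 5), (3, 6), (4, 5), (4, 6),
      (5, 6)] :
      List (Fin 7 × Fin 7)), ¬G.Adj (p q.1) (p q.2)) :
    Below G 2 5 := by
  refine below_of_list p hp hN
    {(0, 1), (0, 3), (0, 4), (0, 5), (0, 6), (1, 2), (2, 3), (2, 4), (2, 5), (2, 6)} (by decide)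
    [coord 0, coord 2] (by simp) (ε := 1/5) (by norm_num) fun f hf => ?_
  simp at hf
  obtain ⟨h0, h1⟩ := hf
  simp only [Fin.sum_univ_succ, Fin.sum_univ_zero]
  simp [h0, h1]
  linarith [sq_nonneg (f 1),
    sq_nonneg (f 3),
    sq_nonneg (f 4),
    sq_nonneg (f 5),
    sq_nonneg (f 6)]

/-- In the shapes `A1`, `A2`, `H1`, `H2` the permitted edges contain a 5-cycle, here `0, 1, 2, 4,
5`, so no complete bipartite graph covers them. Zeros at `0, 2, 5` leave four vertices, each with
exactly two permitted edges, all ending at zeros. -/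
theorem below_A1_four {V : Type*} [Fintype V] {G : SimpleGraph V} (p : Fin 7 → V)
    (hp : Function.Bijective p)
    (hN : ∀ q ∈ ([(0, 2), (0, 4), (0, 6), (1, 3), (1, 4), (1, 5), (1, 6), (2, 5), (3, 4), (3, 5),
      (3, 6), (4, 6)] :
      List (Fin 7 × Fin 7)), ¬G.Adj (p q.1) (p q.2)) :
    Below G 3 4 := by
  refine below_of_list p hp hN
    {(0, 1), (0, 3), (0, 5), (1, 2), (2, 3), (2, 4), (2, 6), (4, 5), (5, 6)} (by decide)
    [coord 0, coord 2, coord 5] (by simp) (ε := 1/5) (by norm_num) fun f hf => ?_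
  simp at hf
  obtain ⟨h0, h1, h2⟩ := hf
  simp only [Fin.sum_univ_succ, Fin.sum_univ_zero]
  simp [h0, h1, h2]
  linarith [sq_nonneg (f 1),
    sq_nonneg (f 3),
    sq_nonneg (f 4),
    sq_nonneg (f 6)]

theorem below_A1_five {V : Type*} [Fintype V] {G : SimpleGraph V} (p : Fin 7 → V)
    (hp : Function.Bijective p)
    (hN : ∀ q ∈ ([(0, 2), (0, 4), (0, 6), (1, 3), (1, 4), (1, 5), (1, 6), (2, 5), (3, 4), (3, 5),
      (3, 6), (4, 6)] :
      List (Fin 7 × Fin 7)), ¬G.Adj (p q.1) (p q.2)) :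
    Below G 2 5 := by
  refine below_of_list p hp hN
    {(0, 1), (0, 3), (0, 5), (1, 2), (2, 3), (2, 4), (2, 6), (4, 5), (5, 6)} (by decide)
    [coord 0, coord 2] (by simp) (ε := 1/5) (by norm_num) fun f hf => ?_
  simp at hf
  obtain ⟨h0, h1⟩ := hf
  simp only [Fin.sum_univ_succ, Fin.sum_univ_zero]
  simp [h0, h1]
  linarith [sq_nonneg (f 1),
    sq_nonneg (f 3),
    sq_nonneg (f 4 + (5/14) * f 5),
    sq_nonneg ((5/14) * f 5 + f 6),
    sq_nonneg (f 5)]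

theorem below_A2_four {V : Type*} [Fintype V] {G : SimpleGraph V} (p : Fin 7 → V)
    (hp : Function.Bijective p)
    (hN : ∀ q ∈ ([(0, 2), (0, 5), (1, 3), (1, 4), (1, 5), (1, 6), (2, 4), (3, 4), (3, 5), (3, 6),
      (4, 6), (5, 6)] :
      List (Fin 7 × Fin 7)), ¬G.Adj (p q.1) (p q.2)) :
    Below G 2 4 := by
  refine below_of_list p hp hN
    {(0, 1), (0, 3), (0, 4), (0, 6), (1, 2), (2, 3), (2, 5), (2, 6), (4, 5)} (by decide)
    [coord 0, coord 2] (by simp) (ε := 1/5) (by norm_num) fun f hf => ?_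
  simp at hf
  obtain ⟨h0, h1⟩ := hf
  simp only [Fin.sum_univ_succ, Fin.sum_univ_zero]
  simp [h0, h1]
  linarith [sq_nonneg (f 1),
    sq_nonneg (f 3),
    sq_nonneg (f 4 + (5/9) * f 5),
    sq_nonneg (f 6),
    sq_nonneg (f 5)]

theorem below_A2_five {V : Type*} [Fintype V] {G : SimpleGraph V} (p : Fin 7 → V)
    (hp : Function.Bijective p)
    (hN : ∀ q ∈ ([(0, 2), (0, 5), (1, 3), (1, 4), (1, 5), (1, 6), (2, 4), (3, 4), (3, 5), (3, 6),
      (4, 6), (5, 6)] :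
      List (Fin 7 × Fin 7)), ¬G.Adj (p q.1) (p q.2)) :
    Below G 2 5 := by
  refine below_of_list p hp hN
    {(0, 1), (0, 3), (0, 4), (0, 6), (1, 2), (2, 3), (2, 5), (2, 6), (4, 5)} (by decide)
    [coord 0, coord 2] (by simp) (ε := 1/5) (by norm_num) fun f hf => ?_
  simp at hf
  obtain ⟨h0, h1⟩ := hf
  simp only [Fin.sum_univ_succ, Fin.sum_univ_zero]
  simp [h0, h1]
  linarith [sq_nonneg (f 1),
    sq_nonneg (f 3),
    sq_nonneg (f 4 + (5/14) * f 5),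
    sq_nonneg (f 6),
    sq_nonneg (f 5)]

/-- The conditions contract the matching `01, 23, 46`, and the form sees only the differences
between the four resulting classes. `below_H2_four` contracts the matching `04, 12, 36`. -/
theorem below_H1_four {V : Type*} [Fintype V] {G : SimpleGraph V} (p : Fin 7 → V)
    (hp : Function.Bijective p)
    (hN : ∀ q ∈ ([(0, 2), (0, 5), (0, 6), (1, 3), (1, 4), (1, 5), (2, 4), (2, 6), (3, 4), (3, 5),
      (5, 6)] :
      List (Fin 7 × Fin 7)), ¬G.Adj (p q.1) (p q.2)) :
    Below G 3 4 := by
  refine below_of_list p hp hN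
    {(0, 1), (0, 3), (0, 4), (1, 2), (1, 6), (2, 3), (2, 5), (3, 6), (4, 5), (4, 6)} (by decide)
    [coord 1 - coord 0, coord 3 - coord 2, coord 6 - coord 4] (by simp) (ε := 1/5) (by norm_num)
      fun f hf => ?_
  simp at hf
  obtain ⟨h0, h1, h2⟩ := hf
  replace h0 : f 1 = f 0 := by linarith
  replace h1 : f 3 = f 2 := by linarith
  replace h2 : f 6 = f 4 := by linarith
  simp only [Fin.sum_univ_succ, Fin.sum_univ_zero]
  simp [h0, h1, h2]
  linarith [sq_nonneg (f 0 + (5/9) * f 2 + (5/9) * f 4),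
    sq_nonneg (f 2 + (-5/112) * f 4 + (45/112) * f 5),
    sq_nonneg (f 4 + (45/107) * f 5),
    sq_nonneg (f 5)]

theorem below_H1_five {V : Type*} [Fintype V] {G : SimpleGraph V} (p : Fin 7 → V)
    (hp : Function.Bijective p)
    (hN : ∀ q ∈ ([(0, 2), (0, 5), (0, 6), (1, 3), (1, 4), (1, 5), (2, 4), (2, 6), (3, 4), (3, 5),
      (5, 6)] :
      List (Fin 7 × Fin 7)), ¬G.Adj (p q.1) (p q.2)) :
    Below G 2 5 := by
  refine below_of_list p hp hN
    {(0, 1), (0, 3), (0, 4), (1, 2), (1, 6), (2, 3), (2, 5), (3, 6), (4, 5), (4, 6)} (by decide)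
    [coord 1, coord 3] (by simp) (ε := 1/5) (by norm_num) fun f hf => ?_
  simp at hf
  obtain ⟨h0, h1⟩ := hf
  simp only [Fin.sum_univ_succ, Fin.sum_univ_zero]
  simp [h0, h1]
  linarith [sq_nonneg ((5/14) * f 2 + (5/14) * f 4 + f 5),
    sq_nonneg (f 0 + (5/9) * f 4),
    sq_nonneg ((5/9) * f 4 + f 6),
    sq_nonneg (f 2 + (-25/101) * f 4),
    sq_nonneg (f 4)]

theorem below_H2_four {V : Type*} [Fintype V] {G : SimpleGraph V} (p : Fin 7 → V)
    (hp : Function.Bijective p)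
    (hN : ∀ q ∈ ([(0, 2), (0, 5), (0, 6), (1, 3), (1, 4), (1, 5), (2, 5), (2, 6), (3, 4), (3, 5),
      (4, 6)] :
      List (Fin 7 × Fin 7)), ¬G.Adj (p q.1) (p q.2)) :
    Below G 3 4 := by
  refine below_of_list p hp hN
    {(0, 1), (0, 3), (0, 4), (1, 2), (1, 6), (2, 3), (2, 4), (3, 6), (4, 5), (5, 6)} (by decide)
    [coord 4 - coord 0, coord 2 - coord 1, coord 6 - coord 3] (by simp) (ε := 1/5) (by norm_num)
      fun f hf => ?_
  simp at hf
  obtain ⟨h0, h1, h2⟩ := hf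
  replace h0 : f 4 = f 0 := by linarith
  replace h1 : f 2 = f 1 := by linarith
  replace h2 : f 6 = f 3 := by linarith
  simp only [Fin.sum_univ_succ, Fin.sum_univ_zero]
  simp [h0, h1, h2]
  linarith [sq_nonneg (f 0 + (5/9) * f 1 + (5/18) * f 3 + (5/18) * f 5),
    sq_nonneg ((10/23) * f 1 + f 3 + (5/23) * f 5),
    sq_nonneg (f 1 + (-50/107) * f 5),
    sq_nonneg (f 5)]

theorem below_H2_five {V : Type*} [Fintype V] {G : SimpleGraph V} (p : Fin 7 → V)
    (hp : Function.Bijective p)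
    (hN : ∀ q ∈ ([(0, 2), (0, 5), (0, 6), (1, 3), (1, 4), (1, 5), (2, 5), (2, 6), (3, 4), (3, 5),
      (4, 6)] :
      List (Fin 7 × Fin 7)), ¬G.Adj (p q.1) (p q.2)) :
    Below G 2 5 := by
  refine below_of_list p hp hN
    {(0, 1), (0, 3), (0, 4), (1, 2), (1, 6), (2, 3), (2, 4), (3, 6), (4, 5), (5, 6)} (by decide)
    [coord 1, coord 3] (by simp) (ε := 1/5) (by norm_num) fun f hf => ?_
  simp at hf
  obtain ⟨h0, h1⟩ := hf
  simp only [Fin.sum_univ_succ, Fin.sum_univ_zero]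
  simp [h0, h1]
  linarith [sq_nonneg ((5/14) * f 4 + f 5 + (5/14) * f 6),
    sq_nonneg (f 0 + (5/9) * f 4),
    sq_nonneg (f 2 + (5/9) * f 4),
    sq_nonneg ((-25/101) * f 4 + f 6),
    sq_nonneg (f 4)]

theorem below_K23_four {V : Type*} [Fintype V] {G : SimpleGraph V} (p : Fin 5 → V)
    (hp : Function.Bijective p)
    (hN : ∀ q ∈ ([(0, 2), (1, 3), (1, 4), (3, 4)] :
      List (Fin 5 × Fin 5)), ¬G.Adj (p q.1) (p q.2)) :
    Below G 1 4 := by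
  refine below_of_list p hp hN
    {(0, 1), (0, 3), (0, 4), (1, 2), (2, 3), (2, 4)} (by decide)
    [coord 2 + coord 0] (by simp) (ε := 1/5) (by norm_num) fun f hf => ?_
  simp at hf
  have h0 := hf
  replace h0 : f 2 = -f 0 := by linarith
  simp only [Fin.sum_univ_succ, Fin.sum_univ_zero]
  simp [h0]
  linarith [sq_nonneg (f 1),
    sq_nonneg (f 3),
    sq_nonneg (f 4),
    sq_nonneg (f 0)]

theorem below_K33_four {V : Type*} [Fintype V] {G : SimpleGraph V} (p : Fin 6 → V)
    (hp : Function.Bijective p)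
    (hN : ∀ q ∈ ([(0, 2), (0, 5), (1, 3), (1, 4), (2, 5), (3, 4)] :
      List (Fin 6 × Fin 6)), ¬G.Adj (p q.1) (p q.2)) :
    Below G 1 4 := by
  refine below_of_list p hp hN
    {(0, 1), (0, 3), (0, 4), (1, 2), (1, 5), (2, 3), (2, 4), (3, 5), (4, 5)} (by decide)
    [coord 5 + coord 0 + coord 2] (by simp) (ε := 1/5) (by norm_num) fun f hf => ?_
  simp at hf
  have h0 := hf
  replace h0 : f 5 = -f 0 + -f 2 := by linarith
  simp only [Fin.sum_univ_succ, Fin.sum_univ_zero]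
  simp [h0]
  linarith [sq_nonneg (f 0 + (1/2) * f 2),
    sq_nonneg (f 2),
    sq_nonneg (f 1),
    sq_nonneg (f 3),
    sq_nonneg (f 4)]

theorem below_K24_four {V : Type*} [Fintype V] {G : SimpleGraph V} (p : Fin 6 → V)
    (hp : Function.Bijective p)
    (hN : ∀ q ∈ ([(0, 2), (1, 3), (1, 4), (1, 5), (3, 4), (3, 5), (4, 5)] :
      List (Fin 6 × Fin 6)), ¬G.Adj (p q.1) (p q.2)) :
    Below G 2 4 := by
  refine below_of_list p hp hN
    {(0, 1), (0, 3), (0, 4), (0, 5), (1, 2), (2, 3), (2, 4), (2, 5)} (by decide)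
    [coord 0, coord 2] (by simp) (ε := 1/5) (by norm_num) fun f hf => ?_
  simp at hf
  obtain ⟨h0, h1⟩ := hf
  simp only [Fin.sum_univ_succ, Fin.sum_univ_zero]
  simp [h0, h1]
  linarith [sq_nonneg (f 1),
    sq_nonneg (f 3),
    sq_nonneg (f 4),
    sq_nonneg (f 5)]

theorem below_K24_five {V : Type*} [Fintype V] {G : SimpleGraph V} (p : Fin 6 → V)
    (hp : Function.Bijective p)
    (hN : ∀ q ∈ ([(0, 2), (1, 3), (1, 4), (1, 5), (3, 4), (3, 5), (4, 5)] :
      List (Fin 6 × Fin 6)), ¬G.Adj (p q.1) (p q.2)) :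
    Below G 1 5 := by
  refine below_of_list p hp hN
    {(0, 1), (0, 3), (0, 4), (0, 5), (1, 2), (2, 3), (2, 4), (2, 5)} (by decide)
    [coord 2 + coord 0] (by simp) (ε := 1/5) (by norm_num) fun f hf => ?_
  simp at hf
  have h0 := hf
  replace h0 : f 2 = -f 0 := by linarith
  simp only [Fin.sum_univ_succ, Fin.sum_univ_zero]
  simp [h0]
  linarith [sq_nonneg (f 1),
    sq_nonneg (f 3),
    sq_nonneg (f 4),
    sq_nonneg (f 5),
    sq_nonneg (f 0)]

theorem below_K24_sub_edge_four {V : Type*} [Fintype V] {G : SimpleGraph V} (p : Fin 6 → V)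
    (hp : Function.Bijective p)
    (hN : ∀ q ∈ ([(0, 2), (1, 3), (1, 4), (1, 5), (2, 5), (3, 4), (3, 5), (4, 5)] :
      List (Fin 6 × Fin 6)), ¬G.Adj (p q.1) (p q.2)) :
    Below G 1 4 := by
  refine below_of_list p hp hN
    {(0, 1), (0, 3), (0, 4), (0, 5), (1, 2), (2, 3), (2, 4)} (by decide)
    [coord 2 + coord 0] (by simp) (ε := 1/5) (by norm_num) fun f hf => ?_
  simp at hf
  have h0 := hf
  replace h0 : f 2 = -f 0 := by linarith
  simp only [Fin.sum_univ_succ, Fin.sum_univ_zero]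
  simp [h0]
  linarith [sq_nonneg ((5/14) * f 0 + f 5),
    sq_nonneg (f 1),
    sq_nonneg (f 3),
    sq_nonneg (f 4),
    sq_nonneg (f 0)]

theorem below_K23s_four {V : Type*} [Fintype V] {G : SimpleGraph V} (p : Fin 6 → V)
    (hp : Function.Bijective p)
    (hN : ∀ q ∈ ([(0, 2), (0, 5), (1, 3), (1, 4), (1, 5), (2, 4), (3, 4), (3, 5)] :
      List (Fin 6 × Fin 6)), ¬G.Adj (p q.1) (p q.2)) :
    Below G 2 4 := by
  refine below_of_list p hp hN
    {(0, 1), (0, 3), (0, 4), (1, 2), (2, 3), (2, 5), (4, 5)} (by decide)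
    [coord 0, coord 2] (by simp) (ε := 1/5) (by norm_num) fun f hf => ?_
  simp at hf
  obtain ⟨h0, h1⟩ := hf
  simp only [Fin.sum_univ_succ, Fin.sum_univ_zero]
  simp [h0, h1]
  linarith [sq_nonneg (f 1),
    sq_nonneg (f 3),
    sq_nonneg (f 4 + (5/9) * f 5),
    sq_nonneg (f 5)]

theorem below_K23s_five {V : Type*} [Fintype V] {G : SimpleGraph V} (p : Fin 6 → V)
    (hp : Function.Bijective p)
    (hN : ∀ q ∈ ([(0, 2), (0, 5), (1, 3), (1, 4), (1, 5), (2, 4), (3, 4), (3, 5)] :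
      List (Fin 6 × Fin 6)), ¬G.Adj (p q.1) (p q.2)) :
    Below G 1 5 := by
  refine below_of_list p hp hN
    {(0, 1), (0, 3), (0, 4), (1, 2), (2, 3), (2, 5), (4, 5)} (by decide)
    [coord 0] (by simp) (ε := 1/5) (by norm_num) fun f hf => ?_
  simp at hf
  have h0 := hf
  simp only [Fin.sum_univ_succ, Fin.sum_univ_zero]
  simp [h0]
  linarith [sq_nonneg (f 1 + (5/14) * f 2),
    sq_nonneg ((5/14) * f 2 + f 3),
    sq_nonneg (f 4 + (5/14) * f 5),
    sq_nonneg ((70/171) * f 2 + f 5),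
    sq_nonneg (f 2)]

/-- This rules out `Y_{8,3}`, the one graph `Y_{n,3}` with `n ≥ 7` missing from the list. The
condition ties the value at the vertex between the two branch vertices to theirs. -/
theorem below_Y83_four {V : Type*} [Fintype V] {G : SimpleGraph V} (p : Fin 8 → V)
    (hp : Function.Bijective p)
    (hN : ∀ q ∈ ([(0, 2), (0, 3), (0, 4), (0, 7), (1, 3), (1, 4), (1, 5), (1, 6), (1, 7), (2, 4),
      (2, 5), (2, 6), (3, 5), (3, 6), (3, 7), (4, 6), (4, 7), (5, 6), (5, 7), (6, 7)] :
      List (Fin 8 × Fin 8)), ¬G.Adj (p q.1) (p q.2)) :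
    Below G 1 4 := by
  refine below_of_list p hp hN
    {(0, 1), (0, 5), (0, 6), (1, 2), (2, 3), (2, 7), (3, 4), (4, 5)} (by decide)
    [coord 1 - coord 0 - coord 2] (by simp) (ε := 1/10) (by norm_num) fun f hf => ?_
  simp at hf
  have h0 := hf
  replace h0 : f 1 = f 0 + f 2 := by linarith
  simp only [Fin.sum_univ_succ, Fin.sum_univ_zero]
  simp [h0]
  linarith [sq_nonneg (f 0 + (13/16) * f 2 + (5/24) * f 5 + (5/24) * f 6),
    sq_nonneg ((10/29) * f 2 + f 7),
    sq_nonneg ((-195/646) * f 2 + (-25/323) * f 5 + f 6),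
    sq_nonneg ((10/19) * f 2 + f 3 + (10/19) * f 4),
    sq_nonneg ((-1885/3608) * f 2 + (1615/2706) * f 4 + f 5),
    sq_nonneg ((-3975/798832) * f 2 + f 4),
    sq_nonneg (f 2)]

end Explicit

end GirthLap

namespace GirthLap

open Finset SimpleGraph

/-! ### Girth four: triangle-free graphs on at most seven vertices. -/

section GirthFour

variable {V : Type*} {G : SimpleGraph V}

theorem NoShortCycle.not_triangle {g : ℕ} (h : NoShortCycle G g) (hg : 4 ≤ g) {a b c : V}
    (hab : G.Adj a b) (hbc : G.Adj b c) : ¬G.Adj a c := by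
  intro hac
  have := h.path_eq (p := Walk.cons hab (Walk.cons hbc Walk.nil)) (q := Walk.cons hac Walk.nil)
    (by simp [hab.ne, hbc.ne, hac.ne]) (by simp [hac.ne]) (by simp; omega)
  have := congrArg Walk.length this
  simp at this

theorem exists_bijective_append [Fintype V] {g : ℕ} {c : ℕ → V} (h : ShortestCycle G g c) {r : ℕ}
    (hcard : Fintype.card V = g + r) :
    ∃ q : Fin r → V, Function.Bijective (Fin.append (fun i : Fin g => c i) q) ∧
      ∀ j, q j ∉ Set.range c := by
  classical
  have h1 : Fintype.card {v // v ∉ Set.range c} = r := by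
    rw [Fintype.card_subtype_compl, hcard, ← Nat.card_eq_fintype_card (α := {x // x ∈ Set.range c})]
    have := h.ncard_range
    rw [← Nat.card_coe_set_eq] at this
    have e : Nat.card {x // x ∈ Set.range c} = g := this
    omega
  let e := (Fintype.equivFinOfCardEq h1).symm
  refine ⟨fun j => (e j).1, ?_, fun j => (e j).2⟩
  rw [Fintype.bijective_iff_injective_and_card]
  refine ⟨?_, by simp [hcard]⟩
  rw [Fin.append_injective_iff]
  refine ⟨?_, ?_, ?_⟩
  · intro i j hij
    exact Fin.ext (h.inj_lt i.2 j.2 hij)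
  · exact Subtype.val_injective.comp e.injective
  · intro i j hij
    exact (e j).2 ⟨i, hij⟩

/-- `p` starts with a 4-cycle, and `G` has no triangle. -/
structure FourCycle {m : ℕ} [NeZero m] (G : SimpleGraph V) (p : Fin m → V) : Prop where
  bij : Function.Bijective p
  adj01 : G.Adj (p 0) (p 1)
  adj12 : G.Adj (p 1) (p 2)
  adj23 : G.Adj (p 2) (p 3)
  adj30 : G.Adj (p 3) (p 0)
  tri : ∀ {a b c}, G.Adj a b → G.Adj b c → ¬G.Adj a c

/-- Without triangles, a neighbour of `p 1` or `p 3` sees neither `p 0` nor `p 2`. Each vertex can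
thus be assigned to a class according to which opposite pair it may see. -/
theorem FourCycle.parity {m : ℕ} [NeZero m] {p : Fin m → V} (h : FourCycle G p) (x : V) :
    (¬G.Adj x (p 1) ∧ ¬G.Adj x (p 3)) ∨ (¬G.Adj x (p 0) ∧ ¬G.Adj x (p 2)) := by
  by_contra! hcon
  by_cases h1 : G.Adj x (p 1)
  · have e0 := h.tri h1 h.adj01.symm
    have e2 := h.tri h1 h.adj12
    exact e2 (hcon.2 e0)
  · have h3 := hcon.1 h1
    have e0 := h.tri h3 h.adj30
    have e2 := h.tri h3 h.adj23.symm
    exact e2 (hcon.2 e0)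

/-- The possible shapes of a triangle-free graph on six vertices that contains a 4-cycle. -/
inductive SixShape (G : SimpleGraph V) : Prop
  | bipartite (p : Fin 6 → V) (hp : Function.Bijective p)
      (hN : ∀ q ∈ ([(0, 2), (0, 5), (1, 3), (1, 4), (2, 5), (3, 4)] : List (Fin 6 × Fin 6)),
        ¬G.Adj (p q.1) (p q.2))
  | sub (p : Fin 6 → V) (hp : Function.Bijective p)
      (hN : ∀ q ∈ ([(0, 2), (1, 3), (1, 4), (1, 5), (2, 5), (3, 4), (3, 5), (4, 5)] :
        List (Fin 6 × Fin 6)), ¬G.Adj (p q.1) (p q.2))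
  | full (p : Fin 6 → V) (hp : FourCycle G p)
      (hN : ∀ q ∈ ([(0, 2), (1, 3), (1, 4), (1, 5), (3, 4), (3, 5), (4, 5)] :
        List (Fin 6 × Fin 6)), ¬G.Adj (p q.1) (p q.2))
      (hA : ∀ q ∈ ([(0, 4), (0, 5), (2, 4), (2, 5)] : List (Fin 6 × Fin 6)),
        G.Adj (p q.1) (p q.2))
  | theta (p : Fin 6 → V) (hp : FourCycle G p)
      (hN : ∀ q ∈ ([(0, 2), (0, 5), (1, 3), (1, 4), (1, 5), (2, 4), (3, 4), (3, 5)] :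
        List (Fin 6 × Fin 6)), ¬G.Adj (p q.1) (p q.2))
      (hA : ∀ q ∈ ([(0, 4), (2, 5), (4, 5)] : List (Fin 6 × Fin 6)), G.Adj (p q.1) (p q.2))

/-- If `p 4` and `p 5` are not adjacent, the graph is `K_{2,4}` or lacks one of its edges. If they
are adjacent, they share no neighbour: either they see opposite vertices of the 4-cycle, which is
the theta shape, or one of them misses the 4-cycle and can change class, so that `K_{3,3}` contains
the graph. -/
theorem FourCycle.six_of_same {p : Fin 6 → V} (h : FourCycle G p)
    (h41 : ¬G.Adj (p 4) (p 1)) (h43 : ¬G.Adj (p 4) (p 3))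
    (h51 : ¬G.Adj (p 5) (p 1)) (h53 : ¬G.Adj (p 5) (p 3)) : SixShape G := by
  have h02 := h.tri h.adj01 h.adj12
  have h13 := h.tri h.adj12 h.adj23
  have bip : ∀ σ : Fin 6 → Fin 6, Function.Bijective σ →
      (∀ q ∈ ([(0, 2), (0, 5), (1, 3), (1, 4), (2, 5), (3, 4)] : List (Fin 6 × Fin 6)),
        ¬G.Adj ((p ∘ σ) q.1) ((p ∘ σ) q.2)) → SixShape G := fun σ hσ hN =>
    SixShape.bipartite _ (h.bij.comp hσ) hN
  by_cases h45 : G.Adj (p 4) (p 5)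
  · have key : ∀ p : Fin 6 → V, FourCycle G p → ¬G.Adj (p 4) (p 1) → ¬G.Adj (p 4) (p 3) →
        ¬G.Adj (p 5) (p 1) → ¬G.Adj (p 5) (p 3) → G.Adj (p 4) (p 5) → G.Adj (p 4) (p 0) →
        G.Adj (p 5) (p 2) → SixShape G := by
      intro p h h41 h43 h51 h53 h45 h40 h52
      have h02 := h.tri h.adj01 h.adj12
      have h13 := h.tri h.adj12 h.adj23
      have h42 : ¬G.Adj (p 4) (p 2) := h.tri h45 h52
      have h50 : ¬G.Adj (p 5) (p 0) := h.tri h45.symm h40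
      refine SixShape.theta p h ?_ ?_
      · simp
        repeat' apply And.intro
        all_goals first | assumption | (rw [G.adj_comm]; assumption)
      · simp
        exact ⟨h40.symm, h52.symm, h45⟩
    by_cases h50 : G.Adj (p 5) (p 0)
    · by_cases h42 : G.Adj (p 4) (p 2)
      · exact key (p ∘ ![2, 3, 0, 1, 4, 5])
          ⟨h.bij.comp (by decide), h.adj23, h.adj30, h.adj01, h.adj12, h.tri⟩ h43 h41 h53 h51 h45
          h42 h50
      · have h40 : ¬G.Adj (p 4) (p 0) := h.tri h45 h50
        refine bip ![0, 1, 2, 3, 5, 4] (by decide) ?_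
        simp
        repeat' apply And.intro
        all_goals first | assumption | (rw [G.adj_comm]; assumption)
    · by_cases h52 : G.Adj (p 5) (p 2)
      · by_cases h40 : G.Adj (p 4) (p 0)
        · exact key p h h41 h43 h51 h53 h45 h40 h52
        · have h42 : ¬G.Adj (p 4) (p 2) := h.tri h45 h52
          refine bip ![0, 1, 2, 3, 5, 4] (by decide) ?_
          simp
          repeat' apply And.intro
          all_goals first | assumption | (rw [G.adj_comm]; assumption)
      · refine bip ![0, 1, 2, 3, 4, 5] (by decide) ?_
        simp
        repeat' apply And.intro
        all_goals first | assumption | (rw [G.adj_comm]; assumption)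
  · have sub : ∀ σ : Fin 6 → Fin 6, Function.Bijective σ →
        (∀ q ∈ ([(0, 2), (1, 3), (1, 4), (1, 5), (2, 5), (3, 4), (3, 5), (4, 5)] :
          List (Fin 6 × Fin 6)), ¬G.Adj ((p ∘ σ) q.1) ((p ∘ σ) q.2)) → SixShape G :=
      fun σ hσ hN => SixShape.sub _ (h.bij.comp hσ) hN
    by_cases h40 : G.Adj (p 4) (p 0)
    · by_cases h42 : G.Adj (p 4) (p 2)
      · by_cases h50 : G.Adj (p 5) (p 0)
        · by_cases h52 : G.Adj (p 5) (p 2)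
          · refine SixShape.full p h ?_ ?_
            · simp
              repeat' apply And.intro
              all_goals first | assumption | (rw [G.adj_comm]; assumption)
            · simp
              exact ⟨h40.symm, h50.symm, h42.symm, h52.symm⟩
          · refine sub ![0, 1, 2, 3, 4, 5] (by decide) ?_
            simp
            repeat' apply And.intro
            all_goals first | assumption | (rw [G.adj_comm]; assumption)
        · refine sub ![2, 1, 0, 3, 4, 5] (by decide) ?_
          simp
          repeat' apply And.intro
          all_goals first | assumption | (rw [G.adj_comm]; assumption)
      · refine sub ![0, 1, 2, 3, 5, 4] (by decide) ?_
        simp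
        repeat' apply And.intro
        all_goals first | assumption | (rw [G.adj_comm]; assumption)
    · refine sub ![2, 1, 0, 3, 5, 4] (by decide) ?_
      simp
      repeat' apply And.intro
      all_goals first | assumption | (rw [G.adj_comm]; assumption)

theorem FourCycle.six {p : Fin 6 → V} (h : FourCycle G p) : SixShape G := by
  have h02 := h.tri h.adj01 h.adj12
  have h13 := h.tri h.adj12 h.adj23
  rcases h.parity (p 4) with ⟨a1, a2⟩ | ⟨a1, a2⟩ <;> rcases h.parity (p 5) with ⟨b1, b2⟩ | ⟨b1, b2⟩
  · exact h.six_of_same a1 a2 b1 b2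
  · refine SixShape.bipartite p h.bij ?_
    simp
    repeat' apply And.intro
    all_goals first | assumption | (rw [G.adj_comm]; assumption)
  · refine SixShape.bipartite (p ∘ ![0, 1, 2, 3, 5, 4]) (h.bij.comp (by decide)) ?_
    simp
    repeat' apply And.intro
    all_goals first | assumption | (rw [G.adj_comm]; assumption)
  · exact FourCycle.six_of_same (p := p ∘ ![1, 2, 3, 0, 4, 5])
      ⟨h.bij.comp (by decide), h.adj12, h.adj23, h.adj30, h.adj01, h.tri⟩ a2 a1 b2 b1

variable [Fintype V]

theorem FourCycle.seven_of_bipartite {p : Fin 7 → V}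
    (hp : Function.Bijective p)
    (hN : ∀ q ∈ ([(0, 2), (0, 6), (1, 3), (1, 4), (1, 5), (2, 6), (3, 4), (3, 5), (4, 5)] :
      List (Fin 7 × Fin 7)), ¬G.Adj (p q.1) (p q.2)) : Below G 3 4 ∧ Below G 2 5 :=
  ⟨below_K34_four p hp hN, (below_K34_five p hp hN).mono (by norm_num) le_rfl⟩

/-- Off the 4-cycle only `p 4 p 5` and `p 5 p 6` can be edges. None present gives a subgraph of
`K_{2,5}`; one gives `K_{3,4}` or `A2`; both give `K_{3,4}` or `A1`. -/
theorem FourCycle.seven_of_same {p : Fin 7 → V} (h : FourCycle G p)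
    (h41 : ¬G.Adj (p 4) (p 1)) (h43 : ¬G.Adj (p 4) (p 3))
    (h51 : ¬G.Adj (p 5) (p 1)) (h53 : ¬G.Adj (p 5) (p 3))
    (h61 : ¬G.Adj (p 6) (p 1)) (h63 : ¬G.Adj (p 6) (p 3)) (h46 : ¬G.Adj (p 4) (p 6)) :
    Below G 3 4 ∧ Below G 2 5 := by
  have h02 := h.tri h.adj01 h.adj12
  have h13 := h.tri h.adj12 h.adj23
  by_cases hx : G.Adj (p 4) (p 5)
  · by_cases hz : G.Adj (p 5) (p 6)
    · wlog h50 : G.Adj (p 5) (p 0) generalizing p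
      · by_cases h52 : G.Adj (p 5) (p 2)
        · exact this (p := p ∘ ![2, 3, 0, 1, 4, 5, 6])
            ⟨h.bij.comp (by decide), h.adj23, h.adj30, h.adj01, h.adj12, h.tri⟩
            h43 h41 h53 h51 h63 h61 h46 (fun hh => h02 hh.symm) (fun hh => h13 hh.symm) hx hz h52
        · refine seven_of_bipartite (p := p ∘ ![0, 1, 2, 3, 4, 6, 5]) (h.bij.comp (by decide)) ?_
          simp
          repeat' apply And.intro
          all_goals first | assumption | (rw [G.adj_comm]; assumption)
      · have h40 : ¬G.Adj (p 4) (p 0) := h.tri hx h50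
        have h60 : ¬G.Adj (p 6) (p 0) := h.tri hz.symm h50
        by_cases h52 : G.Adj (p 5) (p 2)
        · have h42 : ¬G.Adj (p 4) (p 2) := h.tri hx h52
          have h62 : ¬G.Adj (p 6) (p 2) := h.tri hz.symm h52
          refine seven_of_bipartite (p := p ∘ ![1, 0, 3, 2, 4, 6, 5]) (h.bij.comp (by decide)) ?_
          simp
          repeat' apply And.intro
          all_goals first | assumption | (rw [G.adj_comm]; assumption)
        · have hN : ∀ q ∈ ([(0, 2), (0, 4), (0, 6), (1, 3), (1, 4), (1, 5), (1, 6), (2, 5), (3, 4),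
            (3, 5), (3, 6), (4, 6)] : List (Fin 7 × Fin 7)), ¬G.Adj (p q.1) (p q.2) := by
            simp
            repeat' apply And.intro
            all_goals first | assumption | (rw [G.adj_comm]; assumption)
          exact ⟨below_A1_four p h.bij hN, below_A1_five p h.bij hN⟩
    · wlog h42 : G.Adj (p 4) (p 2) generalizing p
      · by_cases h40 : G.Adj (p 4) (p 0)
        · exact this (p := p ∘ ![2, 3, 0, 1, 4, 5, 6])
            ⟨h.bij.comp (by decide), h.adj23, h.adj30, h.adj01, h.adj12, h.tri⟩
            h43 h41 h53 h51 h63 h61 h46 (fun hh => h02 hh.symm) (fun hh => h13 hh.symm) hx hz h40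
        · refine seven_of_bipartite (p := p ∘ ![0, 1, 2, 3, 5, 6, 4]) (h.bij.comp (by decide)) ?_
          simp
          repeat' apply And.intro
          all_goals first | assumption | (rw [G.adj_comm]; assumption)
      · have h52 : ¬G.Adj (p 5) (p 2) := h.tri hx.symm h42
        by_cases h50 : G.Adj (p 5) (p 0)
        · have h40 : ¬G.Adj (p 4) (p 0) := h.tri hx h50
          have hN : ∀ q ∈ ([(0, 2), (0, 5), (1, 3), (1, 4), (1, 5), (1, 6), (2, 4), (3, 4), (3, 5),
            (3, 6), (4, 6), (5, 6)] : List (Fin 7 × Fin 7)),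
            ¬G.Adj ((p ∘ ![0, 1, 2, 3, 5, 4, 6]) q.1) ((p ∘ ![0, 1, 2, 3, 5, 4, 6]) q.2) := by
            simp
            repeat' apply And.intro
            all_goals first | assumption | (rw [G.adj_comm]; assumption)
          exact ⟨(below_A2_four _ (h.bij.comp (by decide)) hN).mono (by norm_num) le_rfl,
            below_A2_five _ (h.bij.comp (by decide)) hN⟩
        · refine seven_of_bipartite (p := p ∘ ![0, 1, 2, 3, 4, 6, 5]) (h.bij.comp (by decide)) ?_
          simp
          repeat' apply And.intro
          all_goals first | assumption | (rw [G.adj_comm]; assumption)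
  · by_cases hz : G.Adj (p 5) (p 6)
    · wlog h62 : G.Adj (p 6) (p 2) generalizing p
      · by_cases h60 : G.Adj (p 6) (p 0)
        · exact this (p := p ∘ ![2, 3, 0, 1, 4, 5, 6])
            ⟨h.bij.comp (by decide), h.adj23, h.adj30, h.adj01, h.adj12, h.tri⟩
            h43 h41 h53 h51 h63 h61 h46 (fun hh => h02 hh.symm) (fun hh => h13 hh.symm) hx hz h60
        · refine seven_of_bipartite (p := p ∘ ![0, 1, 2, 3, 4, 5, 6]) (h.bij.comp (by decide)) ?_
          simp
          repeat' apply And.intro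
          all_goals first | assumption | (rw [G.adj_comm]; assumption)
      · have h52 : ¬G.Adj (p 5) (p 2) := h.tri hz h62
        by_cases h50 : G.Adj (p 5) (p 0)
        · have h60 : ¬G.Adj (p 6) (p 0) := h.tri hz.symm h50
          have hN : ∀ q ∈ ([(0, 2), (0, 5), (1, 3), (1, 4), (1, 5), (1, 6), (2, 4), (3, 4), (3, 5),
            (3, 6), (4, 6), (5, 6)] : List (Fin 7 × Fin 7)),
            ¬G.Adj ((p ∘ ![0, 1, 2, 3, 5, 6, 4]) q.1) ((p ∘ ![0, 1, 2, 3, 5, 6, 4]) q.2) := by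
            simp
            repeat' apply And.intro
            all_goals first | assumption | (rw [G.adj_comm]; assumption)
          exact ⟨(below_A2_four _ (h.bij.comp (by decide)) hN).mono (by norm_num) le_rfl,
            below_A2_five _ (h.bij.comp (by decide)) hN⟩
        · refine seven_of_bipartite (p := p ∘ ![0, 1, 2, 3, 4, 6, 5]) (h.bij.comp (by decide)) ?_
          simp
          repeat' apply And.intro
          all_goals first | assumption | (rw [G.adj_comm]; assumption)
    · have hN : ∀ q ∈ ([(0, 2), (1, 3), (1, 4), (1, 5), (1, 6), (3, 4), (3, 5), (3, 6), (4, 5),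
        (4, 6), (5, 6)] : List (Fin 7 × Fin 7)), ¬G.Adj (p q.1) (p q.2) := by
        simp
        repeat' apply And.intro
        all_goals first | assumption | (rw [G.adj_comm]; assumption)
      exact ⟨(below_K25_four p h.bij hN).mono (by norm_num) le_rfl, below_K25_five p h.bij hN⟩

theorem FourCycle.seven_of_mixed {p : Fin 7 → V} (h : FourCycle G p)
    (h41 : ¬G.Adj (p 4) (p 1)) (h43 : ¬G.Adj (p 4) (p 3))
    (h51 : ¬G.Adj (p 5) (p 1)) (h53 : ¬G.Adj (p 5) (p 3))
    (h60 : ¬G.Adj (p 6) (p 0)) (h62 : ¬G.Adj (p 6) (p 2)) :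
    Below G 3 4 ∧ Below G 2 5 := by
  have h02 := h.tri h.adj01 h.adj12
  have h13 := h.tri h.adj12 h.adj23
  by_cases hxy : G.Adj (p 4) (p 5)
  · wlog h56 : ¬G.Adj (p 5) (p 6) generalizing p
    · have h46 : ¬G.Adj (p 4) (p 6) := h.tri hxy (not_not.1 h56)
      exact this (p := p ∘ ![0, 1, 2, 3, 5, 4, 6])
        ⟨h.bij.comp (by decide), h.adj01, h.adj12, h.adj23, h.adj30, h.tri⟩
        h51 h53 h41 h43 h60 h62 h02 h13 hxy.symm h46
    · have H1 : ∀ p : Fin 7 → V, FourCycle G p →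
          (∀ q ∈ ([(0, 2), (0, 5), (0, 6), (1, 3), (1, 4), (1, 5), (2, 4), (2, 6), (3, 4), (3, 5),
            (5, 6)] : List (Fin 7 × Fin 7)), ¬G.Adj (p q.1) (p q.2)) →
          Below G 3 4 ∧ Below G 2 5 := fun p h hN =>
        ⟨below_H1_four p h.bij hN, below_H1_five p h.bij hN⟩
      have H2 : ∀ p : Fin 7 → V, FourCycle G p →
          (∀ q ∈ ([(0, 2), (0, 5), (0, 6), (1, 3), (1, 4), (1, 5), (2, 5), (2, 6), (3, 4), (3, 5),
            (4, 6)] : List (Fin 7 × Fin 7)), ¬G.Adj (p q.1) (p q.2)) →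
          Below G 3 4 ∧ Below G 2 5 := fun p h hN =>
        ⟨below_H2_four p h.bij hN, below_H2_five p h.bij hN⟩
      by_cases h40 : G.Adj (p 4) (p 0)
      · have h50 : ¬G.Adj (p 5) (p 0) := h.tri hxy.symm h40
        by_cases h42 : G.Adj (p 4) (p 2)
        · have h52 : ¬G.Adj (p 5) (p 2) := h.tri hxy.symm h42
          by_cases h46 : G.Adj (p 4) (p 6)
          · refine seven_of_bipartite (p := p ∘ ![1, 0, 3, 2, 5, 6, 4]) (h.bij.comp (by decide)) ?_
            simp
            repeat' apply And.intro
            all_goals first | assumption | (rw [G.adj_comm]; assumption)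
          · refine H2 p h ?_
            simp
            repeat' apply And.intro
            all_goals first | assumption | (rw [G.adj_comm]; assumption)
        · refine H1 p h ?_
          simp
          repeat' apply And.intro
          all_goals first | assumption | (rw [G.adj_comm]; assumption)
      · by_cases h52 : G.Adj (p 5) (p 2)
        · have h42 : ¬G.Adj (p 4) (p 2) := h.tri hxy h52
          by_cases h50 : G.Adj (p 5) (p 0)
          · refine H2 (p ∘ ![0, 1, 2, 3, 5, 4, 6])
              ⟨h.bij.comp (by decide), h.adj01, h.adj12, h.adj23, h.adj30, h.tri⟩ ?_
            simp
            repeat' apply And.intro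
            all_goals first | assumption | (rw [G.adj_comm]; assumption)
          · refine H1 p h ?_
            simp
            repeat' apply And.intro
            all_goals first | assumption | (rw [G.adj_comm]; assumption)
        · refine H1 (p ∘ ![2, 3, 0, 1, 4, 5, 6])
            ⟨h.bij.comp (by decide), h.adj23, h.adj30, h.adj01, h.adj12, h.tri⟩ ?_
          simp
          repeat' apply And.intro
          all_goals first | assumption | (rw [G.adj_comm]; assumption)
  · refine seven_of_bipartite (p := p) h.bij ?_
    simp
    repeat' apply And.intro
    all_goals first | assumption | (rw [G.adj_comm]; assumption)

/-- If all three outside vertices are in one class, some two of them are non-adjacent, as there is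
no triangle; these are renamed `p 4` and `p 6`. -/
theorem FourCycle.seven_of_two {p : Fin 7 → V} (h : FourCycle G p)
    (h41 : ¬G.Adj (p 4) (p 1)) (h43 : ¬G.Adj (p 4) (p 3))
    (h51 : ¬G.Adj (p 5) (p 1)) (h53 : ¬G.Adj (p 5) (p 3)) : Below G 3 4 ∧ Below G 2 5 := by
  rcases h.parity (p 6) with ⟨h61, h63⟩ | ⟨h60, h62⟩
  · by_cases h46 : G.Adj (p 4) (p 6)
    · by_cases h45 : G.Adj (p 4) (p 5)
      · have h56 : ¬G.Adj (p 5) (p 6) := h.tri h45.symm h46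
        exact FourCycle.seven_of_same (p := p ∘ ![0, 1, 2, 3, 5, 4, 6])
          ⟨h.bij.comp (by decide), h.adj01, h.adj12, h.adj23, h.adj30, h.tri⟩
          h51 h53 h41 h43 h61 h63 h56
      · exact FourCycle.seven_of_same (p := p ∘ ![0, 1, 2, 3, 4, 6, 5])
          ⟨h.bij.comp (by decide), h.adj01, h.adj12, h.adj23, h.adj30, h.tri⟩
          h41 h43 h61 h63 h51 h53 h45
    · exact h.seven_of_same h41 h43 h51 h53 h61 h63 h46
  · exact h.seven_of_mixed h41 h43 h51 h53 h60 h62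

/-- Two of the three outside vertices fall into the same class; rotating the 4-cycle exchanges the
classes. -/
theorem FourCycle.seven {p : Fin 7 → V} (h : FourCycle G p) : Below G 3 4 ∧ Below G 2 5 := by
  have rot : FourCycle G (p ∘ ![1, 2, 3, 0, 4, 5, 6]) :=
    ⟨h.bij.comp (by decide), h.adj12, h.adj23, h.adj30, h.adj01, h.tri⟩
  have sw : ∀ {p : Fin 7 → V}, FourCycle G p → FourCycle G (p ∘ ![0, 1, 2, 3, 4, 6, 5]) :=
    fun h => ⟨h.bij.comp (by decide), h.adj01, h.adj12, h.adj23, h.adj30, h.tri⟩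
  have sw' : ∀ {p : Fin 7 → V}, FourCycle G p → FourCycle G (p ∘ ![0, 1, 2, 3, 5, 6, 4]) :=
    fun h => ⟨h.bij.comp (by decide), h.adj01, h.adj12, h.adj23, h.adj30, h.tri⟩
  rcases h.parity (p 4) with ⟨a1, a2⟩ | ⟨a1, a2⟩ <;> rcases h.parity (p 5) with ⟨b1, b2⟩ | ⟨b1, b2⟩
  · exact h.seven_of_two a1 a2 b1 b2
  · rcases h.parity (p 6) with ⟨c1, c2⟩ | ⟨c1, c2⟩
    · exact (sw h).seven_of_two a1 a2 c1 c2
    · exact (sw' rot).seven_of_two b2 b1 c2 c1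
  · rcases h.parity (p 6) with ⟨c1, c2⟩ | ⟨c1, c2⟩
    · exact (sw' h).seven_of_two b1 b2 c1 c2
    · exact (sw rot).seven_of_two a2 a1 c2 c1
  · exact rot.seven_of_two a2 a1 b2 b1

theorem SixShape.below_two_four (h : SixShape G) : Below G 2 4 := by
  cases h with
  | bipartite p hp hN => exact (below_K33_four p hp hN).mono (by norm_num) le_rfl
  | sub p hp hN => exact (below_K24_sub_edge_four p hp hN).mono (by norm_num) le_rfl
  | full p hp hN => exact below_K24_four p hp.bij hN
  | theta p hp hN => exact below_K23s_four p hp.bij hN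

theorem SixShape.below_one_five (h : SixShape G) : Below G 1 5 := by
  cases h with
  | bipartite p hp hN => exact (below_K33_four p hp hN).mono le_rfl (by norm_num)
  | sub p hp hN => exact (below_K24_sub_edge_four p hp hN).mono le_rfl (by norm_num)
  | full p hp hN => exact below_K24_five p hp.bij hN
  | theta p hp hN => exact below_K23s_five p hp.bij hN

theorem FourCycle.five {p : Fin 5 → V} (h : FourCycle G p) : Below G 1 4 := by
  have h02 := h.tri h.adj01 h.adj12
  have h13 := h.tri h.adj12 h.adj23
  rcases h.parity (p 4) with ⟨a1, a2⟩ | ⟨a1, a2⟩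
  · refine below_K23_four p h.bij ?_
    simp
    repeat' apply And.intro
    all_goals first | assumption | (rw [G.adj_comm]; assumption)
  · refine below_K23_four (p ∘ ![1, 2, 3, 0, 4]) (h.bij.comp (by decide)) ?_
    simp
    repeat' apply And.intro
    all_goals first | assumption | (rw [G.adj_comm]; assumption)

theorem exists_fourCycle {c : ℕ → V} (h : ShortestCycle G 4 c) {r : ℕ}
    (hcard : Fintype.card V = 4 + r) : ∃ p : Fin (4 + r) → V, FourCycle G p := by
  obtain ⟨q, hq, -⟩ := exists_bijective_append h hcard
  have e : ∀ i : Fin 4, Fin.append (fun i : Fin 4 => c i) q (Fin.castAdd r i) = c i := fun i => by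
    rw [Fin.append_left]
  have e0 : Fin.append (fun i : Fin 4 => c i) q 0 = c 0 := e 0
  have e1 : Fin.append (fun i : Fin 4 => c i) q 1 = c 1 := by
    refine Eq.trans ?_ (e 1); congr 1; ext; exact Nat.mod_eq_of_lt (show 1 < 4 + r by lia)
  have e2 : Fin.append (fun i : Fin 4 => c i) q 2 = c 2 := by
    refine Eq.trans ?_ (e 2); congr 1; ext; exact Nat.mod_eq_of_lt (show 2 < 4 + r by lia)
  have e3 : Fin.append (fun i : Fin 4 => c i) q 3 = c 3 := by
    refine Eq.trans ?_ (e 3); congr 1; ext; exact Nat.mod_eq_of_lt (show 3 < 4 + r by lia)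
  refine ⟨_, hq, ?_, ?_, ?_, ?_, fun hab hbc => h.min.not_triangle le_rfl hab hbc⟩
  · rw [e0, e1]; exact h.adj 0
  · rw [e1, e2]; exact h.adj 1
  · rw [e2, e3]; exact h.adj 2
  · rw [e3, e0, ← h.period 0]; exact h.adj 3

end GirthFour

end GirthLap

namespace GirthLap

open Finset SimpleGraph

theorem sdiff_ofPairs_singleton_adj {V : Type*} {G : SimpleGraph V} {u v a b : V} :
    (G \ ofPairs {(u, v)}).Adj a b ↔
    G.Adj a b ∧ ¬(a = u ∧ b = v) ∧ ¬(b = u ∧ a = v) := by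
  classical
  rw [SimpleGraph.sdiff_adj]
  simp only [ofPairs, SimpleGraph.fromRel_adj, mem_singleton, Prod.mk.injEq]
  constructor
  · rintro ⟨h1, h2⟩
    have := h1.ne
    tauto
  · rintro ⟨h1, h2, h3⟩
    tauto

/-! ### Few vertices outside the cycle, and threshold 5. -/

section Outside

variable {V : Type*} [Fintype V] {G : SimpleGraph V} {g : ℕ} {c : ℕ → V}

theorem exists_attached (hG : G.Connected) (h : ShortestCycle G g c)
    (hcard : g < Fintype.card V) : ∃ x ∉ Set.range c, ∃ u ∈ Set.range c, G.Adj x u := by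
  obtain ⟨v, hv⟩ := exists_not_mem_range h hcard
  obtain ⟨p⟩ := hG.preconnected (c 0) v
  obtain ⟨d, -, hd1, hd2⟩ := p.exists_boundary_dart (Set.range c) ⟨0, rfl⟩ hv
  exact ⟨d.snd, hd2, d.fst, hd1, d.adj.symm⟩

theorem exists_outside (h : ShortestCycle G g c) {r : ℕ} (hcard : Fintype.card V = g + r) :
    ∃ q : Fin r → V, Function.Injective q ∧ (∀ j, q j ∉ Set.range c) ∧
      ∀ v ∉ Set.range c, ∃ j, q j = v := by
  obtain ⟨q, hq, hqc⟩ := exists_bijective_append h hcard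
  refine ⟨q, ?_, hqc, fun v hv => ?_⟩
  · exact (Fin.append_injective_iff.1 hq.1).2.1
  · obtain ⟨i, hi⟩ := hq.2 v
    induction i using Fin.addCases with
    | left i => exact absurd ⟨i, by simpa using hi⟩ hv
    | right j => exact ⟨j, by simpa using hi⟩

theorem exists_outside_one (hG : G.Connected) (h : ShortestCycle G g c)
    (hcard : Fintype.card V = g + 1) :
    ∃ x u, x ∉ Set.range c ∧ u ∈ Set.range c ∧ G.Adj x u ∧ ∀ v ∉ Set.range c, v = x := by
  obtain ⟨x, hx, u, hu, hxu⟩ := exists_attached hG h (by omega)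
  obtain ⟨q, hq, hqc, hall⟩ := exists_outside h hcard
  refine ⟨x, u, hx, hu, hxu, fun v hv => ?_⟩
  obtain ⟨i, rfl⟩ := hall x hx
  obtain ⟨j, rfl⟩ := hall v hv
  rw [Subsingleton.elim i j]

theorem exists_outside_two (hG : G.Connected) (h : ShortestCycle G g c)
    (hcard : Fintype.card V = g + 2) :
    ∃ x y u, x ≠ y ∧ x ∉ Set.range c ∧ y ∉ Set.range c ∧ u ∈ Set.range c ∧ G.Adj x u ∧
      ∀ v ∉ Set.range c, v = x ∨ v = y := by
  obtain ⟨x, hx, u, hu, hxu⟩ := exists_attached hG h (by omega)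
  obtain ⟨q, hq, hqc, hall⟩ := exists_outside h hcard
  obtain ⟨i, rfl⟩ := hall x hx
  refine ⟨q i, q (i + 1), u, hq.ne (by fin_cases i <;> decide), hx, hqc _, hu, hxu, fun v hv => ?_⟩
  obtain ⟨j, rfl⟩ := hall v hv
  have : j = i ∨ j = i + 1 := by fin_cases i <;> fin_cases j <;> decide
  rcases this with rfl | rfl <;> simp

theorem exists_outside_three (h : ShortestCycle G g c) (hcard : Fintype.card V = g + 3) {x : V}
    (hx : x ∉ Set.range c) :
    ∃ y z, x ≠ y ∧ x ≠ z ∧ y ≠ z ∧ y ∉ Set.range c ∧ z ∉ Set.range c ∧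
      ∀ v ∉ Set.range c, v = x ∨ v = y ∨ v = z := by
  obtain ⟨q, hq, hqc, hall⟩ := exists_outside h hcard
  obtain ⟨i, rfl⟩ := hall x hx
  refine ⟨q (i + 1), q (i + 2), hq.ne (by fin_cases i <;> decide),
    hq.ne (by fin_cases i <;> decide), hq.ne (by fin_cases i <;> decide), hqc _, hqc _,
    fun v hv => ?_⟩
  obtain ⟨j, rfl⟩ := hall v hv
  have : j = i ∨ j = i + 1 ∨ j = i + 2 := by fin_cases i <;> fin_cases j <;> decide
  rcases this with rfl | rfl | rfl <;> simp

/-- After killing `u₀` and deleting `D`, only `u₂` can have degree three, and `qf_lt_five` applies.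
If the degree of `u₂` exceeds three then `u₂ = u₀` is already a zero, and `x` takes the role of the
exceptional vertex. -/
theorem below_five_of_delete (h : ShortestCycle G g c) {H : SimpleGraph V} (hHG : H ≤ G)
    {D : Finset (V × V)} {m : ℕ} (hm : 1 + D.card ≤ m)
    (hD : ∀ u v, G.Adj u v → ¬H.Adj u v → (u, v) ∈ D ∨ (v, u) ∈ D) {u₀ u₂ x y : V}
    (hx : x ∉ Set.range c)
    (hR : ∀ v ∉ Set.range c, (H.neighborSet v).ncard ≤ 2)
    (hC : ∀ v ∈ Set.range c, v ≠ u₀ → ∀ b ∉ Set.range c, H.Adj v b → v = u₂ ∧ b = y) :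
    Below G m 5 := by
  classical
  have hdeg : ∀ v ∉ ({u₀} : Set V), v ≠ u₂ → (H.neighborSet v).ncard ≤ 2 := by
    intro v hv hvu
    by_cases hvc : v ∈ Set.range c
    · obtain ⟨i, rfl⟩ := hvc
      refine ncard_le_two_of_subset (a := c (i + 1)) (b := c (i + (g - 1))) fun b hb => ?_
      by_cases hbc : b ∈ Set.range c
      · simpa using h.eq_of_adj hbc (hHG hb)
      · exact absurd (hC _ ⟨i, rfl⟩ (by simpa using hv) b hbc hb).1 hvu
    · exact hR v hvc
  refine below_of_delete (H := H) {u₀} D (by simpa using hm) hD fun f hf hS => ?_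
  by_cases hu : (H.neighborSet u₂).ncard ≤ 3
  · exact qf_lt_five (S := {u₀}) hdeg hu hf (by simpa using hS)
  · have hu₂ : u₂ = u₀ := by
      by_contra hne
      apply hu
      by_cases hvc : u₂ ∈ Set.range c
      · obtain ⟨i, rfl⟩ := hvc
        refine ncard_le_three_of_subset (a := c (i + 1)) (b := c (i + (g - 1))) (c := y)
          fun b hb => ?_
        by_cases hbc : b ∈ Set.range c
        · rcases h.eq_of_adj hbc (hHG hb) with e | e <;> simp [e]
        · simp [(hC _ ⟨i, rfl⟩ hne b hbc hb).2]
      · exact (hR _ hvc).trans (by norm_num)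
    refine qf_lt_five (S := {u₀}) (u := x) (fun v hv hvx => ?_) ((hR x hx).trans (by norm_num)) hf
      (by simpa using hS)
    exact hdeg v hv (by simpa [hu₂] using hv)

/-- A vertex outside the cycle has at most one neighbour on it. -/
theorem exists_attach_vertex (h : ShortestCycle G g c) (hg : 5 ≤ g) {y : V}
    (hy : y ∉ Set.range c) : ∃ u ∈ Set.range c, ∀ b ∈ Set.range c, G.Adj y b → b = u := by
  by_cases hyu : ∃ u ∈ Set.range c, G.Adj y u
  · obtain ⟨u, hu, hyu⟩ := hyu
    exact ⟨u, hu, fun b hb hyb => h.attach_unique hg hy hb hu hyb hyu⟩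
  · push Not at hyu
    exact ⟨c 0, ⟨0, rfl⟩, fun b hb hyb => absurd hyb (hyu b hb)⟩

/-- The condition is spent on the attachment vertex of `x`; only that of `y` can still have degree
three. -/
theorem below_one_five_of_five_le (hg : 5 ≤ g) (hG : G.Connected) (h : ShortestCycle G g c)
    (hcard : Fintype.card V = g + 2) : Below G 1 5 := by
  obtain ⟨x, y, u, hxy, hx, hy, hu, hxu, hall⟩ := exists_outside_two hG h hcard
  obtain ⟨w, hw, hyw⟩ := exists_attach_vertex h hg hy
  refine below_five_of_delete h le_rfl (D := ∅) (u₀ := u) (u₂ := w) (y := y) (by simp)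
    (fun a b hab hn => absurd hab hn) hx (fun v hv => ?_) fun v hv hvu b hb hvb => ?_
  · rcases hall v hv with rfl | rfl
    · refine ncard_le_two_of_subset (a := y) (b := u) fun b hb => ?_
      by_cases hbc : b ∈ Set.range c
      · exact Or.inr (h.attach_unique hg hv hbc hu hb hxu)
      · rcases hall b hbc with rfl | rfl
        · exact absurd rfl (Adj.ne hb)
        · simp
    · refine ncard_le_two_of_subset (a := x) (b := w) fun b hb => ?_
      by_cases hbc : b ∈ Set.range c
      · exact Or.inr (hyw b hbc hb)
      · rcases hall b hbc with rfl | rfl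
        · simp
        · exact absurd rfl (Adj.ne hb)
  · rcases hall b hb with rfl | rfl
    · exact absurd (h.attach_unique hg hb hv hu hvb.symm hxu) hvu
    · exact ⟨hyw v hv hvb.symm, rfl⟩

theorem exists_outside_not_adj (hg : 5 ≤ g) (h : ShortestCycle G g c)
    (hcard : Fintype.card V = g + 3) :
    ∃ x y z, x ∉ Set.range c ∧ y ∉ Set.range c ∧ z ∉ Set.range c ∧
      (∀ v ∉ Set.range c, v = x ∨ v = y ∨ v = z) ∧ ¬G.Adj x z := by
  obtain ⟨x, hx⟩ := exists_not_mem_range h (by omega)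
  obtain ⟨y, z, hxy, hxz, hyz, hy, hz, hall⟩ := exists_outside_three h hcard hx
  by_cases h1 : G.Adj x z
  · by_cases h2 : G.Adj x y
    · exact ⟨y, x, z, hy, hx, hz, fun v hv => by rcases hall v hv with e | e | e <;> simp [e],
        h.min.not_triangle (by omega) h2.symm h1⟩
    · exact ⟨x, z, y, hx, hz, hy, fun v hv => by rcases hall v hv with e | e | e <;> simp [e], h2⟩
  · exact ⟨x, y, z, hx, hy, hz, hall, h1⟩

/-- The outside vertices are named so that `x` and `z` are not adjacent. Cutting `y` from the cycle
and killing the attachment vertex of `x` leaves only the attachment vertex of `z` with possible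
degree three. -/
theorem below_two_five_of_five_le (hg : 5 ≤ g) (h : ShortestCycle G g c)
    (hcard : Fintype.card V = g + 3) : Below G 2 5 := by
  classical
  obtain ⟨x, y, z, hx, hy, hz, hall, hxz⟩ := exists_outside_not_adj hg h hcard
  obtain ⟨u, hu, hxu⟩ := exists_attach_vertex h hg hx
  obtain ⟨v, hv, hyv⟩ := exists_attach_vertex h hg hy
  obtain ⟨w, hw, hzw⟩ := exists_attach_vertex h hg hz
  have hHadj : ∀ a b, (G \ ofPairs {(y, v)}).Adj a b ↔
      G.Adj a b ∧ ¬(a = y ∧ b = v) ∧ ¬(b = y ∧ a = v) := fun a b => sdiff_ofPairs_singleton_adj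
  have hR : ∀ a b, a ∉ Set.range c → (G \ ofPairs {(y, v)}).Adj a b → b ∉ Set.range c →
      (a = x ∧ b = y) ∨ (a = y ∧ (b = x ∨ b = z)) ∨ (a = z ∧ b = y) := by
    intro a b ha hab hb
    have hab' := ((hHadj a b).1 hab).1
    rcases hall a ha with rfl | rfl | rfl <;> rcases hall b hb with rfl | rfl | rfl <;>
      first | exact absurd rfl hab'.ne | exact absurd hab' hxz | exact absurd hab'.symm hxz | simp
  have hcy : ∀ b ∈ Set.range c, ¬(G \ ofPairs {(y, v)}).Adj y b := by
    intro b hb hyb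
    rw [hHadj] at hyb
    exact hyb.2.1 ⟨rfl, hyv b hb hyb.1⟩
  refine below_five_of_delete h (H := G \ ofPairs {(y, v)}) sdiff_le (D := {(y, v)}) (u₀ := u)
    (u₂ := w) (y := z) (by simp) (fun a b hab hn => ?_) hx (fun a ha => ?_)
    fun a ha hau b hb hab => ?_
  · rw [hHadj] at hn
    simp only [mem_singleton, Prod.mk.injEq]
    tauto
  · rcases hall a ha with rfl | rfl | rfl
    · refine ncard_le_two_of_subset (a := y) (b := u) fun b hb => ?_
      by_cases hbc : b ∈ Set.range c
      · exact Or.inr (hxu b hbc ((hHadj _ _).1 hb).1)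
      · have := hR _ b ha hb hbc
        simp only [Set.mem_insert_iff]
        rcases this with h1 | h1 | h1
        · exact Or.inl h1.2
        · exfalso
          rcases h1.2 with rfl | rfl
          · exact ((hHadj _ _).1 hb).1.ne rfl
          · exact hxz ((hHadj _ _).1 hb).1
        · exact Or.inl h1.2
    · refine ncard_le_two_of_subset (a := x) (b := z) fun b hb => ?_
      by_cases hbc : b ∈ Set.range c
      · exact absurd hb (hcy b hbc)
      · have := hR _ b ha hb hbc
        have hne := ((hHadj _ _).1 hb).1.ne
        simp only [Set.mem_insert_iff, Set.mem_singleton_iff]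
        rcases this with h1 | h1 | h1
        · exact absurd h1.2.symm hne
        · exact h1.2
        · exact absurd h1.2.symm hne
    · refine ncard_le_two_of_subset (a := y) (b := w) fun b hb => ?_
      by_cases hbc : b ∈ Set.range c
      · exact Or.inr (hzw b hbc ((hHadj _ _).1 hb).1)
      · have := hR _ b ha hb hbc
        simp only [Set.mem_insert_iff]
        rcases this with h1 | h1 | h1
        · exact Or.inl h1.2
        · exfalso
          rcases h1.2 with rfl | rfl
          · exact hxz ((hHadj _ _).1 hb).1.symm
          · exact ((hHadj _ _).1 hb).1.ne rfl
        · exact Or.inl h1.2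
  · have hab' := ((hHadj a b).1 hab).1
    rcases hall b hb with rfl | rfl | rfl
    · exact absurd (hxu a ha hab'.symm) hau
    · exact absurd hab.symm (hcy a ha)
    · exact ⟨hzw a ha hab'.symm, rfl⟩

theorem below_one_five (hG : G.Connected) (h : ShortestCycle G g c)
    (hcard : Fintype.card V = g + 2) : Below G 1 5 := by
  rcases h.four_le.eq_or_lt with rfl | hg
  · obtain ⟨p, hp⟩ := exists_fourCycle h hcard
    exact hp.six.below_one_five
  · exact below_one_five_of_five_le hg hG h hcard

theorem below_two_five (h : ShortestCycle G g c)
    (hcard : Fintype.card V = g + 3) : Below G 2 5 := by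
  rcases h.four_le.eq_or_lt with rfl | hg
  · obtain ⟨p, hp⟩ := exists_fourCycle h hcard
    exact hp.seven.2
  · exact below_two_five_of_five_le hg h hcard

theorem below_four (hG : G.Connected) (h : ShortestCycle G g c) {r : ℕ} (hr1 : 1 ≤ r)
    (hr : r < g) (hcard : Fintype.card V = g + r) : Below G r 4 := by
  rcases h.four_le.eq_or_lt with rfl | hg
  · have : r = 1 ∨ r = 2 ∨ r = 3 := by omega
    rcases this with rfl | rfl | rfl
    · obtain ⟨p, hp⟩ := exists_fourCycle h hcard
      exact hp.five
    · obtain ⟨p, hp⟩ := exists_fourCycle h hcard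
      exact hp.six.below_two_four
    · obtain ⟨p, hp⟩ := exists_fourCycle h hcard
      exact hp.seven.1
  · exact below_four_of_five_le hg r hr1 hr hG h hcard

end Outside

end GirthLap

namespace GirthLap

open Finset SimpleGraph

/-! ### Recognising the named graphs. -/

section Iso

variable {V W : Type*} {G : SimpleGraph V} {H : SimpleGraph W}

theorem nonempty_iso_of_bijective {p : W → V} (hp : Function.Bijective p)
    (hadj : ∀ a b, H.Adj a b ↔ G.Adj (p a) (p b)) : Nonempty (G ≃g H) :=
  ⟨(RelIso.mk (Equiv.ofBijective p hp) (by intro a b; exact (hadj a b).symm) : H ≃g G).symm⟩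

theorem nonempty_iso_of_list (E N : List (W × W))
    (hE : ∀ a b, H.Adj a b ↔ (a, b) ∈ E ∨ (b, a) ∈ E)
    (hEN : ∀ a b, a = b ∨ (a, b) ∈ E ∨ (b, a) ∈ E ∨ (a, b) ∈ N ∨ (b, a) ∈ N) {p : W → V}
    (hp : Function.Bijective p) (hA : ∀ q ∈ E, G.Adj (p q.1) (p q.2))
    (hN : ∀ q ∈ N, ¬G.Adj (p q.1) (p q.2)) : Nonempty (G ≃g H) := by
  refine nonempty_iso_of_bijective hp fun a b => ?_
  rw [hE]
  constructor
  · rintro (h | h)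
    · exact hA _ h
    · exact (hA _ h).symm
  · intro hab
    rcases hEN a b with rfl | h | h | h | h
    · exact absurd rfl hab.ne
    · exact Or.inl h
    · exact Or.inr h
    · exact absurd hab (hN _ h)
    · exact absurd hab.symm (hN _ h)

theorem cycleGraph_adj_iff {m : ℕ} (hm : 2 ≤ m) (a b : Fin m) :
    (cycleGraph m).Adj a b ↔ (b : ℕ) % m = (a + 1) % m ∨ (a : ℕ) % m = (b + 1) % m := by
  rw [cycleGraph_adj', Fin.val_sub, Fin.val_sub]
  have ha := a.2
  have hb := b.2
  have key : ∀ a b : ℕ, a < m → b < m → ((m - b + a) % m = 1 ↔ a % m = (b + 1) % m) := by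
    intro a b ha hb
    rw [Nat.mod_eq_of_lt ha]
    rcases lt_or_ge a b with hab | hab
    · rw [Nat.mod_eq_of_lt (show m - b + a < m by omega)]
      rcases (Nat.succ_le_of_lt hb).eq_or_lt with e | e
      · rw [show b + 1 = m from e, Nat.mod_self]; omega
      · rw [Nat.mod_eq_of_lt e]; omega
    · rw [show m - b + a = (a - b) + m by omega, Nat.add_mod_right,
        Nat.mod_eq_of_lt (show a - b < m by omega)]
      rcases (Nat.succ_le_of_lt hb).eq_or_lt with e | e
      · rw [show b + 1 = m from e, Nat.mod_self]; omega
      · rw [Nat.mod_eq_of_lt e]; omega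
  rw [key a b ha hb, key b a hb ha, or_comm]

theorem nonempty_iso_pendantCycle [Fintype V] {g m r : ℕ} {c : ℕ → V} (h : ShortestCycle G g c)
    (hm : m = g) (hcard : Fintype.card V = g + r) {q : Fin r → V} (hq : Function.Injective q)
    (hqc : ∀ j, q j ∉ Set.range c) {p : Fin r → ℕ} (hqq : ∀ i j, ¬G.Adj (q i) (q j))
    (hp : ∀ j, ∀ i < g, G.Adj (c i) (q j) ↔ i + 1 = p j) : Nonempty (G ≃g pendantCycle m p) := by
  subst hm
  have h4 := h.four_le
  refine nonempty_iso_of_bijective (p := Sum.elim (fun i : Fin m => c i) q) ?_ ?_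
  · rw [Fintype.bijective_iff_injective_and_card]
    refine ⟨?_, by simp [hcard]⟩
    exact Function.Injective.sumElim (fun i j hij => Fin.ext (h.inj_lt i.2 j.2 hij)) hq
      fun i j hij => hqc j ⟨i, hij⟩
  · rintro (a | i) (b | j)
    · exact (cycleGraph_adj_iff (by omega) a b).trans (h.adj_iff a b).symm
    · exact (hp j a a.2).symm
    · exact (hp i b b.2).symm.trans (G.adj_comm _ _)
    · exact ⟨False.elim, hqq i j⟩

theorem nonempty_iso_completeBipartiteGraph [Fintype V] {a b : ℕ} (hcard : Fintype.card V = a + b)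
    {s : Fin a → V} {t : Fin b → V} (hs : Function.Injective s) (ht : Function.Injective t)
    (hss : ∀ i j, ¬G.Adj (s i) (s j)) (htt : ∀ i j, ¬G.Adj (t i) (t j))
    (hst : ∀ i j, G.Adj (s i) (t j)) :
    Nonempty (G ≃g completeBipartiteGraph (Fin a) (Fin b)) := by
  refine nonempty_iso_of_bijective (p := Sum.elim s t) ?_ ?_
  · rw [Fintype.bijective_iff_injective_and_card]
    exact ⟨hs.sumElim ht fun i j => (hst i j).ne, by simp [hcard]⟩
  · rintro (i | i) (j | j)
    · simpa using hss i j
    · simpa using hst i j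
    · simpa using (hst j i).symm
    · simpa using htt i j

end Iso

/-! ### One vertex outside the cycle. -/

section OneOutside

variable {V : Type*} [Fintype V] {G : SimpleGraph V} {g : ℕ} {c : ℕ → V}

/-- A second neighbour on the cycle at distance `d` forces `g ≤ 2 + d` with `2 * d ≤ g`, so `g = 4`
and `d = 2`; without triangles this is `K_{2,3}`. Otherwise the extra vertex is pendant. -/
theorem bipartite_or_pendant (hG : G.Connected) (h : ShortestCycle G g c)
    (hcard : Fintype.card V = g + 1) :
    Nonempty (G ≃g completeBipartiteGraph (Fin 2) (Fin 3)) ∨ Nonempty (G ≃g U (g + 1)) := by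
  obtain ⟨x, u, hx, hu, hxu, hall⟩ := exists_outside_one hG h hcard
  by_cases hw : ∃ w ∈ Set.range c, w ≠ u ∧ G.Adj x w
  · left
    obtain ⟨w, hw, hwu, hxw⟩ := hw
    obtain ⟨c', hc', hr, rfl, d, hd, rfl⟩ := h.exists_reparam hu hw
    rw [← hr] at hx
    have h4 := hc'.four_le
    have := hc'.le_length_add (d := d) (by omega)
      (p := Walk.cons hxu.symm (Walk.cons hxw Walk.nil))
      (by simp [hxu.ne.symm, hxw.ne, hwu.symm]) (x := x) (by simp) hx
    simp at this
    obtain rfl : g = 4 := by omega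
    obtain rfl : d = 2 := by omega
    have e1 : ¬G.Adj x (c' 1) := h.min.not_triangle le_rfl hxu (hc'.adj 0)
    have e3 : ¬G.Adj x (c' 3) := h.min.not_triangle le_rfl hxw (hc'.adj 2)
    have a30 : G.Adj (c' 3) (c' 0) := by rw [← hc'.period 0]; exact hc'.adj 3
    have n02 : ¬G.Adj (c' 0) (c' 2) := h.min.not_triangle le_rfl (hc'.adj 0) (hc'.adj 1)
    have n13 : ¬G.Adj (c' 1) (c' 3) := h.min.not_triangle le_rfl (hc'.adj 1) (hc'.adj 2)
    have hne : ∀ i, c' i ≠ x := fun i hi => hx ⟨i, hi⟩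
    have hne' : ∀ i, x ≠ c' i := fun i hi => hx ⟨i, hi.symm⟩
    have hcc : ∀ i j, i < 4 → j < 4 → (c' i = c' j ↔ i = j) := fun i j hi hj =>
      ⟨fun e => hc'.inj_lt hi hj e, fun e => by rw [e]⟩
    refine nonempty_iso_completeBipartiteGraph hcard (s := ![c' 0, c' 2]) (t := ![c' 1, c' 3, x])
      ?_ ?_ ?_ ?_ ?_
    · intro i j
      fin_cases i <;> fin_cases j <;> simp [hcc]
    · intro i j
      fin_cases i <;> fin_cases j <;> simp [hne, hne', hcc]
    · simp [Fin.forall_fin_two, n02, G.adj_comm (c' 2)]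
    · simp [Fin.forall_fin_succ, n13, e1, e3, G.adj_comm (c' 3), G.adj_comm (c' 1)]
    · simp [Fin.forall_fin_succ, hc'.adj 0, a30.symm, hxu.symm, (hc'.adj 1).symm, hc'.adj 2,
        hxw.symm]
  · right
    push Not at hw
    obtain ⟨c', hc', hr, rfl, -⟩ := h.exists_reparam hu hu
    rw [← hr] at hx hw
    refine nonempty_iso_pendantCycle hc' (by omega) hcard (q := fun _ => x)
      (fun i j _ => Subsingleton.elim i j) (fun _ => hx) (by simp) fun j i hi => ?_
    rw [Subsingleton.elim j 0]
    have h4 := h.four_le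
    constructor
    · intro hadj
      by_contra hne
      exact hw (c' i) ⟨i, rfl⟩ (fun e => hne (by
        have := hc'.inj_lt hi (by omega) e
        simpa using this)) hadj.symm
    · intro e
      obtain rfl : i = 0 := by simpa using e
      exact hxu.symm

end OneOutside

end GirthLap

namespace GirthLap

open Finset SimpleGraph

/-! ### The subdivided graphs as edge lists, and six vertices of girth four. -/

section Explicit

variable {V : Type*} {G : SimpleGraph V}

theorem K23s_adj (a b : Fin 6) : K23s.Adj a b ↔
    (a, b) ∈ ([(0, 2), (0, 3), (0, 4), (1, 2), (1, 3), (4, 5), (5, 1)] : List (Fin 6 × Fin 6)) ∨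
    (b, a) ∈ ([(0, 2), (0, 3), (0, 4), (1, 2), (1, 3), (4, 5), (5, 1)] :
      List (Fin 6 × Fin 6)) := by
  simp only [K23s, fromEdgeSet_adj, Set.mem_insert_iff, Set.mem_singleton_iff]
  revert a b
  decide

theorem K23ss_adj (a b : Fin 7) : K23ss.Adj a b ↔
    (a, b) ∈ ([(0, 2), (0, 3), (0, 4), (1, 2), (4, 5), (5, 1), (3, 6), (6, 1)] :
      List (Fin 7 × Fin 7)) ∨
    (b, a) ∈ ([(0, 2), (0, 3), (0, 4), (1, 2), (4, 5), (5, 1), (3, 6), (6, 1)] :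
      List (Fin 7 × Fin 7)) := by
  simp only [K23ss, fromEdgeSet_adj, Set.mem_insert_iff, Set.mem_singleton_iff]
  revert a b
  decide

theorem K23sss_adj (a b : Fin 8) : K23sss.Adj a b ↔
    (a, b) ∈ ([(0, 2), (0, 3), (0, 4), (4, 5), (5, 1), (3, 6), (6, 1), (2, 7), (7, 1)] :
      List (Fin 8 × Fin 8)) ∨
    (b, a) ∈ ([(0, 2), (0, 3), (0, 4), (4, 5), (5, 1), (3, 6), (6, 1), (2, 7), (7, 1)] :
      List (Fin 8 × Fin 8)) := by
  simp only [K23sss, fromEdgeSet_adj, Set.mem_insert_iff, Set.mem_singleton_iff]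
  revert a b
  decide

theorem SixShape.below_or_inList [Fintype V] (h : SixShape G) :
    Below G 1 4 ∨ InList G 6 := by
  cases h with
  | bipartite p hp hN => exact Or.inl (below_K33_four p hp hN)
  | sub p hp hN => exact Or.inl (below_K24_sub_edge_four p hp hN)
  | full p hp hN hA =>
    refine Or.inr (Or.inl ⟨rfl, Or.inl ?_⟩)
    simp at hN hA
    have hcard : Fintype.card V = 2 + 4 := by
      rw [← Fintype.card_congr (Equiv.ofBijective p hp.bij)]; simp
    refine nonempty_iso_completeBipartiteGraph hcard (s := p ∘ ![0, 2]) (t := p ∘ ![1, 3, 4, 5])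
      (hp.bij.1.comp (by decide)) (hp.bij.1.comp (by decide)) ?_ ?_ ?_
    · simp [Fin.forall_fin_two, hN, G.adj_comm (p 2) (p 0)]
    · simp [Fin.forall_fin_succ, hN, G.adj_comm (p 3) (p 1), G.adj_comm (p 4) (p 1),
        G.adj_comm (p 5) (p 1), G.adj_comm (p 4) (p 3), G.adj_comm (p 5) (p 3),
        G.adj_comm (p 5) (p 4)]
    · simp [Fin.forall_fin_succ, hA, hp.adj01, hp.adj12.symm, hp.adj23, hp.adj30.symm]
  | theta p hp hN hA =>
    refine Or.inr (Or.inl ⟨rfl, Or.inr ?_⟩)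
    refine nonempty_iso_of_list _
      [(0, 1), (0, 5), (2, 3), (2, 4), (2, 5), (1, 4), (3, 4), (3, 5)] K23s_adj (by decide)
      (p := p ∘ ![0, 2, 1, 3, 4, 5]) (hp.bij.comp (by decide)) ?_ ?_
    · simp at hA
      simp [hA, hp.adj01, hp.adj12.symm, hp.adj23, hp.adj30.symm, G.adj_comm (p 5) (p 2)]
    · simpa using hN

end Explicit

/-! ### Two vertices outside the cycle: cutting or killing once. -/

section TwoOutside

variable {V : Type*} [Fintype V] {G : SimpleGraph V} {g : ℕ} {c : ℕ → V}

/-- Cutting one edge of the cycle. -/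
theorem below_four_of_cut (h : ShortestCycle G g c)
    (hdeg : ∀ v, ((G \ ofPairs {(c 0, c 1)}).neighborSet v).ncard ≤ 2)
    (hR : ∀ v ∉ Set.range c, ∃ i, (G \ ofPairs {(c 0, c 1)}).Reachable v (c i))
    {z : V} (hz : (G \ ofPairs {(c 0, c 1)}).Reachable (c 0) z)
    (hz1 : ((G \ ofPairs {(c 0, c 1)}).neighborSet z).ncard < 2) : Below G 1 4 := by
  classical
  have h4 := h.four_le
  -- What remains of the cycle is the path `c 1, c 2, …, c g = c 0`.
  have hcyc : ∀ i, 1 ≤ i → i ≤ g → (G \ ofPairs {(c 0, c 1)}).Reachable (c 1) (c i) := by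
    intro i hi
    induction i, hi using Nat.le_induction with
    | base => exact fun _ => Reachable.refl _
    | succ i hi ih =>
      intro hig
      refine (ih (by omega)).trans (Adj.reachable ?_)
      rw [sdiff_ofPairs_singleton_adj]
      refine ⟨h.adj i, ?_, ?_⟩
      · rintro ⟨e, -⟩
        have := h.inj_lt (by omega) (by omega) e
        omega
      · rintro ⟨e1, e2⟩
        have := h.inj_lt (by omega) (by omega) e2
        subst this
        have := h.inj_lt (by omega) (by omega) e1
        omega
  have h10 : (G \ ofPairs {(c 0, c 1)}).Reachable (c 1) (c 0) := by
    have := hcyc g (by omega) le_rfl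
    rwa [show c g = c 0 by simpa using h.period 0] at this
  have hall : ∀ i, (G \ ofPairs {(c 0, c 1)}).Reachable (c i) (c 0) := by
    intro i
    obtain ⟨j, hj, e⟩ := h.exists_lt (v := c i) ⟨i, rfl⟩
    rw [← e]
    rcases Nat.eq_zero_or_pos j with rfl | hpos
    · exact Reachable.refl _
    · exact (hcyc j hpos hj.le).symm.trans h10
  refine below_of_delete (H := G \ ofPairs {(c 0, c 1)}) ∅ {(c 0, c 1)} (by simp)
    (fun a b hab hn => ?_) fun f hf hS => ?_
  · rw [sdiff_ofPairs_singleton_adj] at hn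
    simp only [mem_singleton, Prod.mk.injEq]
    tauto
  -- No value is killed; strictness comes from `z`, which has degree below two and is reached from
  -- every vertex.
  · refine qf_lt_four (S := ∅) (fun v _ => hdeg v) (fun v => ⟨z, ?_, Or.inr hz1⟩) hf (by simp)
    by_cases hv : v ∈ Set.range c
    · obtain ⟨i, rfl⟩ := hv
      exact (hall i).trans hz
    · obtain ⟨i, e⟩ := hR v hv
      exact e.trans ((hall i).trans hz)

end TwoOutside

end GirthLap

namespace GirthLap

open Finset SimpleGraph

theorem sdiff_adj_of_notMem {V : Type*} {G : SimpleGraph V} {c : ℕ → V} {x b : V}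
    (hx : x ∉ Set.range c) (hxb : G.Adj x b) :
    (G \ ofPairs {(c 0, c 1)}).Adj x b := by
  refine sdiff_ofPairs_singleton_adj.2 ⟨hxb, ?_, ?_⟩
  · rintro ⟨e, -⟩
    exact hx ⟨0, e.symm⟩
  · rintro ⟨-, e⟩
    exact hx ⟨1, e.symm⟩

section TwoOutside

variable {V : Type*} [Fintype V] {G : SimpleGraph V} {g : ℕ} {c : ℕ → V}

theorem ncard_cut_le (h : ShortestCycle G g c) {x y : V}
    (hC : ∀ i < g, ∀ b ∉ Set.range c, G.Adj (c i) b → (i = 0 ∧ b = x) ∨ (i = 1 ∧ b = y))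
    (hR : ∀ v ∉ Set.range c, (G.neighborSet v).ncard ≤ 2) (v : V) :
    ((G \ ofPairs {(c 0, c 1)}).neighborSet v).ncard ≤ 2 := by
  have h4 := h.four_le
  by_cases hv : v ∈ Set.range c
  · obtain ⟨i, hi, rfl⟩ := h.exists_lt hv
    by_cases h0 : i = 0
    · subst h0
      refine ncard_le_two_of_subset (a := c (0 + (g - 1))) (b := x) fun b hb => ?_
      obtain ⟨hb, hb1, -⟩ := sdiff_ofPairs_singleton_adj.1 hb
      by_cases hbc : b ∈ Set.range c
      · rcases h.eq_of_adj hbc hb with e | e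
        · exact absurd ⟨rfl, e⟩ hb1
        · exact Or.inl e
      · rcases hC 0 hi b hbc hb with e | e
        · exact Or.inr e.2
        · omega
    · by_cases h1 : i = 1
      · subst h1
        refine ncard_le_two_of_subset (a := c (1 + 1)) (b := y) fun b hb => ?_
        obtain ⟨hb, -, hb1⟩ := sdiff_ofPairs_singleton_adj.1 hb
        by_cases hbc : b ∈ Set.range c
        · rcases h.eq_of_adj hbc hb with e | e
          · exact Or.inl e
          · refine absurd ⟨e.trans ?_, rfl⟩ hb1
            rw [show 1 + (g - 1) = 0 + g by omega, h.period]
        · rcases hC 1 hi b hbc hb with e | e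
          · omega
          · exact Or.inr e.2
      · refine ncard_le_two_of_subset (a := c (i + 1)) (b := c (i + (g - 1))) fun b hb => ?_
        obtain ⟨hb, -⟩ := sdiff_ofPairs_singleton_adj.1 hb
        by_cases hbc : b ∈ Set.range c
        · simpa using h.eq_of_adj hbc hb
        · rcases hC i hi b hbc hb with e | e <;> omega
  · exact (Set.ncard_le_ncard (fun b hb => (sdiff_ofPairs_singleton_adj.1 hb).1)
      (Set.toFinite _)).trans (hR v hv)

/-- One vertex outside the cycle is joined to it, and the other one is not. -/
theorem below_four_of_tail (h : ShortestCycle G g c) (hg : 5 ≤ g) {x y : V} (hx : x ∉ Set.range c)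
    (hall : ∀ v ∉ Set.range c, v = x ∨ v = y) (hxu : G.Adj x (c 0)) (hxy : G.Adj x y)
    (hyc : ∀ b ∈ Set.range c, ¬G.Adj y b) : Below G 1 4 := by
  have hyx : G.neighborSet y ⊆ {x} := by
    intro b hb
    rcases hall b fun hbc => hyc b hbc hb with rfl | rfl
    · rfl
    · exact absurd rfl (Adj.ne hb)
  have hyx' : (G.neighborSet y).ncard < 2 :=
    (Set.ncard_le_ncard hyx (Set.toFinite _)).trans_lt (by simp)
  have hy : y ∉ Set.range c := by
    rintro ⟨i, rfl⟩
    exact hyc (c (i + 1)) ⟨_, rfl⟩ (h.adj i)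
  refine below_four_of_cut h (ncard_cut_le h (x := x) (y := y) (fun i hi b hb hib => ?_)
    fun v hv => ?_) (fun v hv => ⟨0, ?_⟩) (z := y)
    ((sdiff_adj_of_notMem hx hxu).symm.reachable.trans (sdiff_adj_of_notMem hx hxy).reachable) ?_
  · left
    rcases hall b hb with rfl | rfl
    · refine ⟨h.inj_lt hi (by omega) ?_, rfl⟩
      exact h.attach_unique hg hb ⟨i, rfl⟩ ⟨0, rfl⟩ hib.symm hxu
    · exact absurd hib.symm (hyc _ ⟨i, rfl⟩)
  · rcases hall v hv with rfl | rfl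
    · refine ncard_le_two_of_subset (a := y) (b := c 0) fun b hb => ?_
      by_cases hbc : b ∈ Set.range c
      · exact Or.inr (h.attach_unique hg hv hbc ⟨0, rfl⟩ hb hxu)
      · rcases hall b hbc with rfl | rfl
        · exact absurd rfl (Adj.ne hb)
        · simp
    · exact hyx'.le
  · rcases hall v hv with rfl | rfl
    · exact (sdiff_adj_of_notMem hx hxu).reachable
    · exact (sdiff_adj_of_notMem hx hxy).symm.reachable.trans
        (sdiff_adj_of_notMem hx hxu).reachable
  · exact (Set.ncard_le_ncard (fun b hb => (sdiff_ofPairs_singleton_adj.1 hb).1)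
      (Set.toFinite _)).trans_lt hyx'

/-- The vertices outside the cycle are joined to `c 0` and `c 1` and not to each other. -/
theorem below_four_of_attach_adj (h : ShortestCycle G g c) (hg : 5 ≤ g) {x y : V}
    (hx : x ∉ Set.range c) (hy : y ∉ Set.range c)
    (hall : ∀ v ∉ Set.range c, v = x ∨ v = y) (hxu : G.Adj x (c 0)) (hyw : G.Adj y (c 1))
    (hxy : ¬G.Adj x y) : Below G 1 4 := by
  have hN : ∀ v ∉ Set.range c, ∃ u, G.neighborSet v ⊆ {u} := by
    intro v hv
    obtain ⟨u, -, hu⟩ := exists_attach_vertex h hg hv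
    refine ⟨u, fun b hb => hu b ?_ hb⟩
    by_contra hbc
    rcases hall v hv with rfl | rfl <;> rcases hall b hbc with rfl | rfl
    · exact absurd rfl (Adj.ne hb)
    · exact hxy hb
    · exact hxy (Adj.symm hb)
    · exact absurd rfl (Adj.ne hb)
  have hN' : ∀ v ∉ Set.range c, (G.neighborSet v).ncard < 2 := by
    intro v hv
    obtain ⟨u, hu⟩ := hN v hv
    exact (Set.ncard_le_ncard hu (Set.toFinite _)).trans_lt (by simp)
  refine below_four_of_cut h (ncard_cut_le h (x := x) (y := y) (fun i hi b hb hib => ?_)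
    fun v hv => (hN' v hv).le) (fun v hv => ?_) (z := x)
    (sdiff_adj_of_notMem hx hxu).symm.reachable ?_
  · rcases hall b hb with rfl | rfl
    · refine Or.inl ⟨h.inj_lt hi (by omega) ?_, rfl⟩
      exact h.attach_unique hg hb ⟨i, rfl⟩ ⟨0, rfl⟩ hib.symm hxu
    · refine Or.inr ⟨h.inj_lt hi (by omega) ?_, rfl⟩
      exact h.attach_unique hg hb ⟨i, rfl⟩ ⟨1, rfl⟩ hib.symm hyw
  · rcases hall v hv with rfl | rfl
    · exact ⟨0, (sdiff_adj_of_notMem hx hxu).reachable⟩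
    · exact ⟨1, (sdiff_adj_of_notMem hy hyw).reachable⟩
  · exact (Set.ncard_le_ncard (fun b hb => (sdiff_ofPairs_singleton_adj.1 hb).1)
      (Set.toFinite _)).trans_lt (hN' x hx)

/-- Only `c 0` can have degree above two, and the condition is spent there. An edge between outside
vertices would close a triangle with `c 0`. -/
theorem below_four_of_attach_same (hG : G.Connected) (h : ShortestCycle G g c) (hg : 5 ≤ g)
    {x y : V} (hall : ∀ v ∉ Set.range c, v = x ∨ v = y) (hxu : G.Adj x (c 0))
    (hyw : G.Adj y (c 0)) : Below G 1 4 := by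
  refine below_of_delete (H := G) {c 0} ∅ (by simp) (fun a b hab hn => absurd hab hn)
    fun f hf hS => ?_
  have hat : ∀ v ∉ Set.range c, G.Adj v (c 0) := by
    intro v hv
    rcases hall v hv with rfl | rfl <;> assumption
  refine qf_lt_four (S := {c 0}) (fun v hv => ?_)
    (fun v => ⟨c 0, hG.preconnected v (c 0), Or.inl rfl⟩) hf (by simpa using hS)
  by_cases hvc : v ∈ Set.range c
  · obtain ⟨i, rfl⟩ := hvc
    refine ncard_le_two_of_subset (a := c (i + 1)) (b := c (i + (g - 1))) fun b hb => ?_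
    by_cases hbc : b ∈ Set.range c
    · simpa using h.eq_of_adj hbc hb
    · exact absurd (h.attach_unique hg hbc ⟨i, rfl⟩ ⟨0, rfl⟩ (Adj.symm hb) (hat b hbc)) hv
  · refine ncard_le_two_of_subset (a := c 0) (b := c 0) fun b hb => ?_
    by_cases hbc : b ∈ Set.range c
    · simpa using h.attach_unique hg hvc hbc ⟨0, rfl⟩ hb (hat v hvc)
    · exact absurd (hat b hbc) (h.min.not_triangle (by omega) (Adj.symm hb) (hat v hvc))

end TwoOutside

end GirthLap

namespace GirthLap

open Finset SimpleGraph

theorem ShortestCycle.adj_outside_iff {V : Type*} {G : SimpleGraph V} {g : ℕ}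
    {c : ℕ → V} (h : ShortestCycle G g c) (hg : 5 ≤ g) {x : V} {d : ℕ}
    (hx : x ∉ Set.range c) (hxd : G.Adj x (c d)) (i : ℕ) : G.Adj x (c i) ↔ i % g = d % g := by
  rw [← h.eq_iff]
  constructor
  · intro hi
    exact h.attach_unique hg hx ⟨i, rfl⟩ ⟨d, rfl⟩ hi hxd
  · rintro hi
    rwa [hi]

/-! ### Two attached vertices: the dichotomy for order `g + 2`. -/

section TwoAttached

variable {V : Type*} [Fintype V] {G : SimpleGraph V} {g : ℕ} {c : ℕ → V}

theorem bijective_vecCons_six {x y : V} (h : ShortestCycle G 6 c) (hcard : Fintype.card V = 6 + 2)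
    (hx : x ∉ Set.range c) (hy : y ∉ Set.range c) (hxy : x ≠ y) :
    Function.Bijective ![c 0, c 1, c 2, c 3, c 4, c 5, x, y] := by
  rw [Fintype.bijective_iff_injective_and_card]
  refine ⟨?_, by simp [hcard]⟩
  have hnx : ∀ i, c i ≠ x := fun i hi => hx ⟨i, hi⟩
  have hnx' : ∀ i, x ≠ c i := fun i hi => hx ⟨i, hi.symm⟩
  have hny : ∀ i, c i ≠ y := fun i hi => hy ⟨i, hi⟩
  have hny' : ∀ i, y ≠ c i := fun i hi => hy ⟨i, hi.symm⟩
  intro i j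
  fin_cases i <;> fin_cases j <;> simp [hnx, hnx', hny, hny', hxy, hxy.symm, h.eq_iff]

theorem bijective_vecCons_five {x y : V} (h : ShortestCycle G 5 c) (hcard : Fintype.card V = 5 + 2)
    (hx : x ∉ Set.range c) (hy : y ∉ Set.range c) (hxy : x ≠ y) :
    Function.Bijective ![c 0, c 1, c 2, c 3, c 4, x, y] := by
  rw [Fintype.bijective_iff_injective_and_card]
  refine ⟨?_, by simp [hcard]⟩
  have hnx : ∀ i, c i ≠ x := fun i hi => hx ⟨i, hi⟩
  have hnx' : ∀ i, x ≠ c i := fun i hi => hx ⟨i, hi.symm⟩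
  have hny : ∀ i, c i ≠ y := fun i hi => hy ⟨i, hi⟩
  have hny' : ∀ i, y ≠ c i := fun i hi => hy ⟨i, hi.symm⟩
  intro i j
  fin_cases i <;> fin_cases j <;> simp [hnx, hnx', hny, hny', hxy, hxy.symm, h.eq_iff]

theorem nonempty_iso_K23ss {x y : V} (h : ShortestCycle G 5 c) (hcard : Fintype.card V = 5 + 2)
    (hx : x ∉ Set.range c) (hy : y ∉ Set.range c) (hx0 : G.Adj x (c 0)) (hyd : G.Adj y (c 2))
    (hxy : G.Adj x y) : Nonempty (G ≃g K23ss) := by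
  have hX := h.adj_outside_iff le_rfl hx hx0
  have hX' : ∀ i, G.Adj (c i) x ↔ i % 5 = 0 := fun i => (G.adj_comm _ _).trans (hX i)
  have hY := h.adj_outside_iff le_rfl hy hyd
  have hY' : ∀ i, G.Adj (c i) y ↔ i % 5 = 2 := fun i => (G.adj_comm _ _).trans (hY i)
  refine nonempty_iso_of_list _
    [(0, 1), (0, 5), (0, 6), (1, 3), (1, 4), (2, 3), (2, 4), (2, 5), (2, 6), (3, 4), (3, 5),
      (4, 6), (5, 6)] K23ss_adj (by decide)
    (p := ![c 0, c 1, c 2, c 3, c 4, x, y] ∘ ![0, 2, 1, 5, 4, 3, 6])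
    ((bijective_vecCons_five h hcard hx hy hxy.ne).comp (by decide)) ?_ ?_
  · simp [h.adj_iff, hX', hY, hxy]
  · simp [h.adj_iff, hX, hX', hY']

theorem nonempty_iso_K23sss {x y : V} (h : ShortestCycle G 6 c) (hcard : Fintype.card V = 6 + 2)
    (hx : x ∉ Set.range c) (hy : y ∉ Set.range c) (hx0 : G.Adj x (c 0)) (hyd : G.Adj y (c 3))
    (hxy : G.Adj x y) : Nonempty (G ≃g K23sss) := by
  have hX := h.adj_outside_iff (by norm_num) hx hx0
  have hX' : ∀ i, G.Adj (c i) x ↔ i % 6 = 0 := fun i => (G.adj_comm _ _).trans (hX i)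
  have hY := h.adj_outside_iff (by norm_num) hy hyd
  have hY' : ∀ i, G.Adj (c i) y ↔ i % 6 = 3 := fun i => (G.adj_comm _ _).trans (hY i)
  refine nonempty_iso_of_list _
    [(0, 1), (0, 5), (0, 6), (0, 7), (1, 2), (1, 3), (1, 4), (2, 3), (2, 4), (2, 5), (2, 6),
      (3, 4), (3, 5), (3, 7), (4, 6), (4, 7), (5, 6), (5, 7), (6, 7)] K23sss_adj (by decide)
    (p := ![c 0, c 1, c 2, c 3, c 4, c 5, x, y] ∘ ![0, 3, 1, 5, 6, 7, 4, 2])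
    ((bijective_vecCons_six h hcard hx hy hxy.ne).comp (by decide)) ?_ ?_
  · simp [h.adj_iff, hX', hY, hxy]
  · simp [h.adj_iff, hX, hX', hY, hY']

theorem below_four_of_six_two {x y : V} (h : ShortestCycle G 6 c)
    (hcard : Fintype.card V = 6 + 2) (hx : x ∉ Set.range c) (hy : y ∉ Set.range c)
    (hx0 : G.Adj x (c 0)) (hyd : G.Adj y (c 2)) (hne : x ≠ y) (hxy : ¬G.Adj x y) :
    Below G 1 4 := by
  have hX := h.adj_outside_iff (by norm_num) hx hx0
  have hX' : ∀ i, G.Adj (c i) x ↔ i % 6 = 0 := fun i => (G.adj_comm _ _).trans (hX i)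
  have hY := h.adj_outside_iff (by norm_num) hy hyd
  have hY' : ∀ i, G.Adj (c i) y ↔ i % 6 = 2 := fun i => (G.adj_comm _ _).trans (hY i)
  refine below_Y83_four _ (bijective_vecCons_six h hcard hx hy hne) ?_
  simp [h.adj_iff, hX', hY', hxy]

theorem nonempty_iso_Y {x y : V} {d : ℕ} (h : ShortestCycle G g c) (hg : 5 ≤ g)
    (hcard : Fintype.card V = g + 2) (hx : x ∉ Set.range c) (hy : y ∉ Set.range c)
    (hx0 : G.Adj x (c 0)) (hyd : G.Adj y (c d)) (hdg : d < g) (hne : x ≠ y) (hxy : ¬G.Adj x y) :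
    Nonempty (G ≃g Y (g + 2) (d + 1)) := by
  refine nonempty_iso_pendantCycle h (by omega) hcard (q := ![x, y]) ?_ ?_ ?_ ?_
  · intro i j
    fin_cases i <;> fin_cases j <;> simp [hne, hne.symm]
  · simp [Fin.forall_fin_two, -Set.mem_range, hx, hy]
  · simp [Fin.forall_fin_two, hxy, G.adj_comm y x]
  · intro j i hi
    rw [G.adj_comm]
    fin_cases j
    · simpa [Nat.mod_eq_of_lt hi] using h.adj_outside_iff hg hx hx0 i
    · simpa [Nat.mod_eq_of_lt hi, Nat.mod_eq_of_lt hdg] using h.adj_outside_iff hg hy hyd i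

theorem below_four_or_inList_of_five_le (hG : G.Connected) (h : ShortestCycle G g c) (hg : 5 ≤ g)
    (hcard : Fintype.card V = g + 2) : Below G 1 4 ∨ InList G (g + 2) := by
  obtain ⟨x, y, u, hne, hx, hy, hu, hxu, hall⟩ := exists_outside_two hG h hcard
  by_cases hyw : ∃ w ∈ Set.range c, G.Adj y w
  · obtain ⟨w, hw, hyw⟩ := hyw
    obtain ⟨c', hc', hr, rfl, d, hd, rfl⟩ := h.exists_reparam hu hw
    rw [← hr] at hx hy hall
    clear hr hu hw h
    by_cases hxy : G.Adj x y
    · right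
      have hd0 : d ≠ 0 := by
        rintro rfl
        exact hc'.min.not_triangle (by omega) hxy.symm hxu hyw
      have hlen := hc'.le_length_add (d := d) (by omega)
        (p := Walk.cons hxu.symm (Walk.cons hxy (Walk.cons hyw Walk.nil)))
        (by
          have h0 : c' 0 ≠ c' d := fun e => hd0 (hc'.inj_lt (by omega) (by omega) e).symm
          have h1 : c' 0 ≠ y := fun e => hy ⟨0, e⟩
          have h2 : x ≠ c' d := fun e => hx ⟨d, e.symm⟩
          simp [hxu.ne.symm, hne, hyw.ne, h0, h1, h2]) (x := x) (by simp) hx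
      simp at hlen
      have hcases : (g = 5 ∧ d = 2) ∨ (g = 6 ∧ d = 3) := by omega
      rcases hcases with ⟨rfl, rfl⟩ | ⟨rfl, rfl⟩
      · exact Or.inr (Or.inl ⟨rfl, Or.inl (nonempty_iso_K23ss hc' hcard hx hy hxu hyw hxy)⟩)
      · exact Or.inr (Or.inr (Or.inl
          ⟨rfl, Or.inl (nonempty_iso_K23sss hc' hcard hx hy hxu hyw hxy)⟩))
    · rcases Nat.lt_or_ge d 2 with hd2 | hd2
      · left
        have : d = 0 ∨ d = 1 := by omega
        rcases this with rfl | rfl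
        · exact below_four_of_attach_same hG hc' hg hall hxu hyw
        · exact below_four_of_attach_adj hc' hg hx hy hall hxu hyw hxy
      · by_cases h6 : g = 6 ∧ d = 2
        · obtain ⟨rfl, rfl⟩ := h6
          exact Or.inl (below_four_of_six_two hc' hcard hx hy hxu hyw hne hxy)
        · right
          have hY := nonempty_iso_Y hc' hg hcard hx hy hxu hyw (by omega) hne hxy
          have hcases : (g = 5 ∧ d = 2) ∨ (g = 6 ∧ d = 3) ∨ 7 ≤ g := by omega
          rcases hcases with ⟨rfl, rfl⟩ | ⟨rfl, rfl⟩ | hg7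
          · exact Or.inr (Or.inl ⟨rfl, Or.inr hY⟩)
          · exact Or.inr (Or.inr (Or.inl ⟨rfl, Or.inr hY⟩))
          · refine Or.inr (Or.inr (Or.inr ⟨by omega, d + 1, by omega, ?_, hY⟩))
            -- The bound on `i = d + 1` amounts to `d < (g + 1) / 2`, that is, to `2 * d ≤ g`.
            refine Nat.succ_le_of_lt (Nat.lt_ceil.2 ?_)
            have : (2 * d : ℝ) ≤ g := by exact_mod_cast hd
            push_cast
            linarith
  · left
    push Not at hyw
    obtain ⟨c', hc', hr, rfl, -⟩ := h.exists_reparam hu hu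
    rw [← hr] at hx hall hyw
    have : Nontrivial V := ⟨x, y, hne⟩
    obtain ⟨b, hb⟩ := hG.preconnected.exists_adj_of_nontrivial y
    have hbx : b = x := by
      rcases hall b fun hbc => hyw b hbc hb with rfl | rfl
      · rfl
      · exact absurd rfl hb.ne
    exact below_four_of_tail hc' hg hx hall hxu (hbx ▸ hb).symm hyw

theorem below_four_or_inList (hG : G.Connected) (h : ShortestCycle G g c)
    (hcard : Fintype.card V = g + 2) : Below G 1 4 ∨ InList G (g + 2) := by
  rcases h.four_le.eq_or_lt with rfl | hg
  · obtain ⟨p, hp⟩ := exists_fourCycle h hcard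
    exact hp.six.below_or_inList
  · exact below_four_or_inList_of_five_le hG h hg hcard

end TwoAttached

end GirthLap

namespace GirthLap

open Finset SimpleGraph

/-! ### Test vectors for threshold 4. -/

section TwoVectors

variable {V : Type*} [Fintype V] {G : SimpleGraph V}

theorem above_two_of_vectors {m : ℕ} {T : ℝ} {p : Fin m → V} (hp : Function.Injective p)
    (D : Finset (Fin m × Fin m)) (hD : ∀ q ∈ D, (q.2, q.1) ∉ D)
    (hA : ∀ q ∈ D, G.Adj (p q.1) (p q.2)) (a b : Fin m → ℝ)
    (hab : ∀ s t : ℝ, (∀ i, s * a i + t * b i = 0) → s = 0 ∧ t = 0)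
    (h : ∀ s t : ℝ, T * ∑ i, (s * a i + t * b i) ^ 2 ≤
      ∑ q ∈ D, ((s * a q.1 + t * b q.1) - (s * a q.2 + t * b q.2)) ^ 2) : Above G 2 T := by
  let ψ : (Fin 2 → ℝ) →ₗ[ℝ] (Fin m → ℝ) :=
    { toFun := fun s i => s 0 * a i + s 1 * b i
      map_add' := fun s t => by ext i; simp; ring
      map_smul' := fun r s => by ext i; simp; ring }
  refine above_of_pairs p hp D (fun q hq => ⟨hA q hq, hD q hq⟩) ψ ?_ fun s => h (s 0) (s 1)
  rw [← LinearMap.ker_eq_bot, LinearMap.ker_eq_bot']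
  intro s hs
  obtain ⟨h0, h1⟩ := hab (s 0) (s 1) fun i => congrFun hs i
  ext i
  fin_cases i
  · exact h0
  · exact h1

/-- The test vector is the top eigenvector of `K_{1,3}`, with eigenvalue 4. -/
theorem above_one_of_star {p : Fin 4 → V} (hp : Function.Injective p)
    (hA : ∀ j ∈ ([1, 2, 3] : List (Fin 4)), G.Adj (p 0) (p j)) : Above G 1 4 := by
  let ψ : (Fin 1 → ℝ) →ₗ[ℝ] (Fin 4 → ℝ) :=
    { toFun := fun s => s 0 • ![3, -1, -1, -1]
      map_add' := fun s t => by simp [add_smul]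
      map_smul' := fun r s => by simp [mul_smul] }
  refine above_of_pairs p hp {(0, 1), (0, 2), (0, 3)} ?_ ψ ?_ fun s => ?_
  · simp at hA
    simp [hA]
  · rw [← LinearMap.ker_eq_bot, LinearMap.ker_eq_bot']
    intro s hs
    have h1 : s 0 * -1 = 0 := congrFun hs 1
    ext i
    rw [Subsingleton.elim i 0]
    simpa using h1
  · simp [ψ, Fin.sum_univ_four]
    nlinarith

theorem above_of_two_stars {p : Fin 8 → V} (hp : Function.Injective p)
    (hA : ∀ q ∈ ({(0, 1), (0, 2), (0, 3), (4, 5), (4, 6), (4, 7)} : Finset (Fin 8 × Fin 8)),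
      G.Adj (p q.1) (p q.2)) : Above G 2 4 := by
  refine above_two_of_vectors hp _ (by decide) hA ![3, -1, -1, -1, 0, 0, 0, 0]
    ![0, 0, 0, 0, 3, -1, -1, -1] (fun s t h => ?_) fun s t => ?_
  · have h0 := h 0
    have h4 := h 4
    simp at h0 h4
    exact ⟨h0, h4⟩
  · rw [sum_insert (by decide), sum_insert (by decide), sum_insert (by decide),
      sum_insert (by decide), sum_insert (by decide), sum_singleton]
    simp [Fin.sum_univ_succ]
    nlinarith

/-- The vectors are eigenvectors of `K_{2,4}` with eigenvalues 6 and 4. -/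
theorem above_K24 {p : Fin 6 → V} (hp : Function.Injective p)
    (hA : ∀ q ∈ ({(0, 2), (0, 3), (0, 4), (0, 5), (1, 2), (1, 3), (1, 4), (1, 5)} :
      Finset (Fin 6 × Fin 6)), G.Adj (p q.1) (p q.2)) : Above G 2 4 := by
  refine above_two_of_vectors hp _ (by decide) hA ![2, 2, -1, -1, -1, -1] ![1, -1, 0, 0, 0, 0]
    (fun s t h => ?_) fun s t => ?_
  · have h0 := h 0
    have h4 := h 4
    simp at h0 h4
    subst h4
    exact ⟨rfl, by simpa using h0⟩
  · rw [sum_insert (by decide), sum_insert (by decide), sum_insert (by decide),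
      sum_insert (by decide), sum_insert (by decide), sum_insert (by decide),
      sum_insert (by decide), sum_singleton]
    simp [Fin.sum_univ_succ]
    nlinarith [sq_nonneg s]

/-- One vector is symmetric and the other antisymmetric under the involution exchanging `0` with `1`
and `4` with `5`, so the mixed terms in `s * t` cancel. -/
theorem above_K23s {p : Fin 6 → V} (hp : Function.Injective p)
    (hA : ∀ q ∈ ({(0, 2), (0, 3), (0, 4), (1, 2), (1, 3), (4, 5), (5, 1)} :
      Finset (Fin 6 × Fin 6)), G.Adj (p q.1) (p q.2)) : Above G 2 4 := by
  refine above_two_of_vectors hp _ (by decide) hA ![3, 3, -2, -2, -1, -1]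
    ![1, -1, 0, 0, -1, 1] (fun s t h => ?_) fun s t => ?_
  · have h1 := h 0
    have h2 := h 1
    simp at h1 h2
    constructor <;> linarith
  · repeat rw [sum_insert (by decide)]
    rw [sum_singleton]
    simp [Fin.sum_univ_succ]
    nlinarith [sq_nonneg s, sq_nonneg t]

theorem above_K23ss {p : Fin 7 → V} (hp : Function.Injective p)
    (hA : ∀ q ∈ ({(0, 2), (0, 3), (0, 4), (1, 2), (4, 5), (5, 1), (3, 6), (6, 1)} :
      Finset (Fin 7 × Fin 7)), G.Adj (p q.1) (p q.2)) : Above G 2 4 := by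
  refine above_two_of_vectors hp _ (by decide) hA ![3, 3, -2, -1, -1, -1, -1]
    ![1, -1, 0, -1, -1, 1, 1] (fun s t h => ?_) fun s t => ?_
  · have h1 := h 0
    have h2 := h 1
    simp at h1 h2
    constructor <;> linarith
  · repeat rw [sum_insert (by decide)]
    rw [sum_singleton]
    simp [Fin.sum_univ_succ]
    nlinarith [sq_nonneg s, sq_nonneg t]

/-- Here and for the longer cycles, one vector is symmetric and the other antisymmetric under the
reflection fixing vertex `1`, midway between the branch vertices `0` and `2`. -/
theorem above_Y_five {p : Fin 7 → V} (hp : Function.Injective p)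
    (hA : ∀ q ∈ ({(0, 1), (1, 2), (2, 3), (3, 4), (4, 0), (0, 5), (2, 6)} :
      Finset (Fin 7 × Fin 7)), G.Adj (p q.1) (p q.2)) : Above G 2 4 := by
  refine above_two_of_vectors hp _ (by decide) hA ![-3, 3, -3, 2, 2, 1, 1]
    ![-3, 0, 3, -2, 2, 1, -1] (fun s t h => ?_) fun s t => ?_
  · have h1 := h 5
    have h2 := h 6
    simp at h1 h2
    constructor <;> linarith
  · repeat rw [sum_insert (by decide)]
    rw [sum_singleton]
    simp [Fin.sum_univ_succ]
    nlinarith [sq_nonneg s, sq_nonneg t]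

theorem above_Y_seven {p : Fin 9 → V} (hp : Function.Injective p)
    (hA : ∀ q ∈ ({(0, 1), (1, 2), (2, 3), (3, 4), (4, 5), (5, 6), (6, 0), (0, 7), (2, 8)} :
      Finset (Fin 9 × Fin 9)), G.Adj (p q.1) (p q.2)) : Above G 2 4 := by
  refine above_two_of_vectors hp _ (by decide) hA ![-3, 3, -3, 2, -1, -1, 2, 1, 1]
    ![-3, 0, 3, -2, 1, -1, 2, 1, -1] (fun s t h => ?_) fun s t => ?_
  · have h1 := h 7
    have h2 := h 8
    simp at h1 h2
    constructor <;> linarith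
  · repeat rw [sum_insert (by decide)]
    rw [sum_singleton]
    simp [Fin.sum_univ_succ]
    nlinarith [sq_nonneg s, sq_nonneg t]

theorem above_Y_eight {p : Fin 10 → V} (hp : Function.Injective p)
    (hA : ∀ q ∈ ({(0, 1), (1, 2), (2, 3), (3, 4), (4, 5), (5, 6), (6, 7), (7, 0), (0, 8), (2, 9)} :
      Finset (Fin 10 × Fin 10)), G.Adj (p q.1) (p q.2)) : Above G 2 4 := by
  refine above_two_of_vectors hp _ (by decide) hA ![-3, 3, -3, 2, -1, 0, -1, 2, 1, 1]
    ![-3, 0, 3, -2, 1, 0, -1, 2, 1, -1] (fun s t h => ?_) fun s t => ?_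
  · have h1 := h 8
    have h2 := h 9
    simp at h1 h2
    constructor <;> linarith
  · repeat rw [sum_insert (by decide)]
    rw [sum_singleton]
    simp [Fin.sum_univ_succ]
    nlinarith [sq_nonneg s, sq_nonneg t]

set_option maxRecDepth 4000 in
theorem above_Y_nine_le {p : Fin 11 → V} (hp : Function.Injective p)
    (hA : ∀ q ∈ ({(0, 1), (1, 2), (2, 3), (3, 4), (4, 5), (6, 7), (7, 8), (8, 0), (0, 9), (2, 10)} :
      Finset (Fin 11 × Fin 11)), G.Adj (p q.1) (p q.2)) : Above G 2 4 := by
  refine above_two_of_vectors hp _ (by decide) hA ![-3, 3, -3, 2, -1, 0, 0, -1, 2, 1, 1]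
    ![-3, 0, 3, -2, 1, 0, 0, -1, 2, 1, -1] (fun s t h => ?_) fun s t => ?_
  · have h1 := h 9
    have h2 := h 10
    simp at h1 h2
    constructor <;> linarith
  · repeat rw [sum_insert (by decide)]
    rw [sum_singleton]
    simp [Fin.sum_univ_succ]
    nlinarith [sq_nonneg s, sq_nonneg t]

end TwoVectors

end GirthLap

namespace GirthLap

open Finset SimpleGraph

/-! ### Cycles with pendant vertices: girth and test spaces. -/

section PendantCycle

variable {V : Type*} {G : SimpleGraph V} {m r : ℕ} {p : Fin r → ℕ}

/-- `c` runs periodically around an `m`-cycle, and the pairwise distinct vertices `w j` are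
pendant at `c (p j - 1)`. -/
structure IsPendantCycle (G : SimpleGraph V) (m : ℕ) {r : ℕ} (p : Fin r → ℕ) (c : ℕ → V)
    (w : Fin r → V) : Prop where
  adj : ∀ i, G.Adj (c i) (c (i + 1))
  eq_iff : ∀ i j, c i = c j ↔ i % m = j % m
  ne : ∀ i j, c i ≠ w j
  inj : Function.Injective w
  mem : ∀ v, (∃ i, c i = v) ∨ ∃ j, w j = v
  adj_iff : ∀ i < m, ∀ j, G.Adj (c i) (w j) ↔ i + 1 = p j
  not_adj : ∀ i j, ¬G.Adj (w i) (w j)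
  cycle : ∀ i j, G.Adj (c i) (c j) → c j = c (i + 1) ∨ c j = c (i + (m - 1))

theorem exists_isPendantCycle (hm : 3 ≤ m) (e : G ≃g pendantCycle m p) :
    ∃ c w, IsPendantCycle G m p c w := by
  have : NeZero m := ⟨by omega⟩
  have hcyc : ∀ i j : ℕ, (cycleGraph m).Adj (Fin.ofNat m i) (Fin.ofNat m j) ↔
      j % m = (i + 1) % m ∨ i % m = (j + 1) % m := by
    intro i j
    rw [cycleGraph_adj_iff (by omega)]
    simp [Fin.ofNat]
  have heq : ∀ i j : ℕ, e.symm (.inl (Fin.ofNat m i)) = e.symm (.inl (Fin.ofNat m j)) ↔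
      i % m = j % m := by
    intro i j
    simp [Fin.ext_iff, Fin.ofNat]
  refine ⟨fun i => e.symm (.inl (Fin.ofNat m i)), fun j => e.symm (.inr j), fun i => ?_, heq,
    fun i j h => ?_, fun i j h => ?_, fun v => ?_, fun i hi j => ?_, fun i j h => ?_,
    fun i j h => ?_⟩
  · exact e.symm.map_adj_iff.2 ((hcyc i (i + 1)).2 (Or.inl rfl))
  · simpa using e.symm.injective h
  · simpa using e.symm.injective h
  · rcases hv : e v with a | j
    · exact Or.inl ⟨a, by simp [← hv, Fin.ofNat, Nat.mod_eq_of_lt a.2]⟩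
    · exact Or.inr ⟨j, by simp [← hv]⟩
  · rw [e.symm.map_adj_iff]
    change (Fin.ofNat m i : ℕ) + 1 = p j ↔ _
    simp [Fin.ofNat, Nat.mod_eq_of_lt hi]
  · exact e.symm.map_adj_iff.1 h
  · rcases (hcyc i j).1 (e.symm.map_adj_iff.1 h) with h' | h'
    · exact Or.inl ((heq _ _).2 h')
    · right
      rw [heq]
      have h1 : (i + (m - 1)) % m = ((j + 1) + (m - 1)) % m := Nat.ModEq.add_right _ h'
      rw [h1, show j + 1 + (m - 1) = j + m by omega, Nat.add_mod_right]

variable {c : ℕ → V} {w : Fin r → V}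

namespace IsPendantCycle

theorem adj_inr (h : IsPendantCycle G m p c w) (hm : 3 ≤ m) {j : Fin r} {v : V}
    (hv : G.Adj (w j) v) : v = c (p j - 1) := by
  rcases h.mem v with ⟨i, rfl⟩ | ⟨i, rfl⟩
  · have e : c (i % m) = c i := (h.eq_iff _ _).2 (by simp)
    have := (h.adj_iff (i % m) (Nat.mod_lt _ (by omega)) j).1 (e ▸ hv.symm)
    rw [← this, Nat.add_sub_cancel, e]
  · exact absurd hv (h.not_adj j i)

/-- A vertex of a cycle has two neighbours on it, which excludes the pendant vertices. With `c i`
the cycle therefore contains `c (i + 1)`, and hence all `m` vertices. -/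
theorem le_length (h : IsPendantCycle G m p c w) (hm : 3 ≤ m) {a : V} {q : G.Walk a a}
    (hq : q.IsCycle) : m ≤ q.length := by
  classical
  have hw : ∀ j, w j ∉ q.support := by
    intro j hj
    have h2 := hq.ncard_neighborSet_toSubgraph_eq_two hj
    have h1 : q.toSubgraph.neighborSet (w j) ⊆ {c (p j - 1)} := fun v hv =>
      h.adj_inr hm (q.toSubgraph.adj_sub hv)
    have := Set.ncard_le_ncard h1 (Set.toFinite _)
    simp at this
    omega
  have hstep : ∀ i, c i ∈ q.support → c (i + 1) ∈ q.support := by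
    intro i hi
    have h2 := hq.ncard_neighborSet_toSubgraph_eq_two hi
    have h1 : q.toSubgraph.neighborSet (c i) ⊆ {c (i + 1), c (i + (m - 1))} := by
      intro v hv
      have hvs : v ∈ q.support := by
        rw [← Walk.mem_verts_toSubgraph]
        exact q.toSubgraph.edge_vert (q.toSubgraph.adj_symm hv)
      rcases h.mem v with ⟨j, rfl⟩ | ⟨j, rfl⟩
      · simpa using h.cycle i j (q.toSubgraph.adj_sub hv)
      · exact absurd hvs (hw j)
    have h3 := Set.eq_of_subset_of_ncard_le h1
      (by rw [h2]; exact ncard_le_two_of_subset subset_rfl) (Set.toFinite _)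
    have h4 : c (i + 1) ∈ q.toSubgraph.neighborSet (c i) := by rw [h3]; simp
    rw [← Walk.mem_verts_toSubgraph]
    exact q.toSubgraph.edge_vert (q.toSubgraph.adj_symm h4)
  obtain ⟨i₀, hi₀⟩ : ∃ i, c i ∈ q.support := by
    rcases h.mem a with ⟨i, hi⟩ | ⟨j, hj⟩
    · exact ⟨i, hi ▸ q.start_mem_support⟩
    · exact absurd (hj ▸ q.start_mem_support) (hw j)
  have hall : ∀ i, c (i₀ + i) ∈ q.support := by
    intro i
    induction i with
    | zero => exact hi₀
    | succ i ih => exact hstep _ ih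
  have htail : ∀ v ∈ q.support, v ∈ q.support.tail := by
    intro v hv
    rcases (Walk.mem_support_iff q).1 hv with rfl | hv
    · exact Walk.end_mem_tail_support hq.not_nil
    · exact hv
  have hsub : ((range m).image fun i => c (i₀ + i)) ⊆ q.support.tail.toFinset := by
    intro v hv
    obtain ⟨i, -, rfl⟩ := mem_image.1 hv
    simpa using htail _ (hall i)
  have hcard := card_le_card hsub
  rw [card_image_of_injOn, card_range] at hcard
  · refine (hcard.trans (List.toFinset_card_le _)).trans ?_
    simp
  · intro i hi j hj hij
    have := Nat.ModEq.add_left_cancel' i₀ ((h.eq_iff _ _).1 hij)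
    rw [Nat.ModEq, Nat.mod_eq_of_lt (by simpa using hi), Nat.mod_eq_of_lt (by simpa using hj)]
      at this
    exact this

/-- Positive girth says that a cycle exists, since acyclic graphs are given girth 0. -/
theorem le_girth (h : IsPendantCycle G m p c w) (hm : 3 ≤ m) (hG : 0 < G.girth) :
    m ≤ G.girth := by
  have hac : ¬G.IsAcyclic := by
    rw [← SimpleGraph.girth_eq_zero]; omega
  obtain ⟨a, q, hq, hql⟩ := SimpleGraph.exists_girth_eq_length.2 hac
  exact hql ▸ h.le_length hm hq

/-- For `i ≥ 4` and `2 * (i - 1) ≤ m` the stars centred at `u_1` and `u_i` are disjoint. -/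
theorem above_two_of_four_le [Fintype V] {i : ℕ} {w : Fin 2 → V}
    (h : IsPendantCycle G m ![1, i] c w) (hi : 4 ≤ i) (him : 2 * (i - 1) ≤ m) :
    Above G 2 4 := by
  have hinj : ∀ i j, i < m → j < m → (c i = c j ↔ i = j) := by
    intro i j hi hj
    rw [h.eq_iff, Nat.mod_eq_of_lt hi, Nat.mod_eq_of_lt hj]
  have hne := h.ne
  have hne' : ∀ i j, w j ≠ c i := fun i j e => h.ne i j e.symm
  have hw : w 0 ≠ w 1 := fun e => by simpa using h.inj e
  have a0 : G.Adj (c 0) (c (m - 1)) := by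
    have := h.adj (m - 1)
    rw [(h.eq_iff (m - 1 + 1) 0).2 (by rw [Nat.sub_add_cancel (by omega)]; simp)] at this
    exact this.symm
  have a1 := (h.adj_iff 0 (by omega) 0).2 rfl
  have a2 := (h.adj_iff (i - 1) (by omega) 1).2 (by simp; omega)
  have a3 := h.adj (i - 1)
  have a4 := h.adj (i - 2)
  rw [show i - 2 + 1 = i - 1 by omega] at a4
  rw [show i - 1 + 1 = i by omega] at a3
  refine above_of_two_stars (p := ![c 0, w 0, c 1, c (m - 1), c (i - 1), w 1, c (i - 2), c i])
    ?_ ?_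
  · intro s t
    fin_cases s <;> fin_cases t <;>
      simp (disch := omega) [hinj, hne, hne', hw, hw.symm] <;> omega
  · simp [a0, a1, a2, a3, a4.symm, h.adj 0]

/-- The stars at `u_1` and `u_3` share `u_2`, so explicit vectors are needed. The length `m = 6` is
left out because `Y_{8,3}` violates the conclusion. -/
theorem above_two_of_three [Fintype V] {w : Fin 2 → V}
    (h : IsPendantCycle G m ![1, 3] c w) (hm : m = 5 ∨ 7 ≤ m) : Above G 2 4 := by
  have hinj : ∀ i j, i < m → j < m → (c i = c j ↔ i = j) := by
    intro i j hi hj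
    rw [h.eq_iff, Nat.mod_eq_of_lt hi, Nat.mod_eq_of_lt hj]
  have hne := h.ne
  have hne' : ∀ i j, w j ≠ c i := fun i j e => h.ne i j e.symm
  have hw : w 0 ≠ w 1 := fun e => by simpa using h.inj e
  have a0 : G.Adj (c (m - 1)) (c 0) := by
    have := h.adj (m - 1)
    rwa [(h.eq_iff (m - 1 + 1) 0).2 (by rw [Nat.sub_add_cancel (by omega)]; simp)] at this
  have a1 := (h.adj_iff 0 (by omega) 0).2 rfl
  have a2 := (h.adj_iff 2 (by omega) 1).2 rfl
  have hcases : m = 5 ∨ m = 7 ∨ m = 8 ∨ 9 ≤ m := by omega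
  have hs := h.adj
  rcases hcases with rfl | rfl | rfl | hm9
  · refine above_Y_five (p := ![c 0, c 1, c 2, c 3, c 4, w 0, w 1]) ?_ ?_
    · intro s t
      fin_cases s <;> fin_cases t <;> simp (disch := omega) [hinj, hne, hne', hw, hw.symm]
    · simp [a1, a2, a0, hs 0, hs 1, hs 2, hs 3]
  · refine above_Y_seven (p := ![c 0, c 1, c 2, c 3, c 4, c 5, c 6, w 0, w 1]) ?_ ?_
    · intro s t
      fin_cases s <;> fin_cases t <;> simp (disch := omega) [hinj, hne, hne', hw, hw.symm]
    · simp [a1, a2, a0, hs 0, hs 1, hs 2, hs 3, hs 4, hs 5]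
  · refine above_Y_eight (p := ![c 0, c 1, c 2, c 3, c 4, c 5, c 6, c 7, w 0, w 1]) ?_ ?_
    · intro s t
      fin_cases s <;> fin_cases t <;> simp (disch := omega) [hinj, hne, hne', hw, hw.symm]
    · simp [a1, a2, a0, hs 0, hs 1, hs 2, hs 3, hs 4, hs 5, hs 6]
  -- For `m ≥ 9` the test vectors vanish at `c 5` and `c (m - 3)`, so the rest of the cycle plays no
  -- role.
  · have a3 := hs (m - 2)
    have a4 := hs (m - 3)
    rw [show m - 2 + 1 = m - 1 by omega] at a3
    rw [show m - 3 + 1 = m - 2 by omega] at a4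
    refine above_Y_nine_le (p := ![c 0, c 1, c 2, c 3, c 4, c 5, c (m - 3), c (m - 2), c (m - 1),
      w 0, w 1]) ?_ ?_
    · intro s t
      fin_cases s <;> fin_cases t <;>
        simp (disch := omega) [hinj, hne, hne', hw, hw.symm] <;> omega
    · simp [a1, a2, a0, a3, a4, hs 0, hs 1, hs 2, hs 3, hs 4]

end IsPendantCycle

end PendantCycle

end GirthLap

namespace GirthLap

open Finset SimpleGraph

instance : DecidableRel K23ss.Adj := fun a b => decidable_of_iff _ (K23ss_adj a b).symm

instance : DecidableRel K23sss.Adj := fun a b => decidable_of_iff _ (K23sss_adj a b).symm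

set_option maxRecDepth 4000 in
theorem K23ss_no_four : ∀ a b, K23ss.Adj a b → ∀ c, K23ss.Adj b c → a ≠ c →
    ∀ d, K23ss.Adj c d → b ≠ d → ¬K23ss.Adj d a := by
  decide

set_option maxRecDepth 4000 in
theorem K23sss_no_four : ∀ a b, K23sss.Adj a b → ∀ c, K23sss.Adj b c → a ≠ c →
    ∀ d, K23sss.Adj c d → b ≠ d → ¬K23sss.Adj d a := by
  decide

theorem K23sss_color {a b : Fin 8} (hab : K23sss.Adj a b) :
    (![true, false, false, false, false, true, true, true] a) =
      !(![true, false, false, false, false, true, true, true] b) := by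
  simp only [K23sss_adj] at hab
  revert a b
  decide

/-! ### Girth of the listed graphs, and the lower bounds. -/

section Listed

variable {V : Type*} {G : SimpleGraph V} {g : ℕ} {c : ℕ → V}

theorem five_le_of_iso_K23ss (h : ShortestCycle G g c) (e : G ≃g K23ss) : 5 ≤ g := by
  by_contra! hlt
  obtain rfl : g = 4 := by have := h.four_le; omega
  have hA : ∀ i, K23ss.Adj (e (c i)) (e (c (i + 1))) := fun i => e.map_adj_iff.2 (h.adj i)
  have hne : ∀ i j, i % 4 ≠ j % 4 → e (c i) ≠ e (c j) := fun i j hij he =>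
    hij ((h.eq_iff _ _).1 (e.injective he))
  refine K23ss_no_four _ _ (hA 0) _ (hA 1) (hne 0 2 (by norm_num)) _ (hA 2)
    (hne 1 3 (by norm_num)) ?_
  have := hA 3
  rwa [h.period 0] at this

theorem six_le_of_iso_K23sss (h : ShortestCycle G g c) (e : G ≃g K23sss) : 6 ≤ g := by
  by_contra! hlt
  have hA : ∀ i, K23sss.Adj (e (c i)) (e (c (i + 1))) := fun i => e.map_adj_iff.2 (h.adj i)
  have hg : g = 4 ∨ g = 5 := by have := h.four_le; omega
  rcases hg with rfl | rfl
  · have hne : ∀ i j, i % 4 ≠ j % 4 → e (c i) ≠ e (c j) := fun i j hij he =>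
      hij ((h.eq_iff _ _).1 (e.injective he))
    refine K23sss_no_four _ _ (hA 0) _ (hA 1) (hne 0 2 (by norm_num)) _ (hA 2)
      (hne 1 3 (by norm_num)) ?_
    have := hA 3
    rwa [h.period 0] at this
  -- A 5-cycle would flip the 2-colouring an odd number of times.
  · have h4 := hA 4
    rw [h.period 0] at h4
    have e0 := K23sss_color (hA 0)
    have e1 := K23sss_color (hA 1)
    have e2 := K23sss_color (hA 2)
    have e3 := K23sss_color (hA 3)
    have e4 := K23sss_color h4
    rw [e1, e2, e3, e4] at e0
    simp at e0

variable [Fintype V]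

/-- The list fixes `n` but not the girth, so `n = g + 2` has to be proved. For `K_{2,4}` and
`K_{2,3}^*` it follows from `4 ≤ g ≤ n - 2`; the other graphs need a lower bound on their girth. -/
theorem above_two_of_inList {n : ℕ} (hcard : Fintype.card V = n) (h : ShortestCycle G g c)
    (hg : G.girth = g) (hgn : g + 2 ≤ n) (hL : InList G n) : n = g + 2 ∧ Above G 2 4 := by
  have h4 := h.four_le
  rcases hL with ⟨rfl, hL⟩ | ⟨rfl, hL⟩ | ⟨rfl, hL⟩ | ⟨hn, i, hi, hin, ⟨e⟩⟩
  · rcases hL with ⟨⟨e⟩⟩ | ⟨⟨e⟩⟩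
    · refine ⟨by omega, above_K24 (p := e.symm ∘ ![.inl 0, .inl 1, .inr 0, .inr 1, .inr 2, .inr 3])
        (e.symm.injective.comp (by decide)) ?_⟩
      simp [e.symm.map_adj_iff]
    · refine ⟨by omega, above_K23s (p := e.symm) e.symm.injective fun q hq => ?_⟩
      rw [e.symm.map_adj_iff, K23s_adj]
      revert q
      decide
  · rcases hL with ⟨⟨e⟩⟩ | ⟨⟨e⟩⟩
    · refine ⟨by have := five_le_of_iso_K23ss h e; omega,
        above_K23ss (p := e.symm) e.symm.injective fun q hq => ?_⟩
      rw [e.symm.map_adj_iff, K23ss_adj]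
      revert q
      decide
    · obtain ⟨c', w, hp⟩ := exists_isPendantCycle (by norm_num) e
      refine ⟨?_, hp.above_two_of_three (by norm_num)⟩
      have := hp.le_girth (by norm_num) (by omega)
      omega
  · rcases hL with ⟨⟨e⟩⟩ | ⟨⟨e⟩⟩
    · refine ⟨by have := six_le_of_iso_K23sss h e; omega,
        above_of_two_stars (p := e.symm ∘ ![0, 2, 3, 4, 1, 5, 6, 7])
          (e.symm.injective.comp (by decide)) fun q hq => ?_⟩
      rw [Function.comp_apply, Function.comp_apply, e.symm.map_adj_iff, K23sss_adj]
      revert q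
      decide
    · obtain ⟨c', w, hp⟩ := exists_isPendantCycle (by norm_num) e
      refine ⟨?_, hp.above_two_of_four_le (by norm_num) (by norm_num)⟩
      have := hp.le_girth (by norm_num) (by omega)
      omega
  · obtain ⟨c', w, hp⟩ := exists_isPendantCycle (by omega) e
    have hle := hp.le_girth (by omega) (by omega)
    refine ⟨by omega, ?_⟩
    rcases hi.eq_or_lt with rfl | hi4
    · exact hp.above_two_of_three (by omega)
    · refine hp.above_two_of_four_le hi4 ?_
      have h1 : i - 1 < ⌈((n : ℝ) - 1) / 2⌉₊ := by omega
      rw [Nat.lt_ceil, lt_div_iff₀ (by norm_num), lt_sub_iff_add_lt] at h1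
      have h2 : (i - 1) * 2 + 1 < n := by exact_mod_cast h1
      omega

theorem above_one (hG : G.Connected) (h : ShortestCycle G g c) (hcard : g < Fintype.card V) :
    Above G 1 4 := by
  obtain ⟨x, hx, u, hu, hxu⟩ := exists_attached hG h hcard
  obtain ⟨c', hc', hr, rfl, -⟩ := h.exists_reparam hu hu
  rw [← hr] at hx
  have h4 := h.four_le
  have a0 : G.Adj (c' 0) (c' (g - 1)) := by
    have := hc'.adj (g - 1)
    rw [Nat.sub_add_cancel (by omega), show c' g = c' 0 by simpa using hc'.period 0] at this
    exact this.symm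
  have hne : ∀ i, c' i ≠ x := fun i hi => hx ⟨i, hi⟩
  have hne' : ∀ i, x ≠ c' i := fun i hi => hx ⟨i, hi.symm⟩
  have hinj : ∀ i j, i < g → j < g → (c' i = c' j ↔ i = j) := by
    intro i j hi hj
    rw [hc'.eq_iff, Nat.mod_eq_of_lt hi, Nat.mod_eq_of_lt hj]
  refine above_one_of_star (p := ![c' 0, x, c' 1, c' (g - 1)]) ?_ ?_
  · intro s t
    fin_cases s <;> fin_cases t <;> simp (disch := omega) [hinj, hne, hne'] <;> omega
  · simp [hxu.symm, hc'.adj 0, a0]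

end Listed

end GirthLap

/-! ### The theorem. -/

theorem theorem1p2 {V : Type*} [Fintype V] [DecidableEq V] (G : SimpleGraph V)
    [DecidableRel G.Adj] (hG : G.Connected) (n g k : ℕ) (hn : Fintype.card V = n)
    (hg : G.girth = g) (hg4 : 4 ≤ g) (hk : 1 ≤ k) (hk' : k ≤ min (g - 1) (n - g)) :
    GirthLap.lapCount G (Set.Icc ((n : ℝ) - g - k + 4) n) ≤ n - g ∧
    (k = 1 →
      (GirthLap.lapCount G (Set.Icc ((n : ℝ) - g - k + 4) n) = n - g ↔ g = n - 1) ∧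
      (g = n - 1 ↔ Nonempty (G ≃g completeBipartiteGraph (Fin 2) (Fin 3)) ∨
        Nonempty (G ≃g GirthLap.U n))) ∧
    (k = 2 →
      (GirthLap.lapCount G (Set.Icc ((n : ℝ) - g - k + 4) n) = n - g ↔
        GirthLap.InList G n)) := by
  obtain ⟨c, h⟩ := GirthLap.exists_shortestCycle hg hg4
  have hk1 : k ≤ g - 1 := hk'.trans (min_le_left _ _)
  have hk2 : k ≤ n - g := hk'.trans (min_le_right _ _)
  have hle : GirthLap.lapCount G (Set.Icc ((n : ℝ) - g - k + 4) n) ≤ n - g := by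
    -- The remaining `n - g - k` vertices raise both `k` conditions and threshold 4 by that amount,
    -- giving `n - g` and `n - g - k + 4`.
    have hb := GirthLap.below_of_forall_card (m := k) (b := k) (T := 4) hG h (by omega)
      fun W _ c' hW hc' hWc => GirthLap.below_four hW hc' hk (by omega) hWc
    have := GirthLap.lapCount_le_of_below G hb n
    rw [hn, Nat.cast_sub (by omega)] at this
    convert this using 1
    · congr 2
      push_cast
      ring
    · omega
  refine ⟨hle, ?_, ?_⟩
  · rintro rfl
    refine ⟨⟨fun heq => ?_, fun hgn => le_antisymm hle ?_⟩, fun hgn => ?_, ?_⟩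
    · by_contra hne
      -- For `n ≥ g + 2`, threshold 5 on `g + 2` vertices grows to the same `n - g + 3`, but with
      -- only `n - g - 1` conditions.
      have hb := GirthLap.below_of_forall_card (m := 2) (b := 1) (T := 5) hG h (by omega)
        fun W _ c' hW hc' hWc => GirthLap.below_one_five hW hc' hWc
      have := GirthLap.lapCount_le_of_below G hb n
      rw [hn, Nat.cast_sub (by omega), show (5 : ℝ) + ((n : ℝ) - (g + 2 : ℕ)) =
        (n : ℝ) - g - (1 : ℕ) + 4 by push_cast; ring, heq] at this
      omega
    · have ha := GirthLap.le_lapCount_of_above G (GirthLap.above_one hG h (by omega)) hn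
      rw [show (n : ℝ) - g - (1 : ℕ) + 4 = 4 by
        rw [hgn, Nat.cast_sub (by omega)]; push_cast; ring]
      omega
    · have := GirthLap.bipartite_or_pendant hG h (by omega)
      rwa [show g + 1 = n by omega] at this
    · rintro (⟨⟨e⟩⟩ | ⟨⟨e⟩⟩)
      · have := Fintype.card_congr e.toEquiv
        simp at this
        omega
      · obtain ⟨c', w, hp⟩ := GirthLap.exists_isPendantCycle (by omega) e
        have := hp.le_girth (by omega) (by omega)
        omega
  · rintro rfl
    refine ⟨fun heq => ?_, fun hL => le_antisymm hle ?_⟩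
    · have hn2 : n = g + 2 := by
        by_contra hne
        -- Threshold 5 on `g + 3` vertices grows to `n - g + 2`, again with one condition fewer than
        -- `n - g`.
        have hb := GirthLap.below_of_forall_card (m := 3) (b := 2) (T := 5) hG h (by omega)
          fun W _ c' _ hc' hWc => GirthLap.below_two_five hc' hWc
        have := GirthLap.lapCount_le_of_below G hb n
        rw [hn, Nat.cast_sub (by omega), show (5 : ℝ) + ((n : ℝ) - (g + 3 : ℕ)) =
          (n : ℝ) - g - (2 : ℕ) + 4 by push_cast; ring, heq] at this
        omega
      subst hn2
      rcases GirthLap.below_four_or_inList hG h hn with hb | hL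
      · have := GirthLap.lapCount_le_of_below G hb (g + 2 : ℕ)
        rw [show (4 : ℝ) = ((g + 2 : ℕ) : ℝ) - g - (2 : ℕ) + 4 by push_cast; ring, heq] at this
        omega
      · exact hL
    · obtain ⟨rfl, ha⟩ := GirthLap.above_two_of_inList hn h hg (by omega) hL
      have := GirthLap.le_lapCount_of_above G ha hn
      rw [show (4 : ℝ) = ((g + 2 : ℕ) : ℝ) - g - (2 : ℕ) + 4 by push_cast; ring] at this
      omega
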